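/- Let $0\le\alpha\le 1$ and $0\le\gamma\le\alpha$. The alpha-gamma trees $(T_n)_{n\ge1}$ are random rooted trees, whose root has degree one, with no vertices of degree two and with $n$ further degree-one vertices, the leaves, labelled by $\{1,\dots,n\}$. They are grown as follows: $T_1$ and $T_2$ are the unique such trees; given $T_n$, $n\ge2$, assign weight $1-\alpha$ to each edge adjacent to a leaf, weight $\gamma$ to every other edge (including the one at the root), and weight $(k-1)\alpha-\gamma$ to each vertex of degree $k+1\ge3$; select an edge or vertex with probability proportional to its weight, and attach the new leaf $n+1$ to a new vertex placed in the middle of the selected edge, or to the selected vertex, respectively. Let $T_n^\circ$ be the unlabelled tree underlying $T_n$, and for $n\ge2$ let $q^{\rm seq}_{\alpha,\gamma}(n_1,\dots,n_k)$, where $n_1\ge\dots\ge n_k\ge1$, $k\ge 2$, $n_1+\dots+n_k=n$, be the probability that the components above the branch point adjacent to the root of $T_n^\circ$ have $n_1,\dots,n_k$ leaves. (1) The splitting rules $q^{\rm seq}_{\alpha,\gamma}$ are sampling consistent. That is: $(T_n^\circ)_{n\ge1}$ is the Markov branching model with splitting rules $q^{\rm seq}_{\alpha,\gamma}$ (for $n\ge2$,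 given that the first split is $(n_1,\dots,n_k)$, the components are independent copies of $T_{n_1}^\circ,\dots,T_{n_k}^\circ$), and for every $n\ge 2$ removing a uniformly chosen leaf from $T_n^\circ$ (together with the adjacent branch point if its degree is reduced to $2$) yields a tree with the law of $T_{n-1}^\circ$. (2) Suppose $\alpha<1$. Let $\mathcal S^\downarrow=\{s=(s_i)_{i\ge1}: s_1\ge s_2\ge\dots\ge0,\ \sum_i s_i\le1\}$ and $$\nu_{\alpha,\gamma}(ds)=\Bigl(\gamma+(1-\alpha-\gamma)\sum_{i\ne j}s_is_j\Bigr)\,{\rm PD}^*_{\alpha,-\alpha-\gamma}(ds).$$ Here, for $0<\alpha<1$ and $\theta>-2\alpha$, ${\rm PD}^*_{\alpha,\theta}$ is the measure on $\mathcal S^\downarrow$ with $\int f\,d{\rm PD}^*_{\alpha,\theta}=\mathbb E\bigl[\sigma_1^{-\theta}f(\Delta\sigma_{[0,1]}/\sigma_1)\bigr]$, where $\sigma$ is an $\alpha$-stable subordinator with $\mathbb E[e^{-\lambda\sigma_1}]=e^{-\lambda^\alpha}$ and $\Delta\sigma_{[0,1]}$ is the ranked sequence of its jumps on $[0,1]$;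 and for $\theta=-2\alpha$, $0\le\alpha<1$, $\int f\,d{\rm PD}^*_{\alpha,-2\alpha}=\int_{1/2}^1 f(x,1-x,0,0,\dots)\,x^{-\alpha-1}(1-x)^{-\alpha-1}\,dx$. Then $\nu=\nu_{\alpha,\gamma}$ is a dislocation measure, i.e. $\nu(\{(1,0,0,\dots)\})=0$ and $\int_{\mathcal S^\downarrow}(1-s_1)\,\nu(ds)<\infty$; it satisfies $\nu(\{s:\sum_i s_i<1\})=0$; the constants $\widetilde Z_n=\int_{\mathcal S^\downarrow}\bigl(1-\sum_i s_i^n\bigr)\nu(ds)$, $n\ge2$, are positive and finite; and for all $k\ge2$ and $n_1,\dots,n_k\ge1$ with $n=n_1+\dots+n_k$, $$\frac{m_1!\cdots m_n!}{\binom{n}{n_1,\dots,n_k}}\;q^{\rm seq}_{\alpha,\gamma}\bigl((n_1,\dots,n_k)^\downarrow\bigr)=\frac1{\widetilde Z_n}\int_{\mathcal S^\downarrow}\ \sum_{\substack{i_1,\dots,i_k\ge1\\ \text{distinct}}}\ \prod_{j=1}^k s_{i_j}^{n_j}\ \nu(ds),$$ where $m_r$ is the number of $j$ with $n_j=r$ and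 $\downarrow$ denotes decreasing rearrangement. -/

import Mathlib

open MeasureTheory ProbabilityTheory
open scoped ENNReal Nat

namespace AlphaGamma

/-! ### Labelled trees and tree shapes -/

/-- Rooted combinatorial trees with labelled leaves. Below the root edge there is either a leaf, or
a vertex with `k` subtrees (a vertex of degree `k + 1`). The subtrees of a vertex are listed in
some order, which is forgotten when passing to shapes. -/
inductive LTree : Type
  | leaf (label : ℕ) : LTree
  | node (k : ℕ) (sub : Fin k → LTree) : LTree

namespace LTree

/-- The number of leaves. -/
def numLeaves : LTree → ℕ
  | leaf _ => 1
  | node _ c => ∑ j, numLeaves (c j)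

/-- Two trees have the same shape if they are isomorphic as rooted trees, ignoring leaf labels. -/
inductive SameShape : LTree → LTree → Prop
  | leaf (i j : ℕ) : SameShape (leaf i) (leaf j)
  | node {k : ℕ} {c d : Fin k → LTree} (e : Equiv.Perm (Fin k))
      (h : ∀ j, SameShape (c j) (d (e j))) : SameShape (node k c) (node k d)

theorem SameShape.refl : ∀ t : LTree, SameShape t t
  | .leaf i => .leaf i i
  | .node _ c => .node (Equiv.refl _) fun j => SameShape.refl (c j)

theorem SameShape.symm {t u : LTree} (h : SameShape t u) : SameShape u t := by
  induction h with
  | leaf i j => exact .leaf j i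
  | node e h ih =>
    refine .node e.symm fun j => ?_
    have := ih (e.symm j)
    rwa [Equiv.apply_symm_apply] at this

theorem SameShape.trans {t u v : LTree} (h : SameShape t u) (h' : SameShape u v) :
    SameShape t v := by
  induction h generalizing v with
  | leaf i j => cases h' with | leaf _ l => exact .leaf i l
  | node e h ih =>
    cases h' with
    | node e' g => exact .node (e.trans e') fun j => ih j (g (e j))

instance shapeSetoid : Setoid LTree where
  r := SameShape
  iseqv := ⟨SameShape.refl, SameShape.symm, SameShape.trans⟩

/-- The possible results of inserting a new leaf, each with its weight: weight `1 - α` for every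
edge above a leaf, weight `γ` for every other edge, and weight `(k - 1) α - γ` for every vertex
with `k` subtrees. Each vertex or leaf is considered together with the edge above it. Insertion
into an edge puts a new binary vertex on that edge and attaches the new leaf there; insertion at a
vertex attaches the new leaf to that vertex. -/
noncomputable def insertions (α γ : ℝ) (new : ℕ) : LTree → Multiset (ℝ × LTree)
  | leaf i => {(1 - α, node 2 ![leaf i, leaf new])}
  | node k c =>
      {(γ, node 2 ![node k c, leaf new])} +
      {(((k : ℝ) - 1) * α - γ, node (k + 1) (Fin.snoc c (leaf new)))} +
      ∑ j : Fin k, (insertions α γ new (c j)).map fun p =>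
        (p.1, node k (Function.update c j p.2))

/-- The tree whose vertex above the subtrees `c` is suppressed if only one subtree is left. -/
def collapse : (m : ℕ) → (Fin m → LTree) → LTree
  | 1, c => c 0
  | m, c => node m c

/-- `removeFrom c j o`: the `j`th subtree of a vertex with subtrees `c` has been changed to `o`,
where `none` means that this subtree has disappeared. -/
def removeFrom : {k : ℕ} → (Fin k → LTree) → Fin k → Option LTree → LTree
  | m + 1, c, j, none => collapse m fun i => c (j.succAbove i)
  | m + 1, c, j, some t => node (m + 1) (Function.update c j t)

/-- The results of removing one leaf (together with the adjacent vertex if its degree is reduced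
to 2), listed with one entry for each leaf. Removing the leaf of a one-leaf tree gives `none`. -/
def removals : LTree → Multiset (Option LTree)
  | leaf _ => {none}
  | node _ c => ∑ j, (removals (c j)).map fun o => some (removeFrom c j o)

end LTree

open LTree

/-- Tree shapes, that is, unlabelled trees. -/
abbrev Shape : Type := Quotient LTree.shapeSetoid

namespace Shape

/-- The one-leaf tree. -/
def single : Shape := ⟦leaf 1⟧

/-- The tree formed by joining together the trees of a list at a new vertex. -/
noncomputable def join (l : List Shape) : Shape :=
  ⟦node l.length fun j => (l.get j).out⟧

theorem numLeaves_eq {t u : LTree} (h : SameShape t u) : t.numLeaves = u.numLeaves := by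
  induction h with
  | leaf i j => rfl
  | node e h ih =>
    simp only [LTree.numLeaves]
    exact Fintype.sum_equiv e _ _ ih

/-- The first split: the numbers of leaves in the subtrees of the vertex adjacent to the root. A
multiset stands for its decreasing rearrangement. -/
def firstSplit : Shape → Multiset ℕ :=
  Quotient.lift
    (fun t => match t with
      | leaf _ => 0
      | node k c => (Finset.univ : Finset (Fin k)).val.map fun j => (c j).numLeaves)
    (by
      intro t u h
      cases (h : SameShape t u) with
      | leaf i j => rfl
      | @node k c d e h =>
        have h1 : (fun j => (c j).numLeaves) = (fun j => (d j).numLeaves) ∘ e :=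
          funext fun j => numLeaves_eq (h j)
        show Multiset.map _ _ = Multiset.map _ _
        rw [h1, ← Multiset.map_map]
        congr 1
        simp)

theorem collapse_congr {m : ℕ} {c d : Fin m → LTree} (e : Equiv.Perm (Fin m))
    (h : ∀ j, SameShape (c j) (d (e j))) : SameShape (collapse m c) (collapse m d) := by
  match m, c, d, e, h with
  | 0, c, d, e, h => exact .node e h
  | 1, c, d, e, h =>
    have := h 0
    rwa [Subsingleton.elim (e 0) 0] at this
  | m + 2, c, d, e, h => exact .node e h

theorem removeFrom_congr {k : ℕ} {c d : Fin k → LTree} (e : Equiv.Perm (Fin k))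
    (h : ∀ j, SameShape (c j) (d (e j))) (j : Fin k) {o o' : Option LTree}
    (ho : o.map (Quotient.mk shapeSetoid) = o'.map (Quotient.mk shapeSetoid)) :
    (⟦removeFrom c j o⟧ : Shape) = ⟦removeFrom d (e j) o'⟧ := by
  apply Quotient.sound
  change SameShape _ _
  match k, c, d, e, h, j, o, o', ho with
  | m + 1, c, d, e, h, j, some t, some t', ho =>
    have ht : SameShape t t' := Quotient.exact (Option.some.inj ho)
    refine .node e fun i => ?_
    by_cases hi : i = j
    · subst hi
      simpa using ht
    · rw [Function.update_of_ne hi, Function.update_of_ne (fun h' => hi (e.injective h'))]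
      exact h i
  | m + 1, c, d, e, h, j, none, none, _ =>
    let e' : Equiv.Perm (Fin m) :=
      ((finSuccAboveEquiv j).trans
        (e.subtypeEquiv (p := fun x => x ≠ j) (q := fun x => x ≠ e j)
          fun a => by simp)).trans (finSuccAboveEquiv (e j)).symm
    have he : ∀ i, (e j).succAbove (e' i) = e (j.succAbove i) := fun i => by
      have := congrArg Subtype.val
        ((finSuccAboveEquiv (e j)).apply_symm_apply
          (e.subtypeEquiv (p := fun x => x ≠ j) (q := fun x => x ≠ e j)
            (fun a => by simp) (finSuccAboveEquiv j i)))
      exact this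
    refine collapse_congr e' fun i => ?_
    rw [he]
    exact h _

theorem removals_congr {t u : LTree} (h : SameShape t u) :
    t.removals.map (Option.map (Quotient.mk shapeSetoid)) =
      u.removals.map (Option.map (Quotient.mk shapeSetoid)) := by
  induction h with
  | leaf i j => rfl
  | @node k c d e h ih =>
    have aux : ∀ (c : Fin k → LTree), Multiset.map (Option.map (Quotient.mk shapeSetoid))
        (LTree.node k c).removals = ∑ j, (c j).removals.map
          fun o => some (Quotient.mk shapeSetoid (removeFrom c j o)) := fun c => by
      change Multiset.mapAddMonoidHom _ _ = _
      simp only [LTree.removals]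
      rw [map_sum]
      simp [Multiset.map_map]
    rw [aux, aux]
    refine Fintype.sum_equiv e _ _ fun j => ?_
    let F : Option Shape → Option Shape := fun o =>
      some (Quotient.mk shapeSetoid (removeFrom c j (o.map Quotient.out)))
    have out : ∀ o : Option LTree, ((o.map (Quotient.mk shapeSetoid)).map Quotient.out).map
        (Quotient.mk shapeSetoid) = o.map (Quotient.mk shapeSetoid) := fun o => by
      cases o <;> simp
    have hr : ∀ j, SameShape (c j) (c (Equiv.refl (Fin k) j)) := fun j => SameShape.refl _
    have h1 : (fun o => some (Quotient.mk shapeSetoid (removeFrom c j o))) =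
        F ∘ Option.map (Quotient.mk shapeSetoid) := funext fun o =>
      congrArg some (removeFrom_congr (Equiv.refl _) hr j (out o).symm)
    have h2 : (fun o => some (Quotient.mk shapeSetoid (removeFrom d (e j) o))) =
        F ∘ Option.map (Quotient.mk shapeSetoid) := funext fun o =>
      congrArg some (removeFrom_congr e h j (out o)).symm
    rw [h1, h2, ← Multiset.map_map, ← Multiset.map_map, ih j]

/-- The shapes that result from removing one leaf, one entry for each leaf (for trees with at least
two leaves; a one-leaf tree leaves nothing behind). -/
def removals : Shape → Multiset Shape :=
  Quotient.lift
    (fun t => (t.removals.map (Option.map (Quotient.mk shapeSetoid))).filterMap id)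
    (fun _ _ h => congrArg _ (removals_congr h))

open Classical in
/-- The law of the tree obtained by removing a uniformly chosen leaf, together with the adjacent
vertex if its degree is reduced to 2. (For trees with at least two leaves; a one-leaf tree is left
unchanged by convention.) -/
noncomputable def deleteLeaf (s : Shape) : PMF Shape :=
  if h : s.removals = 0 then PMF.pure s else PMF.ofMultiset s.removals h

end Shape

/-! ### Alpha-gamma trees -/

open Classical in
/-- The total weight that a weighted multiset gives to `b`; negative weights count as `0`. -/
noncomputable def weightOf {β : Type} (m : Multiset (ℝ × β)) (b : β) : ℝ≥0∞ :=
  (m.map fun p => if p.2 = b then ENNReal.ofReal p.1 else 0).sum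

open Classical in
/-- Random selection from a weighted multiset with probabilities proportional to the weights
(and `d` in the degenerate case where this makes no sense). -/
noncomputable def selectProportional {β : Type} (m : Multiset (ℝ × β)) (d : β) : PMF β :=
  if h : ∑' b, weightOf m b ≠ 0 ∧ ∑' b, weightOf m b ≠ ∞ then
    PMF.normalize (weightOf m) h.1 h.2
  else PMF.pure d

/-- The law of the labelled alpha-gamma tree `Tₙ`, for `n ≥ 1`: `T₁` and `T₂` are deterministic,
and `Tₙ₊₁` arises from `Tₙ`, `n ≥ 2`, by inserting leaf `n + 1` at an edge or a vertex selected with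
probability proportional to its weight. (The value at `0` is a convention.) -/
noncomputable def treeLaw (α γ : ℝ) : ℕ → PMF LTree
  | 0 => PMF.pure (leaf 1)
  | 1 => PMF.pure (leaf 1)
  | 2 => PMF.pure (node 2 ![leaf 1, leaf 2])
  | n + 3 => (treeLaw α γ (n + 2)).bind fun t =>
      selectProportional (insertions α γ (n + 3) t) t

/-- The law of the delabelled alpha-gamma tree `Tₙ°`. -/
noncomputable def shapeLaw (α γ : ℝ) (n : ℕ) : PMF Shape :=
  (treeLaw α γ n).map (Quotient.mk shapeSetoid)

/-- The alpha-gamma splitting rule: the law of the first split of `Tₙ°`. -/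
noncomputable def splittingRule (α γ : ℝ) (n : ℕ) : PMF (Multiset ℕ) :=
  (shapeLaw α γ n).map Shape.firstSplit

/-- The joint law, as a list, of independent random variables with the given laws. -/
noncomputable def independent {β : Type} : List (PMF β) → PMF (List β)
  | [] => PMF.pure []
  | p :: ps => p.bind fun b => (independent ps).map fun l => b :: l

/-- `Pₙ`, `n ≥ 1`, are the laws of the Markov branching trees with splitting rule `q`: for `n ≥ 2`,
`Pₙ` is the law of the tree formed by joining together trees that, given that the first split drawn
from `qₙ` has parts `n₁ ≥ … ≥ nₖ`, are independent with laws `P_{n₁}, …, P_{nₖ}`. -/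
def IsMarkovBranching (P : ℕ → PMF Shape) (q : ℕ → PMF (Multiset ℕ)) : Prop :=
  P 1 = PMF.pure Shape.single ∧
  ∀ n, 2 ≤ n → P n =
    (q n).bind fun m => (independent ((m.sort (· ≥ ·)).map P)).map Shape.join

/-- Sampling consistency: removing a uniformly chosen leaf from a tree with law `Pₙ` gives a tree
with law `Pₙ₋₁`. -/
def SamplingConsistent (P : ℕ → PMF Shape) : Prop :=
  ∀ n, 2 ≤ n → (P n).bind Shape.deleteLeaf = P (n - 1)

/-- The EPPF `p(n₁, …, nₖ)` of a splitting rule `q`, that is,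
`m₁! ⋯ mₙ! / (n choose n₁, …, nₖ) * q((n₁, …, nₖ)↓)` where `mᵣ` is the number of `j` with `nⱼ = r`
and `n = n₁ + ⋯ + nₖ`. -/
noncomputable def eppf (q : ℕ → PMF (Multiset ℕ)) {k : ℕ} (parts : Fin k → ℕ) : ℝ≥0∞ :=
  ((∏ r ∈ Finset.Icc 1 (∑ j, parts j), (Finset.univ.filter fun j => parts j = r).card ! : ℕ) : ℝ≥0∞)
    / (Nat.multinomial Finset.univ parts : ℝ≥0∞)
    * q (∑ j, parts j) (Finset.univ.val.map parts)

/-! ### Dislocation measures -/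

/-- The space of nonincreasing sequences `s₁ ≥ s₂ ≥ … ≥ 0` with `s₁ + s₂ + ⋯ ≤ 1` (so all terms are
finite); the first term has index `0`. -/
def RankedSeq : Set (ℕ → ℝ≥0∞) := {s | Antitone s ∧ ∑' i, s i ≤ 1}

/-- Dislocation measures: measures on the space of ranked sequences that do not charge
`(1, 0, 0, …)` and integrate `1 - s₁`. -/
def IsDislocationMeasure (ν : Measure (ℕ → ℝ≥0∞)) : Prop :=
  ν RankedSeqᶜ = 0 ∧ ν {fun i => if i = 0 then 1 else 0} = 0 ∧ ∫⁻ s, (1 - s 0) ∂ν < ∞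

/-- The constant `Zₙ = ∫ (1 - ∑ᵢ sᵢⁿ) ν(ds)`. -/
noncomputable def kingmanConst (ν : Measure (ℕ → ℝ≥0∞)) (n : ℕ) : ℝ≥0∞ :=
  ∫⁻ s, (1 - ∑' i, s i ^ n) ∂ν

/-- The integral representation (without erosion) of a splitting rule `q` by a dislocation measure
`ν` concentrated on sequences with sum `1`: for all `k ≥ 2` and `n₁, …, nₖ ≥ 1` with sum `n`,
`p(n₁, …, nₖ) = (1 / Zₙ) ∫ ∑ s_{i₁}^{n₁} ⋯ s_{iₖ}^{nₖ} ν(ds)`, with the sum over all distinct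
`i₁, …, iₖ`, where the constants `Zₙ`, `n ≥ 2`, are positive and finite. -/
def HasIntegralRepresentation (q : ℕ → PMF (Multiset ℕ)) (ν : Measure (ℕ → ℝ≥0∞)) : Prop :=
  IsDislocationMeasure ν ∧ ν {s | ∑' i, s i < 1} = 0 ∧
  (∀ n, 2 ≤ n → kingmanConst ν n ≠ 0 ∧ kingmanConst ν n ≠ ∞) ∧
  ∀ (k : ℕ) (parts : Fin k → ℕ), 2 ≤ k → (∀ j, 1 ≤ parts j) →
    eppf q parts = (kingmanConst ν (∑ j, parts j))⁻¹ *
      ∫⁻ s, (∑' i : Fin k ↪ ℕ, ∏ j, s (i j) ^ parts j) ∂ν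

/-! ### Poisson-Dirichlet measures -/

/-- The `i`th largest jump over the time interval `[0, 1]` of the `α`-stable subordinator with
Laplace exponent `x ↦ x ^ α`, `0 < α < 1`, as a function of independent standard exponential
variables `E₀, E₁, …`. The jumps are the points of a Poisson process on `(0, ∞)` whose intensity is
the Lévy measure `α / Γ(1 - α) * x ^ (-α - 1) dx`, with tail `x ↦ x ^ (-α) / Γ(1 - α)`; the ranked
points are obtained by applying the inverse of the tail function to the successive arrival times
`E₀ + ⋯ + Eᵢ` of a standard Poisson process. -/
noncomputable def stableJump (α : ℝ) (E : ℕ → ℝ) (i : ℕ) : ℝ≥0∞ :=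
  ENNReal.ofReal ((Real.Gamma (1 - α) * ∑ j ∈ Finset.range (i + 1), E j) ^ (-1 / α))

/-- The value at time `1` of the stable subordinator, which is the sum of its jumps. -/
noncomputable def stableValue (α : ℝ) (E : ℕ → ℝ) : ℝ≥0∞ := ∑' i, stableJump α E i

open Classical in
/-- The (extended) Poisson-Dirichlet measure `PD*_{α,θ}`. For `0 < α < 1` and `θ > -2α` it is the
measure with integrals `E(σ₁^(-θ) f(Δσ / σ₁))`, with `Δσ` the ranked jumps over `[0, 1]` of the
`α`-stable subordinator `σ`. For `α < 1` and `θ = -2α` it is the measure with integrals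
`∫_{1/2}^1 f(x, 1 - x, 0, 0, …) x^(-α-1) (1-x)^(-α-1) dx`. -/
noncomputable def PDStar (α θ : ℝ) : Measure (ℕ → ℝ≥0∞) :=
  if θ = -2 * α then
    ((volume.restrict (Set.Ioo (1 / 2 : ℝ) 1)).withDensity fun x =>
        ENNReal.ofReal (x ^ (-α - 1) * (1 - x) ^ (-α - 1))).map
      fun x i => if i = 0 then ENNReal.ofReal x else if i = 1 then ENNReal.ofReal (1 - x) else 0
  else
    ((Measure.infinitePi fun _ : ℕ => expMeasure 1).withDensity fun E =>
        stableValue α E ^ (-θ)).map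
      fun E i => stableJump α E i / stableValue α E

/-- The measure `(γ + (1 - α - γ) ∑_{i ≠ j} sᵢ sⱼ) PD*_{α,-α-γ}(ds)`. -/
noncomputable def alphaGammaMeasure (α γ : ℝ) : Measure (ℕ → ℝ≥0∞) :=
  (PDStar α (-α - γ)).withDensity fun s =>
    ENNReal.ofReal (γ + (1 - α - γ) * (∑' i, ∑' j, if i = j then 0 else s i * s j).toReal)

end AlphaGamma

/-!
The tree shapes form a type of finite multisets of smaller shapes, and insertion and removal of
leaves act on it by two operators on functions: `Shape.up`, the sum over all insertions with their
weights, and `Shape.down`, the sum over all removals. The law of the tree with `n + 1` leaves is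
`(n - α)⁻¹` times the law of the tree with `n` leaves followed by `Shape.up`, where `n - α` is the
total insertion weight (`expect_shapeLaw_succ`).

*Sampling consistency.* By induction on trees, the operators satisfy the commutation relation
`up ∘ down = down ∘ up + (2 n - α)` on trees with `n` leaves (`Shape.up_down`). The disappearance of
a subtree is included by giving the empty subtree the weight `-α`, which is the loss of weight of
its parent vertex. By induction on `n`, the sum over all removals from the tree with `n + 1` leaves
has expectation `n + 1` times that for the tree with `n` leaves (`expect_down`).

*Markov branching.* An insertion at the root edge or at the first branch point only adds a one-leaf
component, and the total weight of a component with `x` leaves is `x - α`, so that growth preserves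
the conditional independence of the components given the first split (`expect_shapeLaw_eq`). The
resulting recursion for the first split is solved by an explicit formula (`eppf_splittingRule`):
the EPPF is a product of weights of the parts, a weight depending on the number of parts, and the
factor `γ n (n - 1) + (1 - α - γ) ∑_{i ≠ j} nᵢ nⱼ`.

*Integral representation.* Suppose that a measure on sequences with sum `1` has moments over
distinct indices `w k * ∏ⱼ Γ(nⱼ - α) / Γ(n + ϑ)`, up to a constant, with `ϑ = -α - γ`
(`HasGibbsMoments`). As the sequences have sum `1`, the weights `w k` satisfy a recursion, which
determines them up to a constant. On these sequences `∑_{i ≠ j} sᵢ sⱼ = 1 - ∑ sᵢ²`, so the moments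
of the measure with the density of the theorem follow by multiplying out, and they agree with the
explicit splitting rule (`HasGibbsMoments.hasIntegralRepresentation`).

It remains to compute the moments of the Poisson-Dirichlet measures. For `γ = α` they are Beta
integrals (`hasGibbsMoments_binaryMeasure`). For `γ < α` the negative power of the value of the
stable subordinator is a Gamma integral of exponentials, which reduces the moments to expectations
of sums over distinct points of a Poisson process of functionals that are products over the points.
These are evaluated by the Mecke equation (`lintegral_tsum_arrival`, `lintegral_tsum_embedding`),
which is proved directly for the arrival times that represent the process: given the other
arrivals, an arrival is uniform on the interval between its neighbours
(`lintegral_arrival_skip`). The Laplace transform of the subordinator enters the moments only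
through `w k` and need not be known.
-/

namespace AlphaGamma

open LTree

/-! ### Shapes as multisets of shapes -/

theorem exists_perm_of_map_univ_eq {ι β : Type*} [Fintype ι] {f g : ι → β}
    (h : Finset.univ.val.map f = Finset.univ.val.map g) :
    ∃ e : Equiv.Perm ι, ∀ j, f j = g (e j) := by
  classical
  have key : ∀ b, Nonempty ({a // f a = b} ≃ {a // g a = b}) := fun b => by
    have := congrArg (Multiset.count b) h
    rw [Multiset.count_map, Multiset.count_map] at this
    refine ⟨Fintype.equivOfCardEq ?_⟩
    rw [Fintype.card_subtype, Fintype.card_subtype]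
    simpa [Finset.card, eq_comm] using this
  exact ⟨Equiv.ofFiberEquiv fun b => (key b).some, fun j => (Equiv.ofFiberEquiv_map _ j).symm⟩

/-- All ways of singling out one element of a multiset: the pairs `(s, M - s)`, with
multiplicity. -/
noncomputable def pick {β : Type*} (M : Multiset β) : Multiset (β × Multiset β) :=
  open Classical in M.map fun s => (s, M.erase s)

@[simp]
theorem pick_zero {β : Type*} : pick (0 : Multiset β) = 0 := rfl

theorem pick_cons {β : Type*} (a : β) (M : Multiset β) :
    pick (a ::ₘ M) = (a, M) ::ₘ (pick M).map fun p => (p.1, a ::ₘ p.2) := by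
  classical
  unfold pick
  rw [Multiset.map_cons, Multiset.erase_cons_head, Multiset.map_map]
  congr 1
  refine Multiset.map_congr rfl fun s hs => ?_
  simp only [Function.comp_apply, Prod.mk.injEq, true_and]
  by_cases h : a = s
  · subst h
    rw [Multiset.erase_cons_head, Multiset.cons_erase hs]
  · exact Multiset.erase_cons_tail M h

@[simp]
theorem pick_singleton {β : Type*} (a : β) : pick ({a} : Multiset β) = {(a, 0)} := by
  rw [← Multiset.cons_zero a, pick_cons]
  rfl

theorem cons_of_mem_pick {β : Type*} {M : Multiset β} {p : β × Multiset β} (h : p ∈ pick M) :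
    p.1 ::ₘ p.2 = M := by
  classical
  obtain ⟨s, hs, rfl⟩ := Multiset.mem_map.1 h
  exact Multiset.cons_erase hs

theorem pick_map {β δ : Type*} (f : β → δ) (M : Multiset β) :
    pick (M.map f) = (pick M).map fun p => (f p.1, p.2.map f) := by
  induction M using Multiset.induction with
  | empty => rfl
  | cons a M ih =>
    rw [Multiset.map_cons, pick_cons, pick_cons, ih]
    simp [Multiset.map_map]

theorem map_fst_pick {β : Type*} (M : Multiset β) : (pick M).map Prod.fst = M := by
  classical
  simp [pick, Multiset.map_map]

theorem pick_univ {ι : Type*} [Fintype ι] [DecidableEq ι] :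
    pick (Finset.univ : Finset ι).val =
      Finset.univ.val.map fun j => (j, Finset.univ.val.erase j) := by
  unfold pick
  refine Multiset.map_congr rfl fun s _ => ?_
  congr!

namespace Shape

/-- The tree whose root edge leads to a vertex with the given multiset of subtrees. -/
noncomputable def graft (M : Multiset Shape) : Shape := join M.toList

theorem mk_node {k : ℕ} (c : Fin k → LTree) :
    (⟦node k c⟧ : Shape) = graft (Finset.univ.val.map fun j => (⟦c j⟧ : Shape)) := by
  set M := Finset.univ.val.map fun j => (⟦c j⟧ : Shape) with hM
  have hl : M.toList.length = k := by simp [hM]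
  generalize hL : M.toList = l at hl
  subst hl
  rw [graft, hL]
  have h : Finset.univ.val.map (fun j => (⟦c j⟧ : Shape)) = Finset.univ.val.map l.get := by
    rw [← hM, Fin.univ_val_map, List.ofFn_get, ← hL, Multiset.coe_toList]
  obtain ⟨e, he⟩ := exists_perm_of_map_univ_eq h
  refine Quotient.sound (SameShape.node e fun j => ?_)
  refine Quotient.exact (s := shapeSetoid) ?_
  rw [he j, Quotient.out_eq]

theorem join_eq_graft (l : List Shape) : join l = graft l := by
  rw [join, mk_node]
  simp only [Quotient.out_eq]
  rw [Fin.univ_val_map, List.ofFn_get]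

theorem mk_leaf (i : ℕ) : (⟦leaf i⟧ : Shape) = single := Quotient.sound (SameShape.leaf i 1)

theorem induction {P : Shape → Prop} (h1 : P single)
    (h2 : ∀ M : Multiset Shape, (∀ s ∈ M, P s) → P (graft M)) (s : Shape) : P s := by
  induction s using Quotient.ind with
  | _ t =>
    induction t with
    | leaf i => rw [mk_leaf]; exact h1
    | node k c ih =>
      rw [mk_node]
      refine h2 _ fun s hs => ?_
      obtain ⟨j, -, rfl⟩ := Multiset.mem_map.1 hs
      exact ih j

/-- The number of leaves of a shape. -/
def size : Shape → ℕ := Quotient.lift LTree.numLeaves fun _ _ h => numLeaves_eq h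

@[simp]
theorem size_single : size single = 1 := rfl

@[simp]
theorem size_graft (M : Multiset Shape) : size (graft M) = (M.map size).sum := by
  rw [graft, join]
  conv_rhs => rw [← Multiset.coe_toList M, ← List.ofFn_get M.toList, ← Fin.univ_val_map]
  rw [Multiset.map_map]
  change (∑ j : Fin M.toList.length, LTree.numLeaves (M.toList.get j).out) =
    ∑ j : Fin M.toList.length, size (M.toList.get j)
  refine Finset.sum_congr rfl fun j _ => ?_
  exact congrArg size (Quotient.out_eq (M.toList.get j))

@[simp]
theorem firstSplit_graft (M : Multiset Shape) : firstSplit (graft M) = M.map size := by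
  rw [graft, join]
  conv_rhs => rw [← Multiset.coe_toList M, ← List.ofFn_get M.toList, ← Fin.univ_val_map]
  rw [Multiset.map_map]
  change (Finset.univ : Finset (Fin M.toList.length)).val.map _ = _
  refine Multiset.map_congr rfl fun j _ => ?_
  exact congrArg size (Quotient.out_eq (M.toList.get j))

/-! ### Inserting and removing leaves of shapes -/

theorem map_mk_update {k : ℕ} (c : Fin k → LTree) (j : Fin k) (t : LTree) :
    Finset.univ.val.map (fun i => (⟦Function.update c j t i⟧ : Shape)) =
      ⟦t⟧ ::ₘ (Finset.univ.val.erase j).map fun i => (⟦c i⟧ : Shape) := by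
  have : (Finset.univ : Finset (Fin k)).val = j ::ₘ Finset.univ.val.erase j :=
    (Multiset.cons_erase (by simp)).symm
  conv_lhs => rw [this]
  rw [Multiset.map_cons, Function.update_self]
  congr 1
  refine Multiset.map_congr rfl fun i hi => ?_
  rw [Function.update_of_ne]
  rintro rfl
  exact (Multiset.Nodup.notMem_erase Finset.univ.nodup) hi

theorem map_succAbove {β : Type*} {m : ℕ} (j : Fin (m + 1)) (f : Fin (m + 1) → β) :
    Finset.univ.val.map (fun i => f (j.succAbove i)) = (Finset.univ.val.erase j).map f := by
  have h : (Finset.univ : Finset (Fin (m + 1))).val.erase j =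
      (Finset.univ : Finset (Fin m)).val.map j.succAbove := by
    rw [← Finset.erase_val, ← Finset.compl_singleton, ← Fin.image_succAbove_univ,
      Finset.image_val_of_injOn]
    exact Fin.succAbove_right_injective.injOn
  rw [h, Multiset.map_map]
  rfl

/-- The weighted shapes obtained by inserting a leaf into a labelled tree. -/
noncomputable def insertionsMk (α γ : ℝ) (new : ℕ) (t : LTree) : Multiset (ℝ × Shape) :=
  (LTree.insertions α γ new t).map fun p => (p.1, ⟦p.2⟧)

theorem insertionsMk_leaf (α γ : ℝ) (new i : ℕ) :
    insertionsMk α γ new (leaf i) = {(1 - α, graft {single, single})} := by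
  simp only [insertionsMk, LTree.insertions, Multiset.map_singleton]
  rw [mk_node]
  simp [Fin.univ_val_map, mk_leaf]
  rfl

theorem insertionsMk_node (α γ : ℝ) (new k : ℕ) (c : Fin k → LTree) (M : Multiset Shape)
    (hM : Finset.univ.val.map (fun j => (⟦c j⟧ : Shape)) = M) :
    insertionsMk α γ new (node k c) =
      {(γ, graft {graft M, single})} +
      {(((M.card : ℝ) - 1) * α - γ, graft (single ::ₘ M))} +
      ∑ j : Fin k, (insertionsMk α γ new (c j)).map fun p =>
        (p.1, graft (p.2 ::ₘ (Finset.univ.val.erase j).map fun i => (⟦c i⟧ : Shape))) := by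
  have hk : M.card = k := by simp [← hM]
  simp only [insertionsMk, LTree.insertions, Multiset.map_add, Multiset.map_singleton]
  congr 1
  · congr 1
    · rw [mk_node]
      simp only [Fin.univ_val_map, List.ofFn_succ, List.ofFn_zero]
      simp only [Matrix.cons_val_zero, Matrix.cons_val_succ, mk_leaf, mk_node, hM]
      rfl
    · rw [mk_node, hk, Fin.univ_val_map, List.ofFn_succ']
      simp only [Fin.snoc_castSucc, Fin.snoc_last, mk_leaf]
      rw [← hM, Fin.univ_val_map]
      congr 3
      simp only [List.concat_eq_append]
      rw [← Multiset.coe_add, Multiset.add_comm]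
      rfl
  · change Multiset.mapAddMonoidHom _ _ = _
    rw [map_sum]
    refine Finset.sum_congr rfl fun j _ => ?_
    simp only [Multiset.coe_mapAddMonoidHom, Multiset.map_map, Function.comp_def]
    refine Multiset.map_congr rfl fun p _ => ?_
    rw [mk_node, map_mk_update]

theorem insertionsMk_congr (α γ : ℝ) (new new' : ℕ) {t u : LTree} (h : SameShape t u) :
    insertionsMk α γ new t = insertionsMk α γ new' u := by
  induction h with
  | leaf i j => rw [insertionsMk_leaf, insertionsMk_leaf]
  | @node k c d e h ih =>
    have hcd : (fun j => (⟦c j⟧ : Shape)) = (fun j => (⟦d j⟧ : Shape)) ∘ e :=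
      funext fun j => Quotient.sound (h j)
    have he : ∀ j, ((Finset.univ.val.erase j).map fun i => (⟦c i⟧ : Shape)) =
        (Finset.univ.val.erase (e j)).map fun i => (⟦d i⟧ : Shape) := fun j => by
      rw [hcd, ← Multiset.map_map, Multiset.map_erase _ e.injective]
      simp
    rw [insertionsMk_node α γ new k c _ rfl, insertionsMk_node α γ new' k d
      (Finset.univ.val.map (fun j => (⟦c j⟧ : Shape)))]
    · congr 1
      refine Fintype.sum_equiv e _ _ fun j => ?_
      rw [ih j, he j]
    · rw [hcd, ← Multiset.map_map]
      simp

/-- The weighted shapes obtained by inserting a leaf. -/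
noncomputable def insertions (α γ : ℝ) : Shape → Multiset (ℝ × Shape) :=
  Quotient.lift (insertionsMk α γ 0) fun _ _ h => insertionsMk_congr α γ 0 0 h

theorem insertions_mk (α γ : ℝ) (new : ℕ) (t : LTree) :
    insertions α γ ⟦t⟧ = (LTree.insertions α γ new t).map fun p => (p.1, ⟦p.2⟧) :=
  insertionsMk_congr α γ 0 new (SameShape.refl t)

theorem insertions_single (α γ : ℝ) :
    insertions α γ single = {(1 - α, graft {single, single})} := insertionsMk_leaf α γ 0 1

theorem exists_map_mk (M : Multiset Shape) : ∃ (k : ℕ) (c : Fin k → LTree),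
    Finset.univ.val.map (fun j => (⟦c j⟧ : Shape)) = M := by
  refine ⟨M.toList.length, fun j => (M.toList.get j).out, ?_⟩
  simp only [Quotient.out_eq]
  rw [Fin.univ_val_map, List.ofFn_get, Multiset.coe_toList]

theorem pick_map_univ {k : ℕ} (c : Fin k → LTree) :
    pick (Finset.univ.val.map fun j => (⟦c j⟧ : Shape)) = Finset.univ.val.map fun j =>
      ((⟦c j⟧ : Shape), (Finset.univ.val.erase j).map fun i => (⟦c i⟧ : Shape)) := by
  rw [pick_map, pick_univ, Multiset.map_map]
  rfl

theorem insertions_graft (α γ : ℝ) (M : Multiset Shape) :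
    insertions α γ (graft M) =
      {(γ, graft {graft M, single})} +
      {(((M.card : ℝ) - 1) * α - γ, graft (single ::ₘ M))} +
      (pick M).bind fun q => (insertions α γ q.1).map fun p => (p.1, graft (p.2 ::ₘ q.2)) := by
  obtain ⟨k, c, hM⟩ := exists_map_mk M
  rw [← hM, ← mk_node]
  refine (insertionsMk_node α γ 0 k c _ rfl).trans ?_
  rw [pick_map_univ, Multiset.bind_map, ← mk_node]
  rfl

/-- The tree whose vertex above the given subtrees is suppressed if only one subtree is left. -/
noncomputable def collapse (R : Multiset Shape) : Shape :=
  open Classical in if h : ∃ s, R = {s} then h.choose else graft R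

@[simp]
theorem collapse_singleton (s : Shape) : collapse {s} = s := by
  have h : ∃ s', ({s} : Multiset Shape) = {s'} := ⟨s, rfl⟩
  rw [collapse, dif_pos h]
  exact (Multiset.singleton_inj.1 h.choose_spec).symm

theorem collapse_of_card_ne_one {R : Multiset Shape} (h : R.card ≠ 1) : collapse R = graft R := by
  rw [collapse, dif_neg]
  rintro ⟨s, rfl⟩
  simp at h

/-- The tree in which one subtree of the vertex adjacent to the root has been changed to `o`,
where `none` means that it has disappeared, and `R` are the other subtrees. -/
noncomputable def rejoin (R : Multiset Shape) : Option Shape → Shape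
  | none => collapse R
  | some s => graft (s ::ₘ R)

@[simp]
theorem rejoin_none (R : Multiset Shape) : rejoin R none = collapse R := rfl

@[simp]
theorem rejoin_some (R : Multiset Shape) (s : Shape) : rejoin R (some s) = graft (s ::ₘ R) := rfl

theorem mk_collapse {m : ℕ} (c : Fin m → LTree) :
    (⟦LTree.collapse m c⟧ : Shape) = collapse (Finset.univ.val.map fun j => (⟦c j⟧ : Shape)) := by
  match m, c with
  | 0, c => exact (mk_node c).trans (collapse_of_card_ne_one (by simp)).symm
  | 1, c => exact (collapse_singleton _).symm
  | m + 2, c => exact (mk_node c).trans (collapse_of_card_ne_one (by simp)).symm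

theorem mk_removeFrom {k : ℕ} (c : Fin k → LTree) (j : Fin k) (o : Option LTree) :
    (⟦LTree.removeFrom c j o⟧ : Shape) =
      rejoin ((Finset.univ.val.erase j).map fun i => (⟦c i⟧ : Shape))
        (o.map (Quotient.mk shapeSetoid)) := by
  match k, c, j, o with
  | m + 1, c, j, none =>
    refine (mk_collapse _).trans ?_
    rw [map_succAbove j fun i => (⟦c i⟧ : Shape)]
    rfl
  | m + 1, c, j, some t =>
    refine (mk_node _).trans ?_
    rw [map_mk_update]
    rfl

/-- The shapes obtained by removing a leaf, with one entry for each leaf, and `none` for the result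
of removing the leaf of the one-leaf tree. -/
noncomputable def removalsOption : Shape → Multiset (Option Shape) :=
  Quotient.lift (fun t => t.removals.map (Option.map (Quotient.mk shapeSetoid)))
    fun _ _ h => removals_congr h

theorem removals_eq (s : Shape) : removals s = (removalsOption s).filterMap id := by
  induction s using Quotient.ind
  rfl

@[simp]
theorem removalsOption_single : removalsOption single = {none} := rfl

theorem removalsOption_graft (M : Multiset Shape) :
    removalsOption (graft M) =
      (pick M).bind fun q => (removalsOption q.1).map fun o => some (rejoin q.2 o) := by
  obtain ⟨k, c, hM⟩ := exists_map_mk M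
  rw [← hM, ← mk_node, pick_map_univ, Multiset.bind_map]
  change Multiset.mapAddMonoidHom _ (∑ j, _) = ∑ j, _
  rw [map_sum]
  refine Finset.sum_congr rfl fun j _ => ?_
  simp only [Multiset.coe_mapAddMonoidHom, Multiset.map_map]
  refine Eq.trans ?_ (Multiset.map_map _ _ _).symm
  refine Multiset.map_congr rfl fun o _ => ?_
  simp only [Function.comp_apply, Option.map_some]
  exact congrArg some (mk_removeFrom c j o)

end Shape

/-- Two elements of a multiset can be singled out in either order. -/
theorem sum_pick_pick_comm {β R : Type*} [AddCommMonoid R] (M : Multiset β)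
    (G : β → β → Multiset β → R) :
    ((pick M).map fun p => ((pick p.2).map fun q => G p.1 q.1 q.2).sum).sum =
      ((pick M).map fun p => ((pick p.2).map fun q => G q.1 p.1 q.2).sum).sum := by
  induction M using Multiset.induction generalizing G with
  | empty => rfl
  | cons a M ih =>
    simp only [pick_cons, Multiset.map_cons, Multiset.sum_cons, Multiset.map_map,
      Function.comp_def, Multiset.sum_map_add]
    rw [ih fun s t Q => G s t (a ::ₘ Q)]
    abel

namespace Shape

/-! ### The up and down operators -/

/-- The up operator: the sum of the values of `f` at the results of all insertions of a leaf,
weighted by the images under `ψ` of the insertion weights. -/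
noncomputable def up {R : Type*} [CommSemiring R] (ψ : ℝ → R) (α γ : ℝ) (f : Shape → R)
    (s : Shape) : R :=
  ((insertions α γ s).map fun p => ψ p.1 * f p.2).sum

/-- The down operator: the sum of the values of `h` at the results of all removals of a leaf. -/
noncomputable def down {R : Type*} [CommSemiring R] (h : Option Shape → R) (s : Shape) : R :=
  ((removalsOption s).map h).sum

section Operators

variable {R : Type*} [CommSemiring R] (ψ : ℝ → R) (α γ : ℝ)

theorem up_single (f : Shape → R) :
    up ψ α γ f single = ψ (1 - α) * f (graft {single, single}) := by
  simp [up, insertions_single]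

theorem up_graft (f : Shape → R) (M : Multiset Shape) :
    up ψ α γ f (graft M) =
      ψ γ * f (graft {graft M, single}) +
      ψ (((M.card : ℝ) - 1) * α - γ) * f (graft (single ::ₘ M)) +
      ((pick M).map fun q => up ψ α γ (fun s => f (graft (s ::ₘ q.2))) q.1).sum := by
  rw [up, insertions_graft]
  simp only [Multiset.map_add, Multiset.sum_add, Multiset.map_singleton, Multiset.sum_singleton,
    Multiset.map_bind, Multiset.sum_bind, Multiset.map_map, Function.comp_def]
  rfl

@[simp]
theorem down_single (h : Option Shape → R) : down h single = h none := by
  simp [down]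

theorem down_graft (h : Option Shape → R) (M : Multiset Shape) :
    down h (graft M) =
      ((pick M).map fun q => down (fun o => h (some (rejoin q.2 o))) q.1).sum := by
  rw [down, removalsOption_graft]
  simp only [Multiset.map_bind, Multiset.sum_bind, Multiset.map_map, Function.comp_def]
  rfl

theorem up_add (f g : Shape → R) (s : Shape) :
    up ψ α γ (fun s => f s + g s) s = up ψ α γ f s + up ψ α γ g s := by
  simp only [up, mul_add, Multiset.sum_map_add]

theorem down_add (f g : Option Shape → R) (s : Shape) :
    down (fun s => f s + g s) s = down f s + down g s := by
  simp only [down, Multiset.sum_map_add]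

theorem down_mul_left (a : R) (f : Option Shape → R) (s : Shape) :
    down (fun s => a * f s) s = a * down f s := by
  simp only [down, Multiset.sum_map_mul_left]

theorem up_sum {ι : Type*} (m : Multiset ι) (f : ι → Shape → R) (s : Shape) :
    up ψ α γ (fun s => (m.map fun i => f i s).sum) s = (m.map fun i => up ψ α γ (f i) s).sum := by
  simp only [up, ← Multiset.sum_map_mul_left]
  rw [Multiset.sum_map_sum_map]

theorem down_sum {ι : Type*} (m : Multiset ι) (f : ι → Option Shape → R) (s : Shape) :
    down (fun o => (m.map fun i => f i o).sum) s = (m.map fun i => down (f i) s).sum := by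
  simp only [down]
  rw [Multiset.sum_map_sum_map]

/-- Operations on different subtrees commute. -/
theorem up_down_comm (F : Shape → Option Shape → R) (s t : Shape) :
    up ψ α γ (fun s' => down (F s') t) s = down (fun o => up ψ α γ (fun s' => F s' o) s) t := by
  simp only [up, down, ← Multiset.sum_map_mul_left]
  rw [Multiset.sum_map_sum_map]

end Operators

/-- A shape is proper if it has no vertices of degree two (and no childless vertices besides the
leaves). -/
inductive Proper : Shape → Prop
  | single : Proper single
  | graft (M : Multiset Shape) (hM : 2 ≤ M.card) (h : ∀ s ∈ M, Proper s) : Proper (graft M)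

theorem card_le_size_graft {M : Multiset Shape} (h : ∀ s ∈ M, 1 ≤ size s) :
    M.card ≤ size (graft M) := by
  have := Multiset.card_nsmul_le_sum (s := M.map size) (a := 1) fun x hx => by
    obtain ⟨s, hs, rfl⟩ := Multiset.mem_map.1 hx
    exact h s hs
  simpa using this

theorem Proper.one_le_size {s : Shape} (hs : Proper s) : 1 ≤ size s := by
  induction hs with
  | single => exact le_rfl
  | graft M hM h ih =>
    have := card_le_size_graft ih
    omega

theorem Proper.eq_single {s : Shape} (hs : Proper s) (h1 : size s = 1) : s = Shape.single := by
  induction hs with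
  | single => rfl
  | graft M hM h ih =>
    have := card_le_size_graft fun s hs => (h s hs).one_le_size
    omega

theorem mem_of_mem_pick {β : Type*} {M : Multiset β} {p : β × Multiset β} (h : p ∈ pick M) :
    p.1 ∈ M := by
  rw [← cons_of_mem_pick h]
  exact Multiset.mem_cons_self _ _

/-- Insertion of a leaf into a proper tree has nonnegative weights and keeps the tree proper. -/
theorem Proper.of_mem_insertions {α γ : ℝ} (hγ : 0 ≤ γ) (hγα : γ ≤ α) (hα : α ≤ 1) {s : Shape}
    (hs : Proper s) : ∀ p ∈ insertions α γ s, 0 ≤ p.1 ∧ Proper p.2 ∧ size p.2 = size s + 1 := by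
  induction hs with
  | single =>
    simp only [insertions_single, Multiset.mem_singleton, forall_eq]
    refine ⟨by linarith, .graft _ (by simp) (by simp [Proper.single]), by simp⟩
  | graft M hM h ih =>
    intro p hp
    rw [insertions_graft] at hp
    simp only [Multiset.mem_add, Multiset.mem_singleton, Multiset.mem_bind, Multiset.mem_map] at hp
    obtain (rfl | rfl) | ⟨q, hq, p, hp, rfl⟩ := hp
    · refine ⟨hγ, .graft _ (by simp) ?_, by simp⟩
      simp [Proper.single, Proper.graft M hM h]
    · refine ⟨?_, .graft _ (by simp; omega) ?_, by simp [add_comm]⟩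
      · have : (2 : ℝ) ≤ M.card := by exact_mod_cast hM
        nlinarith
      · simpa [Proper.single] using h
    · obtain ⟨h0, h1, h2⟩ := ih q.1 (mem_of_mem_pick hq) p hp
      have hM' := cons_of_mem_pick hq
      refine ⟨h0, .graft _ ?_ ?_, ?_⟩
      · rw [← hM'] at hM
        simpa using hM
      · intro s hs
        obtain rfl | hs := Multiset.mem_cons.1 hs
        · exact h1
        · exact h s (by rw [← hM']; exact Multiset.mem_cons_of_mem hs)
      · rw [← hM']
        simp [h2]
        ring

theorem sum_map_pick_size {R : Type*} [CommRing R] (M : Multiset Shape) (a b : R) :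
    ((pick M).map fun q => a * (size q.1 : R) - b).sum = a * (size (graft M) : R) - M.card * b := by
  have : (pick M).map (fun q => a * (size q.1 : R) - b) = M.map fun s => a * (size s : R) - b := by
    conv_rhs => rw [← map_fst_pick M]
    rw [Multiset.map_map]
    rfl
  rw [this, Multiset.sum_map_sub, Multiset.sum_map_mul_left, size_graft]
  simp [Multiset.map_map]

/-- The total insertion weight of a tree with `n` leaves is `n - α`. -/
theorem up_one (α γ : ℝ) (s : Shape) : up id α γ (fun _ => 1) s = size s - α := by
  induction s using Shape.induction with
  | h1 => simp [up_single]
  | h2 M ih =>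
    rw [up_graft]
    have : ((pick M).map fun q => up id α γ (fun s => (fun _ => (1 : ℝ)) (graft (s ::ₘ q.2))) q.1) =
        (pick M).map fun q => 1 * (size q.1 : ℝ) - α :=
      Multiset.map_congr rfl fun q hq => by rw [ih q.1 (mem_of_mem_pick hq), one_mul]
    rw [this, sum_map_pick_size]
    simp only [id]
    ring

/-- The up operator on functions of a subtree that may have disappeared. The value at `none`
accounts for the loss `α` in weight of the vertex that carried this subtree. -/
noncomputable def upOption (α γ : ℝ) (h : Option Shape → ℝ) : Option Shape → ℝ
  | none => -α * h (some single)
  | some s => up id α γ (fun s => h (some s)) s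

/-- Insertion into a tree after an operation on one subtree. The formula holds in the same form
whether the subtree persists, disappears, or disappears together with its parent vertex. -/
theorem up_rejoin (α γ : ℝ) (f : Shape → ℝ) (R : Multiset Shape) (hR : 1 ≤ R.card)
    (o : Option Shape) :
    up id α γ f (rejoin R o) =
      γ * f (graft {rejoin R o, single}) + (R.card * α - γ) * f (rejoin (single ::ₘ R) o) +
      upOption α γ (fun o => f (rejoin R o)) o +
      ((pick R).map fun q => up id α γ (fun x => f (rejoin (x ::ₘ q.2) o)) q.1).sum := by
  cases o with
  | some s =>
    simp only [rejoin, up_graft, upOption, pick_cons, Multiset.map_cons, Multiset.sum_cons,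
      Multiset.map_map, Function.comp_def, id, Multiset.card_cons, Multiset.cons_swap s]
    push_cast
    ring
  | none =>
    obtain h | h := hR.eq_or_lt
    · obtain ⟨x, rfl⟩ := Multiset.card_eq_one.1 h.symm
      rw [← Multiset.cons_zero x]
      simp only [pick_cons, pick_zero, Multiset.map_zero]
      simp only [rejoin, upOption, Multiset.cons_zero, collapse_singleton, Multiset.map_singleton,
        Multiset.sum_singleton, Multiset.card_singleton]
      rw [collapse_of_card_ne_one (by simp)]
      have : (single ::ₘ {x} : Multiset Shape) = {x, single} := Multiset.pair_comm _ _
      rw [this]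
      push_cast
      ring
    · have e : ((pick R).map fun q => up id α γ (fun x => f (rejoin (x ::ₘ q.2) none)) q.1) =
          (pick R).map fun q => up id α γ (fun x => f (graft (x ::ₘ q.2))) q.1 := by
        refine Multiset.map_congr rfl fun q hq => ?_
        have hc : (q.1 ::ₘ q.2).card = R.card := by rw [cons_of_mem_pick hq]
        simp only [Multiset.card_cons] at hc
        congr 1
        funext x
        rw [rejoin, collapse_of_card_ne_one]
        rw [Multiset.card_cons]
        omega
      rw [e]
      simp only [rejoin, upOption]
      rw [collapse_of_card_ne_one h.ne',
        collapse_of_card_ne_one (by simp only [Multiset.card_cons]; omega), up_graft]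
      simp only [id]
      ring

/-- The commutation relation between insertion and removal of a leaf: on trees with `n` leaves,
`up ∘ down = down ∘ up + (2 n - α)`. -/
theorem up_down (α γ : ℝ) {s : Shape} (hs : Proper s) (h : Option Shape → ℝ) :
    up id α γ (fun s' => down h s') s =
      down (upOption α γ h) s + (2 * size s - α) * h (some s) := by
  induction hs generalizing h with
  | single =>
    have e : down h (graft {single, single}) = 2 * h (some single) := by
      rw [down_graft, Multiset.insert_eq_cons]
      simp only [pick_cons, pick_singleton, Multiset.map_cons, Multiset.sum_cons,
        down_single, rejoin_none, Multiset.cons_zero, collapse_singleton,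
        Multiset.map_singleton, Multiset.sum_singleton]
      ring
    rw [up_single, e]
    simp [upOption]
    ring
  | graft M hM hp ih =>
    have hcard : ∀ q ∈ pick M, q.2.card + 1 = M.card := fun q hq => by
      rw [← Multiset.card_cons q.1, cons_of_mem_pick hq]
    have hq : ∀ q ∈ pick M, up id α γ (fun s' => down h (graft (s' ::ₘ q.2))) q.1 =
        down (upOption α γ fun o => h (some (rejoin q.2 o))) q.1 +
          (2 * size q.1 - α) * h (some (graft M)) +
        ((pick q.2).map fun r => down (fun o =>
          up id α γ (fun s' => h (some (rejoin (s' ::ₘ r.2) o))) q.1) r.1).sum := fun q hq => by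
      have := ih q.1 (mem_of_mem_pick hq) fun o => h (some (rejoin q.2 o))
      simp only [rejoin_some, cons_of_mem_pick hq] at this
      simp only [← up_down_comm]
      rw [← up_sum, ← this, ← up_add]
      congr 1
      funext s'
      rw [down_graft]
      simp only [pick_cons, Multiset.map_cons, Multiset.sum_cons, Multiset.map_map,
        Function.comp_def]
    have hr : ∀ q ∈ pick M, down (fun o => upOption α γ h (some (rejoin q.2 o))) q.1 =
        γ * down (fun o => h (some (graft {rejoin q.2 o, single}))) q.1 +
        ((M.card - 1) * α - γ) * down (fun o => h (some (rejoin (single ::ₘ q.2) o))) q.1 +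
        down (upOption α γ fun o => h (some (rejoin q.2 o))) q.1 +
        ((pick q.2).map fun r => down (fun o =>
          up id α γ (fun s' => h (some (rejoin (s' ::ₘ r.2) o))) r.1) q.1).sum := fun q hq => by
      rw [← down_sum, ← down_mul_left, ← down_mul_left, ← down_add, ← down_add, ← down_add]
      congr 1
      funext o
      have hc := hcard q hq
      have hc' : (q.2.card : ℝ) = M.card - 1 := by rw [← hc]; push_cast; ring
      rw [← hc']
      exact up_rejoin α γ (fun s => h (some s)) q.2 (by omega) o
    have hswap := sum_pick_pick_comm M fun s x Q => down (fun o =>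
          up id α γ (fun s' => h (some (rejoin (s' ::ₘ Q) o))) s) x
    rw [up_graft, down_graft (upOption α γ h), Multiset.map_congr rfl hq,
      Multiset.map_congr rfl hr]
    simp only [Multiset.sum_map_add, Multiset.sum_map_mul_left, Multiset.sum_map_mul_right]
    rw [hswap, sum_map_pick_size]
    have e1 : down h (graft {graft M, single}) = h (some (graft M)) +
        ((pick M).map fun q => down (fun o => h (some (graft {rejoin q.2 o, single}))) q.1).sum := by
      rw [down_graft, Multiset.insert_eq_cons]
      simp only [pick_cons, pick_singleton, Multiset.map_cons, Multiset.sum_cons,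
        down_single, rejoin_none, Multiset.cons_zero, collapse_singleton,
        Multiset.map_singleton, Multiset.sum_singleton]
      rw [down_graft]
      simp only [rejoin_some]
      rw [add_comm]
      rfl
    have e2 : down h (graft (single ::ₘ M)) = h (some (graft M)) +
        ((pick M).map fun q => down (fun o => h (some (rejoin (single ::ₘ q.2) o))) q.1).sum := by
      rw [down_graft]
      simp only [pick_cons, Multiset.map_cons, Multiset.sum_cons, Multiset.map_map,
        Function.comp_def, down_single, rejoin_none]
      rw [collapse_of_card_ne_one (by omega)]
    rw [e1, e2]
    simp only [id]
    ring

end Shape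

open Shape

/-! ### Expectations with respect to probability mass functions -/

/-- The expectation of a nonnegative function. -/
noncomputable def expect {β : Type*} (p : PMF β) (f : β → ℝ≥0∞) : ℝ≥0∞ := ∑' a, p a * f a

section Expect

variable {β δ : Type*}

@[simp]
theorem expect_pure (a : β) (f : β → ℝ≥0∞) : expect (PMF.pure a) f = f a := by
  classical
  rw [expect, tsum_eq_single a]
  · simp
  · intro b hb
    simp [hb]

theorem expect_bind (p : PMF β) (k : β → PMF δ) (f : δ → ℝ≥0∞) :
    expect (p.bind k) f = expect p fun a => expect (k a) f := by
  simp only [expect, PMF.bind_apply, ← ENNReal.tsum_mul_right, ← ENNReal.tsum_mul_left]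
  rw [ENNReal.tsum_comm]
  simp only [mul_assoc]

theorem expect_map (p : PMF β) (g : β → δ) (f : δ → ℝ≥0∞) :
    expect (p.map g) f = expect p fun a => f (g a) := by
  rw [PMF.map, expect_bind]
  simp

theorem expect_congr {p : PMF β} {f g : β → ℝ≥0∞} (h : ∀ a ∈ p.support, f a = g a) :
    expect p f = expect p g := by
  refine tsum_congr fun a => ?_
  by_cases ha : p a = 0
  · simp [ha]
  · rw [h a ((PMF.mem_support_iff p a).2 ha)]

theorem expect_add (p : PMF β) (f g : β → ℝ≥0∞) :
    expect p (fun a => f a + g a) = expect p f + expect p g := by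
  simp only [expect, mul_add, ENNReal.tsum_add]

theorem expect_mul_left (p : PMF β) (c : ℝ≥0∞) (f : β → ℝ≥0∞) :
    expect p (fun a => c * f a) = c * expect p f := by
  simp only [expect, ← ENNReal.tsum_mul_left]
  exact tsum_congr fun a => by ring

theorem expect_const (p : PMF β) (c : ℝ≥0∞) : expect p (fun _ => c) = c := by
  rw [expect, ENNReal.tsum_mul_right, p.tsum_coe, one_mul]

theorem expect_sum (p : PMF β) {ι : Type*} (m : Multiset ι) (f : ι → β → ℝ≥0∞) :
    expect p (fun a => (m.map fun i => f i a).sum) = (m.map fun i => expect p (f i)).sum := by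
  induction m using Multiset.induction with
  | empty => simpa using expect_const p 0
  | cons i m ih => simp only [Multiset.map_cons, Multiset.sum_cons, expect_add, ih]

theorem expect_comm (p : PMF β) (q : PMF δ) (f : β → δ → ℝ≥0∞) :
    expect p (fun a => expect q (f a)) = expect q fun b => expect p fun a => f a b := by
  simp only [expect, ← ENNReal.tsum_mul_left]
  rw [ENNReal.tsum_comm]
  exact tsum_congr fun b => tsum_congr fun a => by ring

open Classical in
theorem expect_indicator (p : PMF β) (b : β) :
    expect p (fun a => if a = b then 1 else 0) = p b := by
  rw [expect, tsum_eq_single b]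
  · simp
  · intro a ha
    simp [ha]

theorem pmf_ext_of_expect {p q : PMF β}
    (h : ∀ f : β → NNReal, expect p (fun a => f a) = expect q fun a => f a) : p = q := by
  classical
  ext b
  have := h fun a => if a = b then 1 else 0
  simpa [apply_ite, expect_indicator] using this

theorem tsum_weightOf_mul {β : Type} (m : Multiset (ℝ × β)) (f : β → ℝ≥0∞) :
    ∑' b, weightOf m b * f b = (m.map fun p => ENNReal.ofReal p.1 * f p.2).sum := by
  classical
  induction m using Multiset.induction with
  | empty => simp [weightOf]
  | cons p m ih =>
    have : ∀ b, weightOf (p ::ₘ m) b =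
        (if p.2 = b then ENNReal.ofReal p.1 else 0) + weightOf m b := fun b => by
      simp only [weightOf, Multiset.map_cons, Multiset.sum_cons]
    simp only [this, add_mul, ENNReal.tsum_add, ih, Multiset.map_cons, Multiset.sum_cons]
    congr 1
    rw [tsum_eq_single p.2]
    · simp
    · intro b hb
      simp [hb.symm]

theorem tsum_count_mul (m : Multiset β) (f : β → ℝ≥0∞) :
    open Classical in ∑' b, (m.count b : ℝ≥0∞) * f b = (m.map f).sum := by
  classical
  induction m using Multiset.induction with
  | empty => simp
  | cons a m ih =>
    simp only [Multiset.count_cons, Nat.cast_add, add_mul, ENNReal.tsum_add, Multiset.map_cons,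
      Multiset.sum_cons, ih]
    rw [add_comm]
    congr 1
    rw [tsum_eq_single a]
    · simp
    · intro b hb
      simp [hb]

theorem expect_ofMultiset (m : Multiset β) (hm : m ≠ 0) (f : β → ℝ≥0∞) :
    m.card * expect (PMF.ofMultiset m hm) f = (m.map f).sum := by
  classical
  rw [← tsum_count_mul, expect, ← ENNReal.tsum_mul_left]
  refine tsum_congr fun b => ?_
  rw [PMF.ofMultiset_apply, ← mul_assoc, ENNReal.mul_div_cancel]
  · simpa using hm
  · exact ENNReal.natCast_ne_top _

theorem expect_selectProportional {β : Type} (m : Multiset (ℝ × β)) (d : β) (f : β → ℝ≥0∞)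
    (h0 : (m.map fun p => ENNReal.ofReal p.1).sum ≠ 0)
    (h1 : (m.map fun p => ENNReal.ofReal p.1).sum ≠ ∞) :
    (m.map fun p => ENNReal.ofReal p.1).sum * expect (selectProportional m d) f =
      (m.map fun p => ENNReal.ofReal p.1 * f p.2).sum := by
  have hs : ∑' b, weightOf m b = (m.map fun p => ENNReal.ofReal p.1).sum := by
    simpa using tsum_weightOf_mul m fun _ => 1
  rw [← hs] at h0 h1 ⊢
  rw [selectProportional, dif_pos ⟨h0, h1⟩, expect, ← tsum_weightOf_mul]
  simp only [PMF.normalize_apply]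
  rw [← ENNReal.tsum_mul_left]
  refine tsum_congr fun b => ?_
  calc (∑' b, weightOf m b) * (weightOf m b * (∑' b, weightOf m b)⁻¹ * f b)
      = (∑' b, weightOf m b) * (∑' b, weightOf m b)⁻¹ * (weightOf m b * f b) := by ring
    _ = _ := by rw [ENNReal.mul_inv_cancel h0 h1, one_mul]

end Expect

/-! ### One step of the growth rule -/

/-- The parameters of alpha-gamma trees. -/
structure IsParam (α γ : ℝ) : Prop where
  nonneg : 0 ≤ γ
  le : γ ≤ α
  le_one : α ≤ 1

/-- The up operator with values in the extended nonnegative reals. -/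
noncomputable abbrev Shape.upE (α γ : ℝ) (f : Shape → ℝ≥0∞) : Shape → ℝ≥0∞ :=
  up ENNReal.ofReal α γ f

section Growth

variable {α γ : ℝ}

/-- On proper trees the insertion weights are nonnegative, so that no truncation takes place. -/
theorem coe_up (h : IsParam α γ) (f : Shape → NNReal) {s : Shape} (hs : Proper s) :
    ((up Real.toNNReal α γ f s : NNReal) : ℝ) = up id α γ (fun s => (f s : ℝ)) s := by
  rw [up, up, ← NNReal.coe_toRealHom, map_multiset_sum, Multiset.map_map]
  refine congrArg _ (Multiset.map_congr rfl fun p hp => ?_)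
  have := (hs.of_mem_insertions h.nonneg h.le h.le_one p hp).1
  simp [this]

theorem upE_coe (f : Shape → NNReal) (s : Shape) :
    upE α γ (fun s => (f s : ℝ≥0∞)) s = (up Real.toNNReal α γ f s : NNReal) := by
  refine Eq.trans ?_ (map_multiset_sum ENNReal.ofNNRealHom _).symm
  rw [upE, up, Multiset.map_map]
  refine congrArg _ (Multiset.map_congr rfl fun p hp => ?_)
  exact (ENNReal.coe_mul _ _).symm

theorem down_coe (f : Option Shape → NNReal) (s : Shape) :
    down (fun s => (f s : ℝ≥0∞)) s = (down f s : NNReal) := by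
  refine Eq.trans ?_ (map_multiset_sum ENNReal.ofNNRealHom _).symm
  rw [down, Multiset.map_map]
  rfl

theorem coe_down (f : Option Shape → NNReal) (s : Shape) :
    ((down f s : NNReal) : ℝ) = down (fun s => (f s : ℝ)) s := by
  rw [down, down, ← NNReal.coe_toRealHom, map_multiset_sum, Multiset.map_map]
  rfl

theorem upE_one (h : IsParam α γ) {s : Shape} (hs : Proper s) :
    upE α γ (fun _ => 1) s = ENNReal.ofReal (size s - α) := by
  have h1 := upE_coe (α := α) (γ := γ) (fun _ => 1) s
  have h2 := coe_up h (fun _ => 1) hs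
  simp only [NNReal.coe_one, up_one, ENNReal.coe_one] at h1 h2
  rw [h1, ← h2, ENNReal.ofReal_coe_nnreal]

theorem upE_const (h : IsParam α γ) {s : Shape} (hs : Proper s) (f : Shape → ℝ≥0∞) (c : ℝ≥0∞)
    (hf : ∀ s', size s' = size s + 1 → f s' = c) :
    upE α γ f s = ENNReal.ofReal (size s - α) * c := by
  rw [← upE_one h hs, upE, upE, up, up, ← Multiset.sum_map_mul_right]
  refine congrArg _ (Multiset.map_congr rfl fun p hp => ?_)
  rw [hf _ (hs.of_mem_insertions h.nonneg h.le h.le_one p hp).2.2, mul_one]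

theorem mk_treeLaw_two : (⟦node 2 ![leaf 1, leaf 2]⟧ : Shape) = graft {single, single} := by
  rw [mk_node]
  simp [Fin.univ_val_map, mk_leaf]
  rfl

theorem shapeLaw_one : shapeLaw α γ 1 = PMF.pure single := PMF.pure_map _ _

theorem shapeLaw_two : shapeLaw α γ 2 = PMF.pure (graft {single, single}) := by
  rw [shapeLaw, treeLaw, PMF.pure_map]
  exact congrArg _ mk_treeLaw_two

theorem expect_insert (h : IsParam α γ) {n : ℕ} {t : LTree} (ht : Proper ⟦t⟧)
    (hn : 2 ≤ size ⟦t⟧) (f : Shape → ℝ≥0∞) :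
    ENNReal.ofReal (size ⟦t⟧ - α) *
      expect (selectProportional (LTree.insertions α γ n t) t) (fun t => f ⟦t⟧) =
      upE α γ f ⟦t⟧ := by
  have hW : ((LTree.insertions α γ n t).map fun p => ENNReal.ofReal p.1).sum =
      ENNReal.ofReal (size ⟦t⟧ - α) := by
    rw [← upE_one h ht, upE, up, insertions_mk α γ n, Multiset.map_map]
    simp
  have h2 : (2 : ℝ) ≤ size ⟦t⟧ := by exact_mod_cast hn
  rw [← hW, expect_selectProportional]
  · rw [upE, up, insertions_mk α γ n, Multiset.map_map]
    rfl
  · rw [hW, ne_eq, ENNReal.ofReal_eq_zero, not_le]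
    linarith [h.le_one]
  · rw [hW]
    exact ENNReal.ofReal_ne_top

theorem support_treeLaw (h : IsParam α γ) {n : ℕ} (hn : 1 ≤ n) :
    ∀ t ∈ (treeLaw α γ n).support, Proper ⟦t⟧ ∧ size ⟦t⟧ = n := by
  match n, hn with
  | 1, _ =>
    intro t ht
    rw [treeLaw, PMF.support_pure, Set.mem_singleton_iff] at ht
    subst ht
    exact ⟨Proper.single, rfl⟩
  | 2, _ =>
    intro t ht
    rw [treeLaw, PMF.support_pure, Set.mem_singleton_iff] at ht
    subst ht
    rw [mk_treeLaw_two]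
    exact ⟨.graft _ (by simp) (by simp [Proper.single]), by simp⟩
  | n + 3, _ =>
    intro t ht
    rw [treeLaw, PMF.mem_support_bind_iff] at ht
    obtain ⟨u, hu, ht⟩ := ht
    obtain ⟨hp, hs⟩ := support_treeLaw h (n := n + 2) (by omega) u hu
    classical
    -- The expectation of the indicator of the exceptional trees vanishes.
    have key := expect_insert h (n := n + 3) hp (by omega)
      fun s => if Proper s ∧ size s = n + 3 then 0 else 1
    have h0 : upE α γ (fun s => if Proper s ∧ size s = n + 3 then 0 else 1) ⟦u⟧ = 0 := by
      rw [upE, up]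
      refine Multiset.sum_eq_zero fun x hx => ?_
      obtain ⟨p, hp', rfl⟩ := Multiset.mem_map.1 hx
      obtain ⟨-, h1, h2⟩ := hp.of_mem_insertions h.nonneg h.le h.le_one p hp'
      rw [if_pos ⟨h1, by omega⟩, mul_zero]
    rw [h0, mul_eq_zero, or_iff_right] at key
    · have := ENNReal.tsum_eq_zero.1 key t
      rw [mul_eq_zero, or_iff_right ((PMF.mem_support_iff _ _).1 ht)] at this
      by_contra hc
      simp [hc] at this
    · rw [ENNReal.ofReal_eq_zero, not_le, hs]
      push_cast
      have : (0 : ℝ) ≤ n := n.cast_nonneg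
      linarith [h.le_one]

theorem support_shapeLaw (h : IsParam α γ) {n : ℕ} (hn : 1 ≤ n) :
    ∀ s ∈ (shapeLaw α γ n).support, Proper s ∧ size s = n := by
  intro s hs
  rw [shapeLaw, PMF.support_map] at hs
  obtain ⟨t, ht, rfl⟩ := hs
  exact support_treeLaw h hn t ht

/-- The law of the tree with `n + 1` leaves in terms of the up operator and the law of the tree
with `n` leaves. -/
theorem expect_shapeLaw_succ (h : IsParam α γ) {n : ℕ} (hn : 1 ≤ n) (f : Shape → ℝ≥0∞) :
    ENNReal.ofReal (n - α) * expect (shapeLaw α γ (n + 1)) f =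
      expect (shapeLaw α γ n) (upE α γ f) := by
  match n, hn with
  | 1, _ =>
    rw [shapeLaw_one, shapeLaw_two, expect_pure, expect_pure, upE, up_single, Nat.cast_one]
  | n + 2, _ =>
    rw [shapeLaw, shapeLaw, expect_map, expect_map, treeLaw, expect_bind, ← expect_mul_left]
    refine expect_congr fun t ht => ?_
    obtain ⟨hp, hs⟩ := support_treeLaw h (by omega) t ht
    rw [← expect_insert h (n := n + 3) hp (by omega), hs]

/-! ### Sampling consistency -/

theorem Shape.Proper.rejoin {R : Multiset Shape} (hR : 1 ≤ R.card) (hp : ∀ s ∈ R, Proper s)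
    {o : Option Shape} (ho : ∀ s ∈ o, Proper s) : Proper (rejoin R o) := by
  cases o with
  | none =>
    obtain h | h := hR.eq_or_lt
    · obtain ⟨x, rfl⟩ := Multiset.card_eq_one.1 h.symm
      simpa using hp x
    · rw [rejoin_none, collapse_of_card_ne_one h.ne']
      exact .graft R h hp
  | some s =>
    refine .graft _ (by simpa) fun t ht => ?_
    obtain rfl | ht := Multiset.mem_cons.1 ht
    · exact ho t rfl
    · exact hp t ht

/-- A proper tree with at least two leaves stays proper when a leaf is removed. -/
theorem Shape.Proper.of_mem_removalsOption {s : Shape} (hs : Proper s) (h2 : 2 ≤ size s) :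
    ∀ o ∈ removalsOption s, ∃ s', o = some s' ∧ Proper s' := by
  induction hs with
  | single => simp at h2
  | graft M hM h ih =>
    intro o ho
    simp only [removalsOption_graft, Multiset.mem_bind, Multiset.mem_map] at ho
    obtain ⟨q, hq, o, ho, rfl⟩ := ho
    have hM' := cons_of_mem_pick hq
    refine ⟨_, rfl, .rejoin ?_ (fun s hs => h s ?_) ?_⟩
    · rw [← hM', Multiset.card_cons] at hM
      omega
    · rw [← hM']
      exact Multiset.mem_cons_of_mem hs
    · have hq1 := mem_of_mem_pick hq
      obtain h1 | h1 := (h _ hq1).one_le_size.eq_or_lt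
      · have : q.1 = Shape.single := (h _ hq1).eq_single h1.symm
        rw [this] at ho
        simp at ho
        simp [ho]
      · obtain ⟨s', rfl, hs'⟩ := ih _ hq1 h1 o ho
        simpa using hs'

/-- Removing a leaf from the tree with `n + 1` leaves in all possible ways gives, on average, `n + 1`
copies of the tree with `n` leaves. The induction step combines the commutation relation
`Shape.up_down` with the growth rule. -/
theorem expect_down (h : IsParam α γ) {n : ℕ} (hn : 1 ≤ n) (f : Option Shape → NNReal) :
    expect (shapeLaw α γ (n + 1)) (fun s => (down f s : NNReal)) =
      (n + 1) * expect (shapeLaw α γ n) fun s => f (some s) := by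
  induction n, hn using Nat.le_induction generalizing f with
  | base =>
    rw [shapeLaw_one, shapeLaw_two, expect_pure, expect_pure]
    have : down f (graft {single, single}) = 2 * f (some single) := by
      rw [down_graft, Multiset.insert_eq_cons]
      simp only [pick_cons, pick_singleton, Multiset.map_cons, Multiset.sum_cons,
        down_single, rejoin_none, Multiset.cons_zero, collapse_singleton,
        Multiset.map_singleton, Multiset.sum_singleton]
      ring
    rw [this]
    push_cast
    norm_num
  | succ n hn ih =>
    have hn1 : (1 : ℝ) ≤ n := by exact_mod_cast hn
    have hα := h.le_one
    let f' : Option Shape → NNReal := fun o => o.elim 0 (up Real.toNNReal α γ fun s => f (some s))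
    have key : ∀ s ∈ (shapeLaw α γ (n + 1)).support,
        upE α γ (fun s => (down f s : NNReal)) s =
          (down f' s : NNReal) + ENNReal.ofReal (2 * (n + 1) - α) * f (some s) := fun s hs => by
      obtain ⟨hp, hsz⟩ := support_shapeLaw h (by omega) s hs
      have h1 := up_down α γ hp fun o => (f o : ℝ)
      have h2 : down (upOption α γ fun o => (f o : ℝ)) s = (down f' s : NNReal) := by
        rw [coe_down, down, down]
        refine congrArg _ (Multiset.map_congr rfl fun o ho => ?_)
        obtain ⟨s', rfl, hs'⟩ := hp.of_mem_removalsOption (by omega) o ho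
        exact (coe_up h (fun s => f (some s)) hs').symm
      simp only [← coe_down] at h1
      rw [← coe_up h _ hp, h2, hsz] at h1
      rw [upE_coe, ← ENNReal.ofReal_coe_nnreal, h1, ENNReal.ofReal_add (by positivity),
        ENNReal.ofReal_mul, ENNReal.ofReal_coe_nnreal, ENNReal.ofReal_coe_nnreal]
      · push_cast
        rfl
      · push_cast
        linarith
      · push_cast
        have : 0 ≤ 2 * ((n : ℝ) + 1) - α := by linarith
        positivity
    have hW : ENNReal.ofReal ((n + 1 : ℕ) - α) ≠ 0 := by
      rw [ne_eq, ENNReal.ofReal_eq_zero, not_le]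
      push_cast
      linarith
    rw [← ENNReal.mul_right_inj hW ENNReal.ofReal_ne_top, expect_shapeLaw_succ h (by omega),
      expect_congr key, expect_add, expect_mul_left, ih f']
    have : expect (shapeLaw α γ n) (fun s => f' (some s)) =
        ENNReal.ofReal (n - α) * expect (shapeLaw α γ (n + 1)) fun s => f (some s) := by
      rw [expect_shapeLaw_succ h hn]
      exact congrArg _ (funext fun s => (upE_coe (fun s => f (some s)) s).symm)
    rw [this, ← mul_assoc, ← mul_assoc, ← add_mul]
    congr 1
    have e1 : ((n : ℝ≥0∞) + 1) = ENNReal.ofReal (n + 1) := by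
      rw [ENNReal.ofReal_add (by linarith) zero_le_one]
      simp
    have e2 : (((n + 1 : ℕ) : ℝ≥0∞) + 1) = ENNReal.ofReal (n + 2) := by
      rw [ENNReal.ofReal_add (by linarith) zero_le_two]
      simp
      norm_num [add_assoc]
    rw [e1, e2, ← ENNReal.ofReal_mul (by linarith), ← ENNReal.ofReal_mul (by push_cast; linarith),
      ← ENNReal.ofReal_add]
    · congr 1
      push_cast
      ring
    · have : 0 ≤ n - α := by linarith
      positivity
    · linarith

theorem card_removalsOption (s : Shape) : (removalsOption s).card = size s := by
  induction s using Shape.induction with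
  | h1 => simp
  | h2 M ih =>
    rw [removalsOption_graft, Multiset.card_bind, size_graft]
    conv_rhs => rw [← map_fst_pick M]
    rw [Multiset.map_map]
    refine congrArg _ (Multiset.map_congr rfl fun q hq => ?_)
    simpa using ih _ (mem_of_mem_pick hq)

theorem map_some_filterMap_id {β : Type*} {m : Multiset (Option β)} (hm : none ∉ m) :
    (m.filterMap id).map some = m := by
  induction m using Multiset.induction with
  | empty => rfl
  | cons o m ih =>
    obtain ⟨h1, h2⟩ := not_or.1 (Multiset.mem_cons.not.1 hm)
    obtain ⟨s, rfl⟩ := Option.ne_none_iff_exists'.1 (Ne.symm h1)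
    rw [Multiset.filterMap_cons_some id (some s) m rfl, Multiset.map_cons, ih h2]

theorem samplingConsistent (h : IsParam α γ) : SamplingConsistent (shapeLaw α γ) := by
  intro n hn
  obtain ⟨n, rfl⟩ := Nat.exists_eq_add_of_le' hn
  refine pmf_ext_of_expect fun f => ?_
  have h0 : ((n + 2 : ℕ) : ℝ≥0∞) ≠ 0 := by simp
  rw [expect_bind, ← ENNReal.mul_right_inj h0 (ENNReal.natCast_ne_top _), ← expect_mul_left]
  have key := expect_down h (n := n + 1) (by omega) fun o => o.elim 0 f
  have e : ((n + 1 : ℕ) : ℝ≥0∞) + 1 = (n + 2 : ℕ) := by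
    push_cast
    ring
  rw [e] at key
  refine Eq.trans (expect_congr fun s hs => ?_) key
  obtain ⟨hp, hsz⟩ := support_shapeLaw h (by omega) s hs
  have hr := hp.of_mem_removalsOption (by omega)
  have hmap : (removals s).map some = removalsOption s := by
    rw [removals_eq]
    refine map_some_filterMap_id fun ho => ?_
    obtain ⟨s', h', -⟩ := hr _ ho
    simp at h'
  have hcard : (removals s).card = n + 2 := by
    rw [← hsz, ← card_removalsOption, ← hmap, Multiset.card_map]
  have h0 : removals s ≠ 0 := fun h0 => by simp [h0] at hcard
  rw [deleteLeaf, dif_neg h0, ← hcard, expect_ofMultiset, ← down_coe, down, ← hmap,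
    Multiset.map_map]
  rfl

end Growth

/-! ### The Markov branching property -/

theorem Shape.Proper.exists_eq_graft {s : Shape} (hs : Proper s) (h2 : 2 ≤ size s) :
    ∃ M, s = Shape.graft M ∧ 2 ≤ M.card ∧ ∀ t ∈ M, Proper t := by
  cases hs with
  | single => simp at h2
  | graft M hM h => exact ⟨M, rfl, hM, h⟩

/-- The law of the multiset of independent trees with the given laws. -/
noncomputable def forestList (P : ℕ → PMF Shape) (l : List ℕ) : PMF (Multiset Shape) :=
  (independent (l.map P)).map (↑)

/-- The law of the multiset of independent trees with laws `P n`, for `n` in the given multiset. -/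
noncomputable def forest (P : ℕ → PMF Shape) (m : Multiset ℕ) : PMF (Multiset Shape) :=
  forestList P (m.sort (· ≥ ·))

section Forest

variable (P : ℕ → PMF Shape)

theorem expect_forestList_cons (n : ℕ) (l : List ℕ) (f : Multiset Shape → ℝ≥0∞) :
    expect (forestList P (n :: l)) f =
      expect (P n) fun s => expect (forestList P l) fun M => f (s ::ₘ M) := by
  simp only [forestList, List.map_cons, independent, expect_map, expect_bind]
  rfl

theorem expect_forestList_perm {l l' : List ℕ} (h : l.Perm l') (f : Multiset Shape → ℝ≥0∞) :
    expect (forestList P l) f = expect (forestList P l') f := by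
  induction h generalizing f with
  | nil => rfl
  | cons x _ ih => simp only [expect_forestList_cons, ih]
  | swap x y l =>
    simp only [expect_forestList_cons]
    rw [expect_comm]
    simp only [Multiset.cons_swap]
  | trans _ _ ih₁ ih₂ => rw [ih₁, ih₂]

theorem expect_forest_zero (f : Multiset Shape → ℝ≥0∞) : expect (forest P 0) f = f 0 := by
  rw [forest, Multiset.sort_zero, forestList, expect_map, List.map_nil, independent, expect_pure]
  rfl

theorem expect_forest_cons (n : ℕ) (m : Multiset ℕ) (f : Multiset Shape → ℝ≥0∞) :
    expect (forest P (n ::ₘ m)) f =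
      expect (P n) fun s => expect (forest P m) fun M => f (s ::ₘ M) := by
  rw [forest, forest, ← expect_forestList_cons]
  refine expect_forestList_perm P ?_ f
  rw [← Multiset.coe_eq_coe, Multiset.sort_eq, ← Multiset.cons_coe, Multiset.sort_eq]

theorem expect_forest_pair (n n' : ℕ) (f : Multiset Shape → ℝ≥0∞) :
    expect (forest P {n, n'}) f = expect (P n) fun s => expect (P n') fun t => f {s, t} := by
  rw [Multiset.insert_eq_cons, ← Multiset.cons_zero n']
  simp only [expect_forest_cons, expect_forest_zero]
  rfl

theorem expect_forest_card (m : Multiset ℕ) (H : ℕ → Multiset Shape → ℝ≥0∞) :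
    expect (forest P m) (fun M => H M.card M) = expect (forest P m) fun M => H m.card M := by
  induction m using Multiset.induction generalizing H with
  | empty => simp [expect_forest_zero]
  | cons n m ih =>
    simp only [expect_forest_cons, Multiset.card_cons]
    congr 1
    funext s
    exact ih fun k M => H (k + 1) (s ::ₘ M)

/-- Singling out a tree of a forest amounts to singling out its size and sampling it separately. -/
theorem expect_forest_pick (m : Multiset ℕ) (F : Shape → Multiset Shape → ℝ≥0∞) :
    expect (forest P m) (fun M => ((pick M).map fun q => F q.1 q.2).sum) =
      ((pick m).map fun r =>
        expect (forest P r.2) fun R => expect (P r.1) fun s => F s R).sum := by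
  induction m using Multiset.induction generalizing F with
  | empty => simp [expect_forest_zero]
  | cons n m ih =>
    simp only [expect_forest_cons, pick_cons, Multiset.map_cons, Multiset.sum_cons,
      Multiset.map_map, Function.comp_def, expect_add]
    congr 1
    · rw [expect_comm]
    · have : ∀ s, expect (forest P m) (fun M => ((pick M).map fun q => F q.1 (s ::ₘ q.2)).sum) =
          ((pick m).map fun r =>
            expect (forest P r.2) fun R => expect (P r.1) fun t => F t (s ::ₘ R)).sum :=
        fun s => ih fun t R => F t (s ::ₘ R)
      simp only [this]
      rw [expect_sum]

end Forest

/-- The up operator on functions of the first split. -/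
noncomputable def splitUp (α γ : ℝ) (g : Multiset ℕ → ℝ≥0∞) (m : Multiset ℕ) : ℝ≥0∞ :=
  ENNReal.ofReal γ * g {m.sum, 1} +
  ENNReal.ofReal (((m.card : ℝ) - 1) * α - γ) * g (1 ::ₘ m) +
  ((pick m).map fun r => ENNReal.ofReal (r.1 - α) * g ((r.1 + 1) ::ₘ r.2)).sum

section MarkovBranching

variable {α γ : ℝ}

theorem expect_splittingRule (n : ℕ) (g : Multiset ℕ → ℝ≥0∞) :
    expect (splittingRule α γ n) g = expect (shapeLaw α γ n) fun s => g (firstSplit s) :=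
  expect_map _ _ _

theorem support_splittingRule (h : IsParam α γ) {n : ℕ} (hn : 2 ≤ n) :
    ∀ m ∈ (splittingRule α γ n).support, m.sum = n ∧ 2 ≤ m.card ∧ ∀ x ∈ m, 1 ≤ x := by
  intro m hm
  rw [splittingRule, PMF.support_map] at hm
  obtain ⟨s, hs, rfl⟩ := hm
  obtain ⟨hp, hsz⟩ := support_shapeLaw h (by omega) s hs
  obtain ⟨M, rfl, hM, hp'⟩ := hp.exists_eq_graft (by omega)
  rw [firstSplit_graft]
  refine ⟨by rw [← hsz, size_graft], by simpa, fun x hx => ?_⟩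
  obtain ⟨t, ht, rfl⟩ := Multiset.mem_map.1 hx
  exact (hp' t ht).one_le_size

theorem splittingRule_two : splittingRule α γ 2 = PMF.pure {1, 1} := by
  rw [splittingRule, shapeLaw_two, PMF.pure_map, firstSplit_graft]
  simp

/-- The growth of the first split: a component with `x` leaves is chosen with weight `x - α`. -/
theorem expect_splittingRule_succ (h : IsParam α γ) {n : ℕ} (hn : 2 ≤ n)
    (g : Multiset ℕ → ℝ≥0∞) :
    ENNReal.ofReal (n - α) * expect (splittingRule α γ (n + 1)) g =
      expect (splittingRule α γ n) (splitUp α γ g) := by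
  rw [expect_splittingRule, expect_splittingRule, expect_shapeLaw_succ h (by omega)]
  refine expect_congr fun s hs => ?_
  obtain ⟨hp, hsz⟩ := support_shapeLaw h (by omega) s hs
  obtain ⟨M, rfl, hM, hp'⟩ := hp.exists_eq_graft (by omega)
  rw [upE, up_graft, splitUp, firstSplit_graft M, pick_map, Multiset.map_map]
  congr 1
  · simp
  · refine congrArg _ (Multiset.map_congr rfl fun q hq => ?_)
    refine upE_const h (hp' _ (mem_of_mem_pick hq)) _ _ fun s' hs' => ?_
    rw [firstSplit_graft, Multiset.map_cons, hs']

/-- The Markov branching property: an insertion at the root edge or at the branch point adjacent to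
the root adds a one-leaf component, and an insertion elsewhere is, given the component in which it
takes place, a step of the growth rule in this component. -/
theorem expect_shapeLaw_eq (h : IsParam α γ) {n : ℕ} (hn : 2 ≤ n) (f : Shape → ℝ≥0∞) :
    expect (shapeLaw α γ n) f = expect (splittingRule α γ n) fun m =>
      expect (forest (shapeLaw α γ) m) fun M => f (graft M) := by
  induction n, hn using Nat.le_induction generalizing f with
  | base =>
    rw [splittingRule_two, expect_pure, shapeLaw_two, expect_pure, expect_forest_pair,
      shapeLaw_one, expect_pure, expect_pure]
  | succ n hn ih =>
    have hn1 : (2 : ℝ) ≤ n := by exact_mod_cast hn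
    have hW : ENNReal.ofReal (n - α) ≠ 0 := by
      rw [ne_eq, ENNReal.ofReal_eq_zero, not_le]
      linarith [h.le_one]
    rw [← ENNReal.mul_right_inj hW ENNReal.ofReal_ne_top, expect_shapeLaw_succ h (by omega),
      expect_splittingRule_succ h hn, ih]
    have h1 : ∀ m, expect (forest (shapeLaw α γ) (1 ::ₘ m)) (fun M => f (graft M)) =
        expect (forest (shapeLaw α γ) m) fun M => f (graft (single ::ₘ M)) := fun m => by
      rw [expect_forest_cons, shapeLaw_one, expect_pure]
    have h2 : expect (forest (shapeLaw α γ) {n, 1}) (fun M => f (graft M)) =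
        expect (shapeLaw α γ n) fun s => f (graft {s, single}) := by
      simp only [expect_forest_pair, shapeLaw_one, expect_pure]
    have h3 : ∀ m ∈ (splittingRule α γ n).support,
        splitUp α γ (fun m => expect (forest (shapeLaw α γ) m) fun M => f (graft M)) m =
        ENNReal.ofReal γ * (expect (shapeLaw α γ n) fun s => f (graft {s, single})) +
        (ENNReal.ofReal (((m.card : ℝ) - 1) * α - γ) *
          (expect (forest (shapeLaw α γ) m) fun M => f (graft (single ::ₘ M))) +
        ((pick m).map fun r => ENNReal.ofReal (r.1 - α) *
          expect (forest (shapeLaw α γ) ((r.1 + 1) ::ₘ r.2)) fun M => f (graft M)).sum) :=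
      fun m hm => by
        rw [splitUp, (support_splittingRule h hn m hm).1, h2, h1, add_assoc]
    have h4 : ∀ m ∈ (splittingRule α γ n).support,
        expect (forest (shapeLaw α γ) m) (fun M => upE α γ f (graft M)) =
        ENNReal.ofReal γ *
          expect (forest (shapeLaw α γ) m) (fun M => f (graft {graft M, single})) +
        (ENNReal.ofReal (((m.card : ℝ) - 1) * α - γ) *
          (expect (forest (shapeLaw α γ) m) fun M => f (graft (single ::ₘ M))) +
        ((pick m).map fun r => ENNReal.ofReal (r.1 - α) *
          expect (forest (shapeLaw α γ) ((r.1 + 1) ::ₘ r.2)) fun M => f (graft M)).sum) :=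
      fun m hm => by
        simp only [upE, up_graft]
        rw [expect_add, expect_add, expect_mul_left, add_assoc]
        congr 2
        · rw [expect_forest_card (shapeLaw α γ) m fun k M =>
            ENNReal.ofReal (((k : ℝ) - 1) * α - γ) * f (graft (single ::ₘ M)), expect_mul_left]
        · rw [expect_forest_pick (shapeLaw α γ) m fun s R =>
            up ENNReal.ofReal α γ (fun s => f (graft (s ::ₘ R))) s]
          refine congrArg _ (Multiset.map_congr rfl fun r hr => ?_)
          have hr1 := (support_splittingRule h hn m hm).2.2 _ (mem_of_mem_pick hr)
          rw [expect_forest_cons, expect_comm (shapeLaw α γ (r.1 + 1)), ← expect_mul_left]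
          congr 1
          funext R
          exact (expect_shapeLaw_succ h hr1 _).symm
    rw [expect_congr h3, expect_congr h4]
    simp only [expect_add, expect_const, expect_mul_left]
    congr 2
    exact (ih fun s => f (graft {s, single})).symm

theorem isMarkovBranching (h : IsParam α γ) :
    IsMarkovBranching (shapeLaw α γ) (splittingRule α γ) := by
  refine ⟨shapeLaw_one, fun n hn => pmf_ext_of_expect fun f => ?_⟩
  rw [expect_shapeLaw_eq h hn, expect_bind]
  simp only [forest, forestList, expect_map, join_eq_graft]

end MarkovBranching

/-! ### The explicit splitting rule -/

/-- The product `∏ (count of x)!` over the distinct elements of a multiset. -/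
def countFactorial (m : Multiset ℕ) : ℕ := ∏ r ∈ m.toFinset, (m.count r)!

theorem countFactorial_eq (m : Multiset ℕ) {S : Finset ℕ} (hS : m.toFinset ⊆ S) :
    countFactorial m = ∏ r ∈ S, (m.count r)! := by
  refine Finset.prod_subset hS fun r _ hr => ?_
  rw [Multiset.mem_toFinset] at hr
  rw [Multiset.count_eq_zero_of_notMem hr, Nat.factorial_zero]

theorem countFactorial_cons (x : ℕ) (R : Multiset ℕ) :
    countFactorial (x ::ₘ R) = (R.count x + 1) * countFactorial R := by
  rw [countFactorial_eq (x ::ₘ R) (S := insert x R.toFinset) (by simp),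
    countFactorial_eq R (S := insert x R.toFinset) (by simp),
    ← Finset.mul_prod_erase _ _ (Finset.mem_insert_self x _),
    ← Finset.mul_prod_erase _ (fun r => (R.count r)!) (Finset.mem_insert_self x _),
    Multiset.count_cons_self, Nat.factorial_succ, mul_assoc]
  refine congrArg _ (congrArg _ (Finset.prod_congr rfl fun r hr => ?_))
  rw [Multiset.count_cons_of_ne (Finset.ne_of_mem_erase hr)]

theorem countFactorial_pos (m : Multiset ℕ) : 0 < countFactorial m :=
  Finset.prod_pos fun _ _ => Nat.factorial_pos _

/-- The weight `1 / (∏ x! ∏ (count of x)!)` of a multiset: `n!` times this weight is the number of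
partitions of an `n`-element set with the given block sizes. -/
noncomputable def blockWeight (m : Multiset ℕ) : ℝ≥0∞ :=
  (((m.map fun x => x !).prod * countFactorial m : ℕ) : ℝ≥0∞)⁻¹

theorem count_mul_blockWeight_cons (x : ℕ) (R : Multiset ℕ) :
    ((x ::ₘ R).count x : ℝ≥0∞) * blockWeight (x ::ₘ R) = blockWeight R * (x ! : ℝ≥0∞)⁻¹ := by
  have h1 : ((R.count x + 1 : ℕ) : ℝ≥0∞) ≠ 0 := by simp
  have h2 := ENNReal.natCast_ne_top (R.count x + 1)
  rw [blockWeight, blockWeight, countFactorial_cons, Multiset.count_cons_self, Multiset.map_cons,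
    Multiset.prod_cons,
    show x ! * (R.map fun x => x !).prod * ((R.count x + 1) * countFactorial R) =
      (R.count x + 1) * ((R.map fun x => x !).prod * countFactorial R * x !) by ring,
    Nat.cast_mul, ENNReal.mul_inv (Or.inl h1) (Or.inl h2), ← mul_assoc,
    ENNReal.mul_inv_cancel h1 h2, one_mul, Nat.cast_mul _ (x !), ENNReal.mul_inv]
  · exact Or.inr (ENNReal.natCast_ne_top _)
  · exact Or.inl (ENNReal.natCast_ne_top _)

/-- Summation over multisets with a distinguished element. -/
theorem tsum_blockWeight_pick (K : ℕ → Multiset ℕ → ℝ≥0∞) :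
    ∑' m, blockWeight m * ((pick m).map fun r => K r.1 r.2).sum =
      ∑' x, ∑' R, blockWeight R * (x ! : ℝ≥0∞)⁻¹ * K x R := by
  have h : ∀ m : Multiset ℕ, ((pick m).map fun r => K r.1 r.2).sum =
      ∑' x, (m.count x : ℝ≥0∞) * K x (m.erase x) := fun m => by
    have := tsum_count_mul m fun x => K x (m.erase x)
    rw [pick, Multiset.map_map]
    convert this.symm using 4 <;> (try simp only [Function.comp_apply]) <;> congr!
  simp only [h, ← ENNReal.tsum_mul_left]
  rw [ENNReal.tsum_comm]
  refine tsum_congr fun x => ?_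
  have hinj : Function.Injective fun R : Multiset ℕ => x ::ₘ R :=
    fun _ _ h => (Multiset.cons_inj_right x).1 h
  rw [← hinj.tsum_eq]
  · refine tsum_congr fun R => ?_
    rw [Multiset.erase_cons_head, ← count_mul_blockWeight_cons]
    ring
  · intro m hm
    refine ⟨m.erase x, Multiset.cons_erase ?_⟩
    by_contra hx
    simp [Multiset.count_eq_zero_of_notMem hx] at hm

/-- The rising factorial `(1 - α) (2 - α) ⋯ (x - 1 - α)`, for `α < 1` and `x ≥ 1`, as a quotient of
values of the Gamma function. -/
noncomputable def risingWeight (α : ℝ) (x : ℕ) : ℝ :=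
  Real.Gamma (x - α) / Real.Gamma (1 - α)

/-- The product `(α - γ) (2 α - γ) ⋯ ((k - 2) α - γ)`, for `k ≥ 2`. -/
noncomputable def vertexWeight (α γ : ℝ) (k : ℕ) : ℝ :=
  ∏ i ∈ Finset.range (k - 2), ((i + 1) * α - γ)

/-- The quantity `γ n (n - 1) + (1 - α - γ) ∑_{i ≠ j} nᵢ nⱼ` for a multiset with sum `n`. -/
noncomputable def sizeWeight (α γ : ℝ) (m : Multiset ℕ) : ℝ :=
  γ * (m.sum * (m.sum - 1)) +
    (1 - α - γ) * ((m.sum : ℝ) ^ 2 - (m.map fun x : ℕ => (x : ℝ) ^ 2).sum)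

/-- The exchangeable partition probability function of the alpha-gamma splitting rule. -/
noncomputable def alphaGammaEppf (α γ : ℝ) (m : Multiset ℕ) : ℝ :=
  vertexWeight α γ m.card * (m.map (risingWeight α)).prod * sizeWeight α γ m /
    (risingWeight α m.sum * (m.sum * (m.sum - 1)))

section Explicit

variable {α γ : ℝ}

theorem risingWeight_one (hα : α < 1) : risingWeight α 1 = 1 := by
  have : Real.Gamma (1 - α) ≠ 0 := (Real.Gamma_pos_of_pos (by linarith)).ne'
  rw [risingWeight, Nat.cast_one, div_self this]

theorem risingWeight_succ (hα : α < 1) {x : ℕ} (hx : 1 ≤ x) :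
    risingWeight α (x + 1) = (x - α) * risingWeight α x := by
  have h1 : (1 : ℝ) ≤ x := by exact_mod_cast hx
  rw [risingWeight, risingWeight, ← mul_div_assoc, ← Real.Gamma_add_one (by linarith)]
  push_cast
  ring_nf

theorem risingWeight_pos (hα : α < 1) {x : ℕ} (hx : 1 ≤ x) : 0 < risingWeight α x := by
  have h1 : (1 : ℝ) ≤ x := by exact_mod_cast hx
  exact div_pos (Real.Gamma_pos_of_pos (by linarith)) (Real.Gamma_pos_of_pos (by linarith))

theorem vertexWeight_two : vertexWeight α γ 2 = 1 := by simp [vertexWeight]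

theorem vertexWeight_succ {k : ℕ} (hk : 2 ≤ k) :
    vertexWeight α γ (k + 1) = ((k - 1) * α - γ) * vertexWeight α γ k := by
  obtain ⟨k, rfl⟩ := Nat.exists_eq_add_of_le' hk
  simp only [vertexWeight, Nat.add_sub_cancel, show k + 2 + 1 - 2 = k + 1 by omega,
    Finset.prod_range_succ]
  push_cast
  ring

theorem vertexWeight_nonneg (h : IsParam α γ) (k : ℕ) : 0 ≤ vertexWeight α γ k := by
  refine Finset.prod_nonneg fun i _ => ?_
  have : (0 : ℝ) ≤ i := i.cast_nonneg
  nlinarith [h.nonneg, h.le]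

theorem sum_le_sum_sq (m : Multiset ℕ) :
    (m.sum : ℝ) ≤ (m.map fun x : ℕ => (x : ℝ) ^ 2).sum ∧
      (m.map fun x : ℕ => (x : ℝ) ^ 2).sum ≤ (m.sum : ℝ) ^ 2 := by
  induction m using Multiset.induction with
  | empty => simp
  | cons x m ih =>
    obtain ⟨h1, h2⟩ := ih
    have hx : (x : ℝ) ≤ (x : ℝ) ^ 2 := by exact_mod_cast Nat.le_self_pow two_ne_zero x
    have h3 : (0 : ℝ) ≤ m.sum := Nat.cast_nonneg _
    have h4 : (0 : ℝ) ≤ x := Nat.cast_nonneg _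
    simp only [Multiset.sum_cons, Multiset.map_cons, Nat.cast_add]
    constructor
    · linarith
    · nlinarith [mul_nonneg h3 h4]

theorem sizeWeight_nonneg (h : IsParam α γ) (m : Multiset ℕ) : 0 ≤ sizeWeight α γ m := by
  obtain ⟨h1, h2⟩ := sum_le_sum_sq m
  have h3 : (0 : ℝ) ≤ (m.sum : ℝ) * (m.sum - 1) := by linarith
  have := h.nonneg
  have := h.le_one
  rw [sizeWeight]
  obtain hc | hc := le_total 0 (1 - α - γ)
  · have := mul_nonneg hc (sub_nonneg.2 h2)
    positivity
  · nlinarith [mul_nonneg (sub_nonneg.2 h.le_one) h3,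
      mul_nonneg (neg_nonneg.2 hc) (sub_nonneg.2 h1)]

theorem prod_risingWeight_pos (hα : α < 1) {m : Multiset ℕ} (h0 : 0 ∉ m) :
    0 < (m.map (risingWeight α)).prod := by
  induction m using Multiset.induction with
  | empty => simp
  | cons x m ih =>
    obtain ⟨hx, hm⟩ := not_or.1 (Multiset.mem_cons.not.1 h0)
    rw [Multiset.map_cons, Multiset.prod_cons]
    exact mul_pos (risingWeight_pos hα (by omega)) (ih hm)

/-- The possible first splits of trees with `n` leaves. -/
def IsSplit (n : ℕ) (m : Multiset ℕ) : Prop := m.sum = n ∧ 2 ≤ m.card ∧ 0 ∉ m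

open Classical in
/-- The exchangeable partition probability function on the possible first splits of trees with `n`
leaves, and `0` elsewhere. -/
noncomputable def splitProb (α γ : ℝ) (n : ℕ) (m : Multiset ℕ) : ℝ≥0∞ :=
  if IsSplit n m then ENNReal.ofReal (alphaGammaEppf α γ m) else 0

open Classical in
/-- The probability flow into the split `y ::ₘ R` of `n + 1` from the split of `n` in which the
block of size `y` is one smaller. -/
noncomputable def splitFlow (α γ : ℝ) (n : ℕ) : ℕ → Multiset ℕ → ℝ≥0∞
  | 0, _ => 0
  | 1, R => if R = {n} then ENNReal.ofReal γ else
      ENNReal.ofReal ((R.card - 1) * α - γ) * splitProb α γ n R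
  | x + 2, R => ENNReal.ofReal ((x + 1 : ℕ) - α) * splitProb α γ n ((x + 1) ::ₘ R)

/-- In each case the size weight of the smaller split is expressed by the parts of the larger one,
so that the flows into a split have the same form for parts equal to `1` and for larger parts. -/
theorem splitFlow_eq (h : IsParam α γ) (hα : α < 1) {n : ℕ} (hn : 2 ≤ n) {y : ℕ}
    {R : Multiset ℕ} (hm : IsSplit (n + 1) (y ::ₘ R)) :
    0 ≤ γ * (n * (n - 1)) + (1 - α - γ) *
        ((n : ℝ) ^ 2 - ((y ::ₘ R).map fun x : ℕ => (x : ℝ) ^ 2).sum + 2 * y - 1) ∧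
    splitFlow α γ n y R = ENNReal.ofReal
      (vertexWeight α γ (y ::ₘ R).card * ((y ::ₘ R).map (risingWeight α)).prod *
        (γ * (n * (n - 1)) + (1 - α - γ) *
          ((n : ℝ) ^ 2 - ((y ::ₘ R).map fun x : ℕ => (x : ℝ) ^ 2).sum + 2 * y - 1)) /
        (risingWeight α n * (n * (n - 1)))) := by
  obtain ⟨hs, hc, h0⟩ := hm
  obtain ⟨hy, hR⟩ := not_or.1 (Multiset.mem_cons.not.1 h0)
  rw [Multiset.sum_cons] at hs
  rw [Multiset.card_cons] at hc
  have hn2 : (2 : ℝ) ≤ n := by exact_mod_cast hn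
  have hrn := risingWeight_pos hα (show 1 ≤ n by omega)
  have hnn : (n : ℝ) * (n - 1) ≠ 0 := (mul_pos (by linarith) (by linarith)).ne'
  match y, hy with
  | 1, _ =>
    have hRs : R.sum = n := by omega
    have e : γ * (n * (n - 1)) + (1 - α - γ) *
        ((n : ℝ) ^ 2 - ((1 ::ₘ R).map fun x : ℕ => (x : ℝ) ^ 2).sum + 2 * (1 : ℕ) - 1) =
        sizeWeight α γ R := by
      rw [sizeWeight, hRs, Multiset.map_cons, Multiset.sum_cons]
      push_cast
      ring
    rw [e]
    refine ⟨sizeWeight_nonneg h R, ?_⟩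
    rw [splitFlow, Multiset.map_cons, Multiset.prod_cons, risingWeight_one hα, one_mul,
      Multiset.card_cons]
    split_ifs with hRn
    · subst hRn
      congr 1
      simp only [Multiset.card_singleton, Multiset.map_singleton, Multiset.prod_singleton,
        sizeWeight, Multiset.sum_singleton, sub_self, mul_zero, add_zero]
      rw [vertexWeight_two]
      have hn1 : (n : ℝ) - 1 ≠ 0 := by linarith
      field_simp
    · have hR2 : 2 ≤ R.card := by
        by_contra hlt
        obtain ⟨x, rfl⟩ := Multiset.card_eq_one.1 (show R.card = 1 by omega)
        simp only [Multiset.sum_singleton] at hRs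
        exact hRn (by rw [hRs])
      have hv : 0 ≤ ((R.card : ℝ) - 1) * α - γ := by
        have : (2 : ℝ) ≤ R.card := by exact_mod_cast hR2
        nlinarith [h.nonneg, h.le]
      rw [splitProb, if_pos ⟨hRs, hR2, hR⟩, ← ENNReal.ofReal_mul hv, vertexWeight_succ hR2,
        alphaGammaEppf, hRs]
      congr 1
      ring
  | x + 2, _ =>
    have hRs : ((x + 1) ::ₘ R).sum = n := by
      rw [Multiset.sum_cons]
      omega
    have e : γ * (n * (n - 1)) + (1 - α - γ) *
        ((n : ℝ) ^ 2 - (((x + 2) ::ₘ R).map fun x : ℕ => (x : ℝ) ^ 2).sum + 2 * (x + 2 : ℕ) - 1) =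
        sizeWeight α γ ((x + 1) ::ₘ R) := by
      rw [sizeWeight, hRs, Multiset.map_cons, Multiset.sum_cons, Multiset.map_cons,
        Multiset.sum_cons]
      push_cast
      ring
    rw [e]
    refine ⟨sizeWeight_nonneg h _, ?_⟩
    have hv : 0 ≤ ((x + 1 : ℕ) : ℝ) - α := by
      push_cast
      have : (0 : ℝ) ≤ x := x.cast_nonneg
      linarith
    rw [splitFlow, splitProb, if_pos ⟨hRs, by simpa using hc, by simpa using hR⟩,
      ← ENNReal.ofReal_mul hv, alphaGammaEppf, hRs]
    simp only [Multiset.card_cons, Multiset.map_cons, Multiset.prod_cons]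
    rw [risingWeight_succ hα (x := x + 1) (by omega)]
    congr 1
    ring

theorem splitFlow_eq_zero {n y : ℕ} {R : Multiset ℕ} (hn : 2 ≤ n)
    (hm : ¬ IsSplit (n + 1) (y ::ₘ R)) : splitFlow α γ n y R = 0 := by
  match y with
  | 0 => rfl
  | 1 =>
    rw [splitFlow, if_neg, splitProb, if_neg, mul_zero]
    · rintro ⟨h1, h2, h3⟩
      refine hm ⟨by rw [Multiset.sum_cons]; omega, by rw [Multiset.card_cons]; omega, ?_⟩
      simpa using h3
    · rintro rfl
      refine hm ⟨by simp [add_comm], by simp, ?_⟩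
      simp
      omega
  | x + 2 =>
    rw [splitFlow, splitProb, if_neg, mul_zero]
    rintro ⟨h1, h2, h3⟩
    rw [Multiset.sum_cons] at h1
    refine hm ⟨by rw [Multiset.sum_cons]; omega, by simpa using h2, ?_⟩
    simpa using h3

theorem ofReal_multiset_sum {ι : Type*} (m : Multiset ι) (f : ι → ℝ) (hf : ∀ i ∈ m, 0 ≤ f i) :
    ENNReal.ofReal (m.map f).sum = (m.map fun i => ENNReal.ofReal (f i)).sum := by
  induction m using Multiset.induction with
  | empty => simp
  | cons a m ih =>
    rw [Multiset.map_cons, Multiset.sum_cons, Multiset.map_cons, Multiset.sum_cons,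
      ENNReal.ofReal_add (hf a (Multiset.mem_cons_self _ _)) (Multiset.sum_nonneg ?_),
      ih fun i hi => hf i (Multiset.mem_cons_of_mem hi)]
    intro x hx
    obtain ⟨i, hi, rfl⟩ := Multiset.mem_map.1 hx
    exact hf i (Multiset.mem_cons_of_mem hi)

/-- The balance equation for the exchangeable partition probability functions: the flows into a
split, weighted by the sizes of the parts that grow, are summed by means of
`∑ nⱼ = n + 1` and `∑ nⱼ * nⱼ = ∑ nⱼ²`. -/
theorem splitProb_succ (h : IsParam α γ) (hα : α < 1) {n : ℕ} (hn : 2 ≤ n) (m : Multiset ℕ) :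
    ENNReal.ofReal (n - α) * ((n + 1 : ℕ) * splitProb α γ (n + 1) m) =
      ((pick m).map fun r => (r.1 : ℝ≥0∞) * splitFlow α γ n r.1 r.2).sum := by
  by_cases hm : IsSplit (n + 1) m
  · have hn2 : (2 : ℝ) ≤ n := by exact_mod_cast hn
    have hrn := risingWeight_pos hα (show 1 ≤ n by omega)
    have hr1 : (n : ℝ) - 1 ≠ 0 := by linarith
    have hr2 : (n : ℝ) - α ≠ 0 := by linarith
    have key : ∀ r ∈ pick m, (r.1 : ℝ≥0∞) * splitFlow α γ n r.1 r.2 = ENNReal.ofReal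
        (r.1 * (vertexWeight α γ m.card * (m.map (risingWeight α)).prod *
        (γ * (n * (n - 1)) + (1 - α - γ) *
          ((n : ℝ) ^ 2 - (m.map fun x : ℕ => (x : ℝ) ^ 2).sum + 2 * r.1 - 1)) /
        (risingWeight α n * (n * (n - 1))))) := fun r hr => by
      have hm' := cons_of_mem_pick hr
      have := (splitFlow_eq h hα hn (y := r.1) (R := r.2) (by rwa [hm'])).2
      rw [this, hm', ENNReal.ofReal_mul (Nat.cast_nonneg _), ENNReal.ofReal_natCast]
    rw [Multiset.map_congr rfl key, ← ofReal_multiset_sum, splitProb, if_pos hm,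
      ← ENNReal.ofReal_natCast, ← ENNReal.ofReal_mul (Nat.cast_nonneg _),
      ← ENNReal.ofReal_mul (by linarith)]
    · congr 1
      have e : ∀ r : ℕ × Multiset ℕ,
        (r.1 * (vertexWeight α γ m.card * (m.map (risingWeight α)).prod *
        (γ * (n * (n - 1)) + (1 - α - γ) *
          ((n : ℝ) ^ 2 - (m.map fun x : ℕ => (x : ℝ) ^ 2).sum + 2 * r.1 - 1)) /
        (risingWeight α n * (n * (n - 1))))) =
        (vertexWeight α γ m.card * (m.map (risingWeight α)).prod /
          (risingWeight α n * (n * (n - 1)))) *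
        ((γ * (n * (n - 1)) + (1 - α - γ) *
          ((n : ℝ) ^ 2 - (m.map fun x : ℕ => (x : ℝ) ^ 2).sum - 1)) * (r.1 : ℝ) +
          2 * (1 - α - γ) * (r.1 : ℝ) ^ 2) := fun r => by ring
      have s1 : ((pick m).map fun r => (r.1 : ℝ)).sum = n + 1 := by
        have : (pick m).map (fun r => (r.1 : ℝ)) = m.map (Nat.cast : ℕ → ℝ) := by
          conv_rhs => rw [← map_fst_pick m]
          rw [Multiset.map_map]
          rfl
        rw [this, ← Nat.cast_multiset_sum, hm.1]
        push_cast
        rfl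
      have s2 : ((pick m).map fun r => (r.1 : ℝ) ^ 2).sum =
          (m.map fun x : ℕ => (x : ℝ) ^ 2).sum := by
        conv_rhs => rw [← map_fst_pick m]
        rw [Multiset.map_map]
        rfl
      simp only [e, Multiset.sum_map_mul_left, Multiset.sum_map_add]
      rw [s1, s2, alphaGammaEppf, sizeWeight, hm.1, risingWeight_succ hα (by omega)]
      push_cast
      have hn0 : (n : ℝ) ≠ 0 := by linarith
      have hn1 : (n : ℝ) + 1 ≠ 0 := by linarith
      rw [add_sub_cancel_right]
      field_simp
      ring
    · intro r hr
      have hm' := cons_of_mem_pick hr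
      have h1 := (splitFlow_eq h hα hn (y := r.1) (R := r.2) (by rwa [hm'])).1
      rw [hm'] at h1
      have h2 : 0 ≤ (n : ℝ) * (n - 1) := mul_nonneg (by linarith) (by linarith)
      have h3 := vertexWeight_nonneg h m.card
      have h4 := prod_risingWeight_pos hα hm.2.2
      positivity
  · rw [splitProb, if_neg hm, mul_zero, mul_zero]
    refine (Multiset.sum_eq_zero fun x hx => ?_).symm
    obtain ⟨r, hr, rfl⟩ := Multiset.mem_map.1 hx
    rw [splitFlow_eq_zero hn, mul_zero]
    rwa [cons_of_mem_pick hr]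

theorem isSplit_two_iff {m : Multiset ℕ} : IsSplit 2 m ↔ m = {1, 1} := by
  constructor
  · rintro ⟨h1, h2, h3⟩
    have h4 : m.card • 1 ≤ m.sum := Multiset.card_nsmul_le_sum fun x hx =>
      Nat.one_le_iff_ne_zero.2 fun h => h3 (h ▸ hx)
    rw [smul_eq_mul, mul_one] at h4
    obtain ⟨x, y, rfl⟩ := Multiset.card_eq_two.1 (show m.card = 2 by omega)
    simp only [Multiset.insert_eq_cons, Multiset.sum_cons, Multiset.sum_singleton,
      Multiset.mem_cons, Multiset.mem_singleton, not_or] at h1 h3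
    obtain rfl : x = 1 := by omega
    obtain rfl : y = 1 := by omega
    rfl
  · rintro rfl
    exact ⟨rfl, le_rfl, by simp⟩

/-- The splitting rule in terms of the exchangeable partition probability function. -/
theorem expect_splittingRule_eq (h : IsParam α γ) (hα : α < 1) {n : ℕ} (hn : 2 ≤ n)
    (g : Multiset ℕ → ℝ≥0∞) :
    expect (splittingRule α γ n) g =
      (n ! : ℝ≥0∞) * ∑' m, blockWeight m * (splitProb α γ n m * g m) := by
  induction n, hn using Nat.le_induction generalizing g with
  | base =>
    rw [splittingRule_two, expect_pure, tsum_eq_single {1, 1}]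
    · have hr2 := risingWeight_succ hα le_rfl
      rw [risingWeight_one hα] at hr2
      have h1 : alphaGammaEppf α γ {1, 1} = 1 := by
        have h0 : 1 - α ≠ 0 := by linarith
        simp only [alphaGammaEppf, sizeWeight, Multiset.insert_eq_cons, Multiset.card_cons,
          Multiset.card_singleton, Multiset.map_cons, Multiset.map_singleton, Multiset.prod_cons,
          Multiset.prod_singleton, Multiset.sum_cons, Multiset.sum_singleton,
          risingWeight_one hα, hr2]
        rw [vertexWeight_two]
        push_cast
        rw [div_eq_one_iff_eq]
        · ring
        · norm_num
          exact h0
      have h2 : blockWeight {1, 1} = 2⁻¹ := by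
        simp [blockWeight, countFactorial]
      rw [splitProb, if_pos (isSplit_two_iff.2 rfl), h1, h2, ENNReal.ofReal_one, one_mul,
        ← mul_assoc, Nat.factorial_two, Nat.cast_two,
        ENNReal.mul_inv_cancel two_ne_zero ENNReal.ofNat_ne_top, one_mul]
    · intro m hm
      rw [splitProb, if_neg (isSplit_two_iff.not.2 hm), zero_mul, mul_zero]
  | succ n hn ih =>
    have hn2 : (2 : ℝ) ≤ n := by exact_mod_cast hn
    have hW : ENNReal.ofReal (n - α) ≠ 0 := by
      rw [ne_eq, ENNReal.ofReal_eq_zero, not_le]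
      linarith
    rw [← ENNReal.mul_right_inj hW ENNReal.ofReal_ne_top, expect_splittingRule_succ h hn]
    have hn0 : (n ! : ℝ≥0∞) ≠ 0 := by exact_mod_cast n.factorial_ne_zero
    -- The contributions of insertion at the root edge, at the branch point and in a subtree.
    have e1 : expect (splittingRule α γ n) (splitUp α γ g) = ENNReal.ofReal γ * g {n, 1} +
        (n ! : ℝ≥0∞) * ∑' m, blockWeight m *
          (splitProb α γ n m * (ENNReal.ofReal (((m.card : ℝ) - 1) * α - γ) * g (1 ::ₘ m))) +
        (n ! : ℝ≥0∞) * ∑' m, blockWeight m *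
          ((pick m).map fun r => splitProb α γ n (r.1 ::ₘ r.2) *
            (ENNReal.ofReal (r.1 - α) * g ((r.1 + 1) ::ₘ r.2))).sum := by
      rw [expect_congr (g := fun m => ENNReal.ofReal γ * g {n, 1} +
        ENNReal.ofReal (((m.card : ℝ) - 1) * α - γ) * g (1 ::ₘ m) +
        ((pick m).map fun r => ENNReal.ofReal (r.1 - α) * g ((r.1 + 1) ::ₘ r.2)).sum),
        expect_add, expect_add, expect_const, ih, ih]
      · congr 2
        refine tsum_congr fun m => ?_
        rw [← Multiset.sum_map_mul_left]
        refine congrArg _ (congrArg _ (Multiset.map_congr rfl fun r hr => ?_))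
        rw [cons_of_mem_pick hr]
      · intro m hm
        rw [splitUp, (support_splittingRule h hn m hm).1]
    have e2 : ENNReal.ofReal (n - α) * (((n + 1)! : ℝ≥0∞) *
        ∑' m, blockWeight m * (splitProb α γ (n + 1) m * g m)) =
        (n ! : ℝ≥0∞) * ∑' m, blockWeight m *
          ((pick m).map fun r => r.1 * splitFlow α γ n r.1 r.2 * g (r.1 ::ₘ r.2)).sum := by
      rw [Nat.factorial_succ]
      push_cast
      rw [mul_comm ((n : ℝ≥0∞) + 1) (n ! : ℝ≥0∞), mul_assoc, mul_left_comm]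
      congr 1
      rw [← ENNReal.tsum_mul_left, ← ENNReal.tsum_mul_left]
      refine tsum_congr fun m => ?_
      have e : ((pick m).map fun r => r.1 * splitFlow α γ n r.1 r.2 * g (r.1 ::ₘ r.2)) =
          (pick m).map fun r => r.1 * splitFlow α γ n r.1 r.2 * g m :=
        Multiset.map_congr rfl fun r hr => by rw [cons_of_mem_pick hr]
      rw [e, Multiset.sum_map_mul_right, ← splitProb_succ h hα hn]
      push_cast
      ring
    rw [e1, e2, tsum_blockWeight_pick fun y R => y * splitFlow α γ n y R * g (y ::ₘ R),
      tsum_blockWeight_pick fun x R => splitProb α γ n (x ::ₘ R) *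
        (ENNReal.ofReal (x - α) * g ((x + 1) ::ₘ R))]
    have hz : ∀ R, splitProb α γ n (0 ::ₘ R) = 0 := fun R => by
      rw [splitProb, if_neg]
      rintro ⟨-, -, h0⟩
      simp at h0
    have hadd : ∀ f : ℕ → ℝ≥0∞, ∑' n, f n = f 0 + ∑' n, f (n + 1) := fun f =>
      tsum_eq_zero_add' ENNReal.summable
    rw [hadd, hadd fun y => ∑' R, blockWeight R * (y ! : ℝ≥0∞)⁻¹ *
        (y * splitFlow α γ n y R * g (y ::ₘ R)),
      hadd fun y => ∑' R, blockWeight R *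
        ((y + 1)! : ℝ≥0∞)⁻¹ * ((y + 1 : ℕ) * splitFlow α γ n (y + 1) R * g ((y + 1) ::ₘ R))]
    simp only [hz, zero_mul, mul_zero, tsum_zero, zero_add, Nat.cast_zero]
    have hsub : ∀ x R, blockWeight R * ((x + 1)! : ℝ≥0∞)⁻¹ * (splitProb α γ n ((x + 1) ::ₘ R) *
        (ENNReal.ofReal ((x + 1 : ℕ) - α) * g ((x + 1 + 1) ::ₘ R))) =
        blockWeight R * ((x + 1 + 1)! : ℝ≥0∞)⁻¹ *
          ((x + 1 + 1 : ℕ) * splitFlow α γ n (x + 1 + 1) R * g ((x + 1 + 1) ::ₘ R)) := fun x R => by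
      have h1 : ((x + 1 + 1 : ℕ) : ℝ≥0∞) ≠ 0 := by simp
      have h2 := ENNReal.natCast_ne_top (x + 1 + 1)
      rw [Nat.factorial_succ (x + 1), Nat.cast_mul, ENNReal.mul_inv (Or.inl h1) (Or.inl h2),
        splitFlow]
      calc _ = blockWeight R * ((x + 1)! : ℝ≥0∞)⁻¹ * (splitProb α γ n ((x + 1) ::ₘ R) *
            (ENNReal.ofReal ((x + 1 : ℕ) - α) * g ((x + 1 + 1) ::ₘ R))) *
            (((x + 1 + 1 : ℕ) : ℝ≥0∞) * ((x + 1 + 1 : ℕ) : ℝ≥0∞)⁻¹) := by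
            rw [ENNReal.mul_inv_cancel h1 h2, mul_one]
        _ = _ := by ring
    have hone : ∑' R, blockWeight R * ((1)! : ℝ≥0∞)⁻¹ *
        ((1 : ℕ) * splitFlow α γ n 1 R * g (1 ::ₘ R)) =
        (n ! : ℝ≥0∞)⁻¹ * (ENNReal.ofReal γ * g {n, 1}) + ∑' R, blockWeight R *
          (splitProb α γ n R * (ENNReal.ofReal (((R.card : ℝ) - 1) * α - γ) * g (1 ::ₘ R))) := by
      classical
      have hsum : (n ! : ℝ≥0∞)⁻¹ * (ENNReal.ofReal γ * g {n, 1}) =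
          ∑' R : Multiset ℕ, if R = {n} then
            (n ! : ℝ≥0∞)⁻¹ * (ENNReal.ofReal γ * g {n, 1}) else 0 := by
        rw [tsum_ite_eq]
      rw [hsum, ← ENNReal.tsum_add]
      refine tsum_congr fun R => ?_
      rw [splitFlow]
      by_cases hR : R = {n}
      · have h1 : blockWeight {n} = (n ! : ℝ≥0∞)⁻¹ := by
          simp [blockWeight, countFactorial]
        have h2 : splitProb α γ n {n} = 0 := if_neg fun h => by
          have := h.2.1
          simp at this
        subst hR
        rw [if_pos rfl, if_pos rfl, h1, h2, Multiset.pair_comm]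
        simp
      · rw [if_neg hR, if_neg hR]
        simp
        ring
    simp only [hsub]
    rw [hone, mul_add, mul_add, ← mul_assoc (n ! : ℝ≥0∞) (n ! : ℝ≥0∞)⁻¹,
      ENNReal.mul_inv_cancel hn0 (ENNReal.natCast_ne_top _), one_mul]

/-- The product `m₁! ⋯ mₙ!` in the definition of the exchangeable partition probability function. -/
theorem countFactorial_map_univ {k : ℕ} (parts : Fin k → ℕ) (hp : ∀ j, 1 ≤ parts j) :
    (∏ r ∈ Finset.Icc 1 (∑ j, parts j),
      (Finset.univ.filter fun j => parts j = r).card !) =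
      countFactorial (Finset.univ.val.map parts) := by
  rw [countFactorial_eq _ (S := Finset.Icc 1 (∑ j, parts j))]
  · refine Finset.prod_congr rfl fun r _ => ?_
    rw [Multiset.count_map]
    congr 2
    simp only [eq_comm]
    rfl
  · intro r hr
    rw [Multiset.mem_toFinset, Multiset.mem_map] at hr
    obtain ⟨j, -, rfl⟩ := hr
    exact Finset.mem_Icc.2 ⟨hp j, Finset.single_le_sum (fun i _ => Nat.zero_le _)
      (Finset.mem_univ j)⟩

/-- The alpha-gamma splitting rule in closed form. -/
theorem eppf_splittingRule (h : IsParam α γ) (hα : α < 1) {k : ℕ} (parts : Fin k → ℕ)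
    (hk : 2 ≤ k) (hp : ∀ j, 1 ≤ parts j) :
    eppf (splittingRule α γ) parts =
      ENNReal.ofReal (alphaGammaEppf α γ (Finset.univ.val.map parts)) := by
  classical
  set m := Finset.univ.val.map parts with hm
  have hsum : m.sum = ∑ j, parts j := rfl
  have hcard : m.card = k := by simp [hm]
  have h0 : 0 ∉ m := fun h0 => by
    obtain ⟨j, -, hj⟩ := Multiset.mem_map.1 h0
    have := hp j
    omega
  have hn : 2 ≤ ∑ j, parts j := by
    have : k ≤ ∑ j, parts j := by
      simpa using Finset.card_nsmul_le_sum Finset.univ parts 1 fun j _ => hp j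
    omega
  have hq := expect_indicator (splittingRule α γ (∑ j, parts j)) m
  rw [expect_splittingRule_eq h hα hn, tsum_eq_single m, if_pos rfl, mul_one, splitProb,
    if_pos ⟨hsum, by omega, h0⟩] at hq
  · rw [eppf, ← hq, countFactorial_map_univ parts hp, ← hm]
    have hmult := Nat.multinomial_spec Finset.univ parts
    have hprod : (m.map fun x => x !).prod = ∏ j, (parts j)! := by
      rw [hm, Multiset.map_map]
      rfl
    rw [blockWeight, hprod, ← hmult]
    have h1 : ((countFactorial m : ℕ) : ℝ≥0∞) ≠ 0 := by exact_mod_cast (countFactorial_pos m).ne'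
    have h2 : ((∏ j, (parts j)! : ℕ) : ℝ≥0∞) ≠ 0 := by
      exact_mod_cast (Finset.prod_pos fun j _ => Nat.factorial_pos _).ne'
    have h3 : ((Nat.multinomial Finset.univ parts : ℕ) : ℝ≥0∞) ≠ 0 := by
      exact_mod_cast (Nat.multinomial_pos _ _).ne'
    have h4 := fun n : ℕ => ENNReal.natCast_ne_top n
    rw [Nat.cast_mul, Nat.cast_mul, ENNReal.mul_inv (Or.inl h2) (Or.inl (h4 _)), div_eq_mul_inv]
    set a : ℝ≥0∞ := ((countFactorial m : ℕ) : ℝ≥0∞)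
    set b : ℝ≥0∞ := ((∏ j, (parts j)! : ℕ) : ℝ≥0∞)
    set c : ℝ≥0∞ := ((Nat.multinomial Finset.univ parts : ℕ) : ℝ≥0∞)
    calc _ = (a * a⁻¹) * (b * b⁻¹) * (c * c⁻¹) *
          ENNReal.ofReal (alphaGammaEppf α γ m) := by ring
      _ = _ := by
        rw [ENNReal.mul_inv_cancel h1 (h4 _), ENNReal.mul_inv_cancel h2 (h4 _),
          ENNReal.mul_inv_cancel h3 (h4 _), one_mul, one_mul, one_mul]
  · intro m' hm'
    rw [if_neg hm', mul_zero, mul_zero]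

end Explicit

/-! ### Sums over distinct indices -/

/-- The sum of `s_{i₁}^{n₁} ⋯ s_{iₖ}^{nₖ}` over all distinct `i₁, …, iₖ`. -/
noncomputable def distinctSum {k : ℕ} (parts : Fin k → ℕ) (s : ℕ → ℝ≥0∞) : ℝ≥0∞ :=
  ∑' i : Fin k ↪ ℕ, ∏ j, s (i j) ^ parts j

instance countable_embedding (k : ℕ) : Countable (Fin k ↪ ℕ) :=
  DFunLike.coe_injective.countable

theorem measurable_distinctSum {k : ℕ} (parts : Fin k → ℕ) : Measurable (distinctSum parts) := by
  refine Measurable.tsum fun i => Finset.measurable_prod _ fun j _ => ?_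
  exact (measurable_pi_apply _).pow_const _

/-- Multiplying by a power sum introduces a further index, which is either different from the other
indices or equal to one of them. -/
theorem tsum_mul_distinctSum {k : ℕ} (parts : Fin k → ℕ) (m : ℕ) (s : ℕ → ℝ≥0∞) :
    (∑' l, s l ^ m) * distinctSum parts s = distinctSum (Fin.cons m parts : Fin (k + 1) → ℕ) s +
      ∑ j, distinctSum (Function.update parts j (parts j + m)) s := by
  classical
  have h1 : ∀ i : Fin k ↪ ℕ, ∑' l, s l ^ m =
      (∑' l : {l // l ∉ Set.range i}, s l ^ m) + ∑ j, s (i j) ^ m := fun i => by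
    have e : ∑ j, s (i j) ^ m = ∑' l : Set.range i, s l ^ m := by
      rw [tsum_range (fun l => s l ^ m) i.injective, tsum_fintype]
    rw [e, add_comm]
    have := (ENNReal.summable (f := fun l : Set.range i => s l ^ m)).tsum_add_tsum_compl
      (f := fun l => s l ^ m) ENNReal.summable
    exact this.symm
  have h2 : distinctSum (Fin.cons m parts : Fin (k + 1) → ℕ) s =
      ∑' i : Fin k ↪ ℕ, (∑' l : {l // l ∉ Set.range i}, s l ^ m) * ∏ j, s (i j) ^ parts j := by
    rw [distinctSum, ← (Equiv.embeddingFinSucc k ℕ).symm.tsum_eq, ENNReal.tsum_sigma']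
    refine tsum_congr fun i => ?_
    rw [← ENNReal.tsum_mul_right]
    refine tsum_congr fun l => ?_
    rw [Fin.prod_univ_succ]
    simp
  have h3 : ∀ j, distinctSum (Function.update parts j (parts j + m)) s =
      ∑' i : Fin k ↪ ℕ, s (i j) ^ m * ∏ j, s (i j) ^ parts j := fun j => by
    refine tsum_congr fun i => ?_
    rw [← Finset.mul_prod_erase _ _ (Finset.mem_univ j),
      ← Finset.mul_prod_erase _ (fun j => s (i j) ^ parts j) (Finset.mem_univ j),
      Function.update_self, pow_add]
    have : ∏ x ∈ Finset.univ.erase j, s (i x) ^ Function.update parts j (parts j + m) x =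
        ∏ x ∈ Finset.univ.erase j, s (i x) ^ parts x :=
      Finset.prod_congr rfl fun x hx => by rw [Function.update_of_ne (Finset.ne_of_mem_erase hx)]
    rw [this]
    ring
  simp only [h2, h3]
  rw [← Summable.tsum_finsetSum fun _ _ => ENNReal.summable, ← ENNReal.tsum_add, distinctSum,
    ← ENNReal.tsum_mul_left]
  refine tsum_congr fun i => ?_
  rw [h1 i, add_mul, Finset.sum_mul]

theorem distinctSum_one (n : ℕ) (s : ℕ → ℝ≥0∞) : distinctSum ![n] s = ∑' l, s l ^ n := by
  rw [distinctSum, ← (Equiv.uniqueEmbeddingEquivResult (α := Fin 1) (β := ℕ)).symm.tsum_eq]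
  refine tsum_congr fun l => ?_
  simp
  rfl

/-! ### Measures with Gibbs-type moments -/

/-- A measure on sequences with sum `1` whose moments over distinct indices are of Gibbs form: up to
a factor `w k` that depends only on the number of parts, they are products over the parts divided
by a function of the sum of the parts. -/
structure HasGibbsMoments (α ϑ : ℝ) (μ : Measure (ℕ → ℝ≥0∞)) (w : ℕ → ℝ≥0∞) : Prop where
  antitone : ∀ᵐ s ∂μ, Antitone s
  sum_eq : ∀ᵐ s ∂μ, ∑' i, s i = 1
  ne_zero : ∀ᵐ s ∂μ, s 1 ≠ 0
  moment : ∀ (k : ℕ) (parts : Fin k → ℕ), 2 ≤ k → (∀ j, 1 ≤ parts j) →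
    ∫⁻ s, distinctSum parts s ∂μ =
      w k * ENNReal.ofReal ((∏ j, risingWeight α (parts j)) / Real.Gamma (∑ j, parts j + ϑ))
  two_ne_zero : w 2 ≠ 0
  two_ne_top : w 2 ≠ ∞

theorem le_sum_parts {k : ℕ} {parts : Fin k → ℕ} (hp : ∀ j, 1 ≤ parts j) : k ≤ ∑ j, parts j := by
  simpa using Finset.card_nsmul_le_sum Finset.univ parts 1 fun j _ => hp j

theorem prod_risingWeight_update {α : ℝ} {k : ℕ} (parts : Fin k → ℕ) (j : Fin k) (x : ℕ) (c : ℝ)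
    (h : risingWeight α x = c * risingWeight α (parts j)) :
    ∏ i, risingWeight α (Function.update parts j x i) = c * ∏ i, risingWeight α (parts i) := by
  rw [← Finset.mul_prod_erase _ _ (Finset.mem_univ j),
    ← Finset.mul_prod_erase _ (fun i => risingWeight α (parts i)) (Finset.mem_univ j),
    Function.update_self, h, mul_assoc]
  refine congrArg _ (congrArg _ (Finset.prod_congr rfl fun i hi => ?_))
  rw [Function.update_of_ne (Finset.ne_of_mem_erase hi)]

theorem sum_update {k : ℕ} (parts : Fin k → ℕ) (j : Fin k) (m : ℕ) :
    ∑ i, Function.update parts j (parts j + m) i = ∑ i, parts i + m := by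
  rw [← Finset.add_sum_erase _ _ (Finset.mem_univ j),
    ← Finset.add_sum_erase _ parts (Finset.mem_univ j), Function.update_self]
  have : ∑ i ∈ Finset.univ.erase j, Function.update parts j (parts j + m) i =
      ∑ i ∈ Finset.univ.erase j, parts i := Finset.sum_congr rfl fun i hi => by
    rw [Function.update_of_ne (Finset.ne_of_mem_erase hi)]
  rw [this]
  ring

theorem one_le_update {k : ℕ} {parts : Fin k → ℕ} (hp : ∀ j, 1 ≤ parts j) (j : Fin k) (m : ℕ) :
    ∀ i, 1 ≤ Function.update parts j (parts j + m) i := fun i => by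
  by_cases h : i = j
  · subst h
    rw [Function.update_self]
    exact (hp i).trans (Nat.le_add_right _ _)
  · rw [Function.update_of_ne h]
    exact hp i

theorem one_le_cons {k : ℕ} {parts : Fin k → ℕ} (hp : ∀ j, 1 ≤ parts j) {m : ℕ} (hm : 1 ≤ m) :
    ∀ i, 1 ≤ (Fin.cons m parts : Fin (k + 1) → ℕ) i := fun i => by
  refine Fin.cases ?_ (fun j => ?_) i
  · simpa
  · simpa using hp j

theorem prod_risingWeight_fin_pos {α : ℝ} (hα : α < 1) {k : ℕ} {parts : Fin k → ℕ}
    (hp : ∀ j, 1 ≤ parts j) : 0 < ∏ j, risingWeight α (parts j) :=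
  Finset.prod_pos fun j _ => risingWeight_pos hα (hp j)

section Gibbs

variable {α γ : ℝ} {μ : Measure (ℕ → ℝ≥0∞)} {w : ℕ → ℝ≥0∞}

theorem Gamma_pos_of_two_le (h : IsParam α γ) (hα : α < 1) {n : ℕ} (hn : 2 ≤ n) :
    0 < (n : ℝ) + (-α - γ) ∧ 0 < Real.Gamma (n + (-α - γ)) := by
  have hn2 : (2 : ℝ) ≤ n := by exact_mod_cast hn
  have : 0 < (n : ℝ) + (-α - γ) := by linarith [h.le]
  exact ⟨this, Real.Gamma_pos_of_pos this⟩

/-- Since the sequences have sum `1`, multiplying a moment by `∑ sᵢ` does not change it, and the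
product rule for sums over distinct indices becomes a recursion for the weights `w k`. -/
theorem HasGibbsMoments.weight_succ (hμ : HasGibbsMoments α (-α - γ) μ w) (h : IsParam α γ)
    (hα : α < 1) {k : ℕ} (hk : 2 ≤ k) (hw : w k ≠ ∞) :
    w (k + 1) ≠ ∞ ∧ (w (k + 1)).toReal = ((k - 1) * α - γ) * (w k).toReal := by
  let parts : Fin k → ℕ := fun _ => 1
  have hp : ∀ j, 1 ≤ parts j := fun _ => le_rfl
  have e : ∫⁻ s, distinctSum parts s ∂μ =
      ∫⁻ s, distinctSum (Fin.cons 1 parts : Fin (k + 1) → ℕ) s ∂μ +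
        ∑ j, ∫⁻ s, distinctSum (Function.update parts j (parts j + 1)) s ∂μ := by
    rw [← lintegral_finsetSum _ fun j _ => measurable_distinctSum _,
      ← lintegral_add_left (measurable_distinctSum _)]
    refine lintegral_congr_ae ?_
    filter_upwards [hμ.sum_eq] with s hs
    rw [← tsum_mul_distinctSum]
    simp [hs]
  have hsum : ∑ j, parts j = k := by simp [parts]
  obtain ⟨hk0, hG⟩ := Gamma_pos_of_two_le h hα hk
  have hG1 : Real.Gamma ((k + 1 : ℕ) + (-α - γ)) =
      (k + (-α - γ)) * Real.Gamma (k + (-α - γ)) := by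
    rw [← Real.Gamma_add_one hk0.ne']
    push_cast
    ring_nf
  have hr2 : risingWeight α (1 + 1) = (1 - α) * risingWeight α 1 := by
    simpa using risingWeight_succ hα le_rfl
  have e1 : ∏ j, risingWeight α (parts j) = 1 := by simp [parts, risingWeight_one hα]
  have e2 : ∏ j, risingWeight α ((Fin.cons 1 parts : Fin (k + 1) → ℕ) j) = 1 := by
    rw [Fin.prod_univ_succ]
    simp [parts, risingWeight_one hα]
  have e3 : ∑ j, (Fin.cons 1 parts : Fin (k + 1) → ℕ) j = k + 1 := by
    rw [Fin.sum_univ_succ]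
    simp [parts, add_comm]
  have e4 : ∀ j, ∫⁻ s, distinctSum (Function.update parts j (parts j + 1)) s ∂μ =
      w k * ENNReal.ofReal ((1 - α) / ((k + (-α - γ)) * Real.Gamma (k + (-α - γ)))) := fun j => by
    rw [hμ.moment k _ hk (one_le_update hp j 1), prod_risingWeight_update parts j _ (1 - α) hr2,
      sum_update, hsum, e1, mul_one, hG1]
  rw [hμ.moment k parts hk hp, hμ.moment (k + 1) _ (by omega) (one_le_cons hp le_rfl), e1, e2, e3,
    hG1, hsum] at e
  simp only [e4, Finset.sum_const, Finset.card_univ, Fintype.card_fin, nsmul_eq_mul] at e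
  have hpos : 0 < 1 / ((k + (-α - γ)) * Real.Gamma (k + (-α - γ))) := by positivity
  have hne : w (k + 1) ≠ ∞ := by
    intro htop
    rw [htop, ENNReal.top_mul, top_add] at e
    · exact ENNReal.mul_ne_top hw ENNReal.ofReal_ne_top e
    · rwa [ne_eq, ENNReal.ofReal_eq_zero, not_le]
  refine ⟨hne, ?_⟩
  have e' := congrArg ENNReal.toReal e
  have hα' : 0 ≤ 1 - α := by linarith
  rw [ENNReal.toReal_add (ENNReal.mul_ne_top hne ENNReal.ofReal_ne_top)
    (ENNReal.mul_ne_top (ENNReal.natCast_ne_top _) (ENNReal.mul_ne_top hw ENNReal.ofReal_ne_top)),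
    ENNReal.toReal_mul, ENNReal.toReal_mul, ENNReal.toReal_mul, ENNReal.toReal_mul,
    ENNReal.toReal_ofReal (by positivity), ENNReal.toReal_ofReal (by positivity),
    ENNReal.toReal_ofReal (by positivity), ENNReal.toReal_natCast] at e'
  field_simp at e'
  linarith

theorem HasGibbsMoments.weight_eq (hμ : HasGibbsMoments α (-α - γ) μ w) (h : IsParam α γ)
    (hα : α < 1) {k : ℕ} (hk : 2 ≤ k) :
    w k = ENNReal.ofReal ((w 2).toReal * vertexWeight α γ k) := by
  have : w k ≠ ∞ ∧ (w k).toReal = (w 2).toReal * vertexWeight α γ k := by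
    induction k, hk using Nat.le_induction with
    | base => exact ⟨hμ.two_ne_top, by rw [vertexWeight_two, mul_one]⟩
    | succ k hk ih =>
      obtain ⟨h1, h2⟩ := hμ.weight_succ h hα hk ih.1
      refine ⟨h1, ?_⟩
      rw [h2, ih.2, vertexWeight_succ hk]
      ring
  rw [← this.2, ENNReal.ofReal_toReal this.1]

theorem HasGibbsMoments.moment_eq (hμ : HasGibbsMoments α (-α - γ) μ w) (h : IsParam α γ)
    (hα : α < 1) {k : ℕ} (parts : Fin k → ℕ) (hk : 2 ≤ k) (hp : ∀ j, 1 ≤ parts j) :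
    ∫⁻ s, distinctSum parts s ∂μ = ENNReal.ofReal ((w 2).toReal * (vertexWeight α γ k *
      (∏ j, risingWeight α (parts j)) / Real.Gamma (∑ j, parts j + (-α - γ)))) := by
  rw [hμ.moment k parts hk hp, hμ.weight_eq h hα hk, ← ENNReal.ofReal_mul]
  · congr 1
    ring
  · exact mul_nonneg ENNReal.toReal_nonneg (vertexWeight_nonneg h k)

/-- The density of the alpha-gamma dislocation measure. -/
noncomputable def alphaGammaDensity (α γ : ℝ) (s : ℕ → ℝ≥0∞) : ℝ≥0∞ :=
  ENNReal.ofReal (γ + (1 - α - γ) * (∑' i, ∑' j, if i = j then 0 else s i * s j).toReal)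

theorem measurable_alphaGammaDensity : Measurable (alphaGammaDensity α γ) := by
  refine ENNReal.measurable_ofReal.comp (measurable_const.add (measurable_const.mul
    (ENNReal.measurable_toReal.comp (Measurable.tsum fun i =>
      Measurable.tsum fun j => ?_))))
  split_ifs
  · exact measurable_const
  · exact (measurable_pi_apply i).mul (measurable_pi_apply j)

theorem tsum_sq_le {s : ℕ → ℝ≥0∞} (hs : ∑' i, s i = 1) (n : ℕ) (hn : 1 ≤ n) :
    ∑' i, s i ^ n ≤ 1 := by
  rw [← hs]
  refine ENNReal.tsum_le_tsum fun i => ?_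
  have h1 : s i ≤ 1 := hs ▸ ENNReal.le_tsum i
  obtain ⟨n, rfl⟩ := Nat.exists_eq_add_of_le' hn
  rw [pow_succ]
  exact mul_le_of_le_one_left' (pow_le_one' h1 n)

/-- On sequences with sum `1` the density is `1 - α - (1 - α - γ) ∑ sᵢ²`. As `1 - α - γ` may have
either sign, its positive and negative parts are on different sides. -/
theorem alphaGammaDensity_add (h : IsParam α γ) {s : ℕ → ℝ≥0∞} (hs : ∑' i, s i = 1) :
    alphaGammaDensity α γ s + ENNReal.ofReal (1 - α - γ) * ∑' i, s i ^ 2 =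
      ENNReal.ofReal (1 - α) + ENNReal.ofReal (-(1 - α - γ)) * ∑' i, s i ^ 2 := by
  set Q := ∑' i, s i ^ 2 with hQ
  have hQ1 : Q ≤ 1 := tsum_sq_le hs 2 (by norm_num)
  set P := ∑' i, ∑' j, if i = j then 0 else s i * s j with hP
  have hPQ : P + Q = 1 := by
    have : ∀ i, (∑' j, if i = j then 0 else s i * s j) + s i ^ 2 = s i := fun i => by
      have h1 : s i ^ 2 = ∑' j, if i = j then s i * s j else 0 := by
        rw [tsum_eq_single i]
        · simp [sq]
        · intro j hj
          simp [hj.symm]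
      rw [h1, ← ENNReal.tsum_add]
      calc _ = ∑' j, s i * s j := tsum_congr fun j => by split_ifs <;> simp
        _ = s i := by rw [ENNReal.tsum_mul_left, hs, mul_one]
    rw [hP, hQ, ← ENNReal.tsum_add]
    simp only [this, hs]
  have hQt : Q ≠ ∞ := ne_top_of_le_ne_top ENNReal.one_ne_top hQ1
  have hPt : P ≠ ∞ := ne_top_of_le_ne_top ENNReal.one_ne_top (hPQ ▸ le_self_add)
  have hr : P.toReal + Q.toReal = 1 := by
    rw [← ENNReal.toReal_add hPt hQt, hPQ, ENNReal.toReal_one]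
  have hq0 : 0 ≤ Q.toReal := ENNReal.toReal_nonneg
  have hp0 : 0 ≤ P.toReal := ENNReal.toReal_nonneg
  have := h.nonneg
  have := h.le_one
  rw [alphaGammaDensity, ← hP, ← ENNReal.ofReal_toReal hQt]
  obtain hc | hc := le_total 0 (1 - α - γ)
  · rw [ENNReal.ofReal_of_nonpos (p := -(1 - α - γ)) (by linarith), zero_mul, add_zero,
      ← ENNReal.ofReal_mul hc, ← ENNReal.ofReal_add (by positivity) (by positivity)]
    congr 1
    linear_combination (1 - α - γ) * hr
  · rw [ENNReal.ofReal_of_nonpos hc, zero_mul, add_zero, ← ENNReal.ofReal_mul (by linarith),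
      ← ENNReal.ofReal_add (by linarith) (mul_nonneg (by linarith) hq0)]
    congr 1
    linear_combination (1 - α - γ) * hr

/-- The moments after application of the density: by the product rule the factor `∑ sᵢ²` of the
density adds a part of size `2` or adds `2` to one of the parts. -/
theorem HasGibbsMoments.density_moment (hμ : HasGibbsMoments α (-α - γ) μ w) (h : IsParam α γ)
    (hα : α < 1) {k : ℕ} (parts : Fin k → ℕ) (hk : 2 ≤ k) (hp : ∀ j, 1 ≤ parts j) :
    ∫⁻ s, distinctSum parts s ∂(μ.withDensity (alphaGammaDensity α γ)) =
      ENNReal.ofReal ((w 2).toReal * (vertexWeight α γ k * (∏ j, risingWeight α (parts j)) *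
        sizeWeight α γ (Finset.univ.val.map parts) /
          Real.Gamma ((∑ j, parts j + 2 : ℕ) + (-α - γ)))) := by
  set n := ∑ j, parts j with hn
  have hn2 : 2 ≤ n := hk.trans (le_sum_parts hp)
  set ρ := ∏ j, risingWeight α (parts j) with hρ
  have hρ0 : 0 < ρ := prod_risingWeight_fin_pos hα hp
  set W := (w 2).toReal with hW
  have hW0 : 0 ≤ W := ENNReal.toReal_nonneg
  have hv0 := vertexWeight_nonneg h k
  obtain ⟨hk0, hG⟩ := Gamma_pos_of_two_le h hα hn2
  obtain ⟨-, hG2⟩ := Gamma_pos_of_two_le h hα (show 2 ≤ n + 2 by omega)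
  have hG' : Real.Gamma ((n + 2 : ℕ) + (-α - γ)) =
      (n + 1 + (-α - γ)) * ((n + (-α - γ)) * Real.Gamma (n + (-α - γ))) := by
    rw [← Real.Gamma_add_one hk0.ne', show (n : ℝ) + 1 + (-α - γ) = n + (-α - γ) + 1 by ring,
      ← Real.Gamma_add_one (by linarith)]
    push_cast
    ring_nf
  rw [lintegral_withDensity_eq_lintegral_mul _ measurable_alphaGammaDensity
    (measurable_distinctSum _)]
  set I := ∫⁻ s, (alphaGammaDensity α γ * distinctSum parts) s ∂μ with hI
  have hJ := hμ.moment_eq h hα parts hk hp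
  set x₁ := W * (((k - 1) * α - γ) * vertexWeight α γ k * ((1 - α) * ρ) /
    Real.Gamma ((n + 2 : ℕ) + (-α - γ))) with hx₁
  set x₂ := ∑ j, W * (vertexWeight α γ k *
    ((parts j + 1 - α) * (parts j - α) * ρ) / Real.Gamma ((n + 2 : ℕ) + (-α - γ))) with hx₂
  have hpos : ∀ j ∈ Finset.univ, 0 ≤ W * (vertexWeight α γ k *
      ((parts j + 1 - α) * (parts j - α) * ρ) / Real.Gamma ((n + 2 : ℕ) + (-α - γ))) := by
    intro j _
    have h1 : (1 : ℝ) ≤ parts j := by exact_mod_cast hp j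
    have h2 : 0 ≤ parts j + 1 - α := by linarith
    have h3 : 0 ≤ parts j - α := by linarith
    positivity
  have hx₁0 : 0 ≤ x₁ := by
    have h1 : 0 ≤ (k - 1) * α - γ := by
      have : (2 : ℝ) ≤ k := by exact_mod_cast hk
      nlinarith [h.nonneg, h.le]
    have h2 : 0 ≤ 1 - α := by linarith
    positivity
  have hx₂0 : 0 ≤ x₂ := Finset.sum_nonneg hpos
  -- The integral of the second power sum times the sum over distinct indices.
  have hX : ∫⁻ s, (∑' l, s l ^ 2) * distinctSum parts s ∂μ = ENNReal.ofReal (x₁ + x₂) := by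
    simp only [tsum_mul_distinctSum]
    rw [lintegral_add_left (measurable_distinctSum _),
      lintegral_finsetSum _ fun j _ => measurable_distinctSum _,
      hμ.moment_eq h hα _ (by omega) (one_le_cons hp (by norm_num)), ENNReal.ofReal_add hx₁0 hx₂0,
      hx₂, ENNReal.ofReal_sum_of_nonneg hpos]
    congr 1
    · have hr2 : risingWeight α 2 = (1 - α) := by
        have := risingWeight_succ hα (x := 1) le_rfl
        rw [risingWeight_one hα] at this
        simpa using this
      rw [vertexWeight_succ hk, Fin.prod_univ_succ, Fin.sum_univ_succ]
      simp only [Fin.cons_zero, Fin.cons_succ, hr2, ← hρ, ← hn, add_comm 2 n]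
      rfl
    · refine Finset.sum_congr rfl fun j _ => ?_
      rw [hμ.moment_eq h hα _ hk (one_le_update hp j 2), sum_update,
        prod_risingWeight_update parts j _ ((parts j + 1 - α) * (parts j - α))]
      rw [show parts j + 2 = (parts j + 1) + 1 from rfl,
        risingWeight_succ hα (by omega), risingWeight_succ hα (hp j)]
      push_cast
      ring
  have hmeasQ : Measurable fun s : ℕ → ℝ≥0∞ => (∑' l, s l ^ 2) * distinctSum parts s :=
    (Measurable.tsum fun l => (measurable_pi_apply l).pow_const 2).mul
      (measurable_distinctSum _)
  have key : I + ENNReal.ofReal (1 - α - γ) * ENNReal.ofReal (x₁ + x₂) =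
      ENNReal.ofReal (1 - α) * ENNReal.ofReal (W * (vertexWeight α γ k * ρ /
        Real.Gamma (n + (-α - γ)))) +
      ENNReal.ofReal (-(1 - α - γ)) * ENNReal.ofReal (x₁ + x₂) := by
    rw [← hX, ← hJ, ← lintegral_const_mul _ hmeasQ, ← lintegral_const_mul _ hmeasQ,
      ← lintegral_const_mul _ (measurable_distinctSum _), hI,
      ← lintegral_add_right _ (hmeasQ.const_mul _), ← lintegral_add_right _ (hmeasQ.const_mul _)]
    refine lintegral_congr_ae ?_
    filter_upwards [hμ.sum_eq] with s hs
    have := congrArg (· * distinctSum parts s) (alphaGammaDensity_add h hs)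
    simpa only [add_mul, mul_assoc, Pi.mul_apply] using this
  have hItop : I ≠ ∞ := by
    intro htop
    rw [htop, top_add] at key
    refine ENNReal.add_ne_top.2 ⟨?_, ?_⟩ key.symm <;>
      exact ENNReal.mul_ne_top ENNReal.ofReal_ne_top ENNReal.ofReal_ne_top
  have key' := congrArg ENNReal.toReal key
  have hj0 : 0 ≤ W * (vertexWeight α γ k * ρ / Real.Gamma (n + (-α - γ))) := by positivity
  rw [ENNReal.toReal_add hItop (ENNReal.mul_ne_top ENNReal.ofReal_ne_top ENNReal.ofReal_ne_top),
    ENNReal.toReal_add (ENNReal.mul_ne_top ENNReal.ofReal_ne_top ENNReal.ofReal_ne_top)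
      (ENNReal.mul_ne_top ENNReal.ofReal_ne_top ENNReal.ofReal_ne_top),
    ENNReal.toReal_mul, ENNReal.toReal_mul, ENNReal.toReal_mul,
    ENNReal.toReal_ofReal (add_nonneg hx₁0 hx₂0), ENNReal.toReal_ofReal hj0,
    ENNReal.toReal_ofReal (r := 1 - α) (by linarith), ENNReal.toReal_ofReal',
    ENNReal.toReal_ofReal'] at key'
  have hmax : max (1 - α - γ) 0 - max (-(1 - α - γ)) 0 = 1 - α - γ := by
    obtain hc | hc := le_total 0 (1 - α - γ)
    · rw [max_eq_left hc, max_eq_right (by linarith), sub_zero]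
    · rw [max_eq_right hc, max_eq_left (by linarith)]
      ring
  rw [← ENNReal.ofReal_toReal hItop]
  congr 1
  have hIr : I.toReal = (1 - α) * (W * (vertexWeight α γ k * ρ / Real.Gamma (n + (-α - γ)))) -
      (1 - α - γ) * (x₁ + x₂) := by
    linear_combination key' - (x₁ + x₂) * hmax
  set S := ∑ j, (parts j : ℝ) ^ 2 with hS
  have hx₂' : x₂ = W * (vertexWeight α γ k * ρ / Real.Gamma ((n + 2 : ℕ) + (-α - γ))) *
      (S + (1 - 2 * α) * n - k * (α * (1 - α))) := by
    have e1 : ∑ j, ((parts j : ℝ) + 1 - α) * (parts j - α) =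
        S + (1 - 2 * α) * n - k * (α * (1 - α)) := by
      have : ∀ j, ((parts j : ℝ) + 1 - α) * (parts j - α) =
          (parts j : ℝ) ^ 2 + (1 - 2 * α) * parts j - α * (1 - α) := fun j => by ring
      simp only [this, Finset.sum_sub_distrib, Finset.sum_add_distrib, ← Finset.mul_sum, hS, hn]
      simp
      ring
    rw [← e1, Finset.mul_sum, hx₂]
    exact Finset.sum_congr rfl fun j _ => by ring
  have hsz : sizeWeight α γ (Finset.univ.val.map parts) =
      γ * (n * (n - 1)) + (1 - α - γ) * ((n : ℝ) ^ 2 - S) := by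
    rw [sizeWeight, Multiset.map_map]
    rfl
  rw [hIr, hx₂', hx₁, hsz, hG']
  have hd1 : (n : ℝ) + 1 + (-α - γ) ≠ 0 := by linarith
  field_simp
  ring

/-- The sum of the powers decreases by the probability that the last of `n + 1` draws is the first
one to differ from the others. -/
theorem tsum_pow_succ_sub {s : ℕ → ℝ≥0∞} (hs : ∑' i, s i = 1) {n : ℕ} (hn : 1 ≤ n) :
    1 - ∑' i, s i ^ (n + 1) = (1 - ∑' i, s i ^ n) + distinctSum ![1, n] s := by
  have h1 := tsum_mul_distinctSum ![n] 1 s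
  have e : Function.update ![n] 0 (n + 1) = ![n + 1] := by
    ext i
    fin_cases i
    rfl
  simp only [pow_one, hs, one_mul, distinctSum_one, Finset.univ_unique, Fin.default_eq_zero,
    Finset.sum_singleton, Matrix.cons_val_fin_one, e] at h1
  have h2 := tsum_sq_le hs n hn
  refine (ENNReal.eq_sub_of_add_eq ?_ ?_).symm
  · exact ne_top_of_le_ne_top ENNReal.one_ne_top (tsum_sq_le hs (n + 1) (by omega))
  · rw [add_assoc]
    refine Eq.trans ?_ (tsub_add_cancel_of_le h2)
    rw [h1]
    rfl

/-- The constants `Zₙ` are found by induction from `Z₁ = 0`, the increments being moments with the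
parts `1` and `n`. -/
theorem HasGibbsMoments.kingmanConst_eq (hμ : HasGibbsMoments α (-α - γ) μ w) (h : IsParam α γ)
    (hα : α < 1) {n : ℕ} (hn : 1 ≤ n) :
    kingmanConst (μ.withDensity (alphaGammaDensity α γ)) n =
      ENNReal.ofReal ((w 2).toReal * (risingWeight α n * (n * (n - 1)) /
        Real.Gamma ((n + 2 : ℕ) + (-α - γ)))) := by
  have hsum := (withDensity_absolutelyContinuous μ (alphaGammaDensity α γ)).ae_le hμ.sum_eq
  induction n, hn using Nat.le_induction with
  | base =>
    simp only [Nat.cast_one, sub_self, mul_zero, zero_div, ENNReal.ofReal_zero]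
    rw [kingmanConst, lintegral_congr_ae (g := fun _ => 0), lintegral_zero]
    filter_upwards [hsum] with s hs
    simp [show ∑' i, s i = 1 from hs]
  | succ n hn ih =>
    have hn1 : (1 : ℝ) ≤ n := by exact_mod_cast hn
    have e : kingmanConst (μ.withDensity (alphaGammaDensity α γ)) (n + 1) =
        kingmanConst (μ.withDensity (alphaGammaDensity α γ)) n +
          ∫⁻ s, distinctSum ![1, n] s ∂(μ.withDensity (alphaGammaDensity α γ)) := by
      rw [kingmanConst, kingmanConst, ← lintegral_add_right _ (measurable_distinctSum _)]
      refine lintegral_congr_ae ?_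
      filter_upwards [hsum] with s hs
      exact tsum_pow_succ_sub hs hn
    have hp : ∀ j, 1 ≤ ![1, n] j := fun j => by
      fin_cases j
      · exact le_rfl
      · exact hn
    rw [e, ih, hμ.density_moment h hα ![1, n] le_rfl hp]
    have hs : ∑ j, ![1, n] j + 2 = n + 3 := by
      rw [Fin.sum_univ_two]
      simp
      ring
    have hm : (Finset.univ.val.map ![1, n] : Multiset ℕ) = {1, n} := by
      simp [Fin.univ_val_map]
      rfl
    obtain ⟨h0, hG⟩ := Gamma_pos_of_two_le h hα (show 2 ≤ n + 2 by omega)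
    have hG3 : Real.Gamma ((n + 3 : ℕ) + (-α - γ)) =
        ((n + 2 : ℕ) + (-α - γ)) * Real.Gamma ((n + 2 : ℕ) + (-α - γ)) := by
      rw [← Real.Gamma_add_one h0.ne']
      push_cast
      ring_nf
    have hr := risingWeight_pos hα hn
    have hW0 : 0 ≤ (w 2).toReal := ENNReal.toReal_nonneg
    have hsz := sizeWeight_nonneg h {1, n}
    rw [hs, hm, Fin.prod_univ_two, vertexWeight_two, show n + 1 + 2 = n + 3 from rfl, hG3,
      ← ENNReal.ofReal_add]
    · congr 1
      simp only [sizeWeight, Matrix.cons_val_zero, Matrix.cons_val_one, risingWeight_one hα,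
        risingWeight_succ hα hn, Multiset.insert_eq_cons, Multiset.sum_cons,
        Multiset.sum_singleton, Multiset.map_cons, Multiset.map_singleton]
      push_cast at *
      field_simp
      ring
    · have : 0 ≤ (n : ℝ) - 1 := by linarith
      positivity
    · simp only [Matrix.cons_val_zero, Matrix.cons_val_one, risingWeight_one hα]
      positivity

/-- The integral representation for a measure with Gibbs-type moments. -/
theorem HasGibbsMoments.hasIntegralRepresentation (hμ : HasGibbsMoments α (-α - γ) μ w)
    (h : IsParam α γ) (hα : α < 1) :
    HasIntegralRepresentation (splittingRule α γ) (μ.withDensity (alphaGammaDensity α γ)) := by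
  set ν := μ.withDensity (alphaGammaDensity α γ) with hν
  have hac := withDensity_absolutelyContinuous μ (alphaGammaDensity α γ)
  have hsum : ∀ᵐ s ∂ν, ∑' i, s i = 1 := hac.ae_le hμ.sum_eq
  have hanti : ∀ᵐ s ∂ν, Antitone s := hac.ae_le hμ.antitone
  have hne : ∀ᵐ s ∂ν, s 1 ≠ 0 := hac.ae_le hμ.ne_zero
  have hW0 : 0 < (w 2).toReal := ENNReal.toReal_pos hμ.two_ne_zero hμ.two_ne_top
  have hZpos : ∀ n, 2 ≤ n → 0 < (w 2).toReal * (risingWeight α n * (n * (n - 1)) /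
      Real.Gamma ((n + 2 : ℕ) + (-α - γ))) := fun n hn => by
    have h1 : (2 : ℝ) ≤ n := by exact_mod_cast hn
    have h2 := risingWeight_pos hα (show 1 ≤ n by omega)
    have h3 : 0 < (n : ℝ) - 1 := by linarith
    have h4 := (Gamma_pos_of_two_le h hα (show 2 ≤ n + 2 by omega)).2
    positivity
  have hZ : ∀ n, 2 ≤ n → kingmanConst ν n ≠ 0 ∧ kingmanConst ν n ≠ ∞ := fun n hn => by
    rw [hμ.kingmanConst_eq h hα (by omega)]
    exact ⟨by rw [ne_eq, ENNReal.ofReal_eq_zero, not_le]; exact hZpos n hn, ENNReal.ofReal_ne_top⟩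
  refine ⟨⟨?_, ?_, ?_⟩, ?_, hZ, ?_⟩
  · have : ∀ᵐ s ∂ν, s ∈ RankedSeq := by
      filter_upwards [hsum, hanti] with s h1 h2
      exact ⟨h2, h1.le⟩
    exact this
  · refine measure_mono_null (fun s hs => ?_) (ae_iff.1 hne)
    rw [Set.mem_singleton_iff.1 hs]
    simp
  · refine lt_of_le_of_lt ?_ (hZ 2 le_rfl).2.lt_top
    refine lintegral_mono_ae ?_
    filter_upwards [hsum, hanti] with s h1 h2
    refine tsub_le_tsub_left ?_ _
    calc ∑' i, s i ^ 2 ≤ ∑' i, s 0 * s i := ENNReal.tsum_le_tsum fun i => by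
          rw [sq]
          gcongr
          exact h2 (Nat.zero_le i)
      _ = s 0 := by rw [ENNReal.tsum_mul_left, h1, mul_one]
  · refine measure_mono_null (fun s hs => ?_) (ae_iff.1 hsum)
    exact (show ∑' i, s i < 1 from hs).ne
  · intro k parts hk hp
    have hn : 2 ≤ ∑ j, parts j := hk.trans (le_sum_parts hp)
    change _ = _ * ∫⁻ s, distinctSum parts s ∂ν
    rw [eppf_splittingRule h hα parts hk hp, hμ.kingmanConst_eq h hα (by omega),
      hμ.density_moment h hα parts hk hp, ← ENNReal.ofReal_inv_of_pos (hZpos _ hn),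
      ← ENNReal.ofReal_mul (inv_nonneg.2 (hZpos _ hn).le)]
    congr 1
    have h1 : (2 : ℝ) ≤ (∑ j, parts j : ℕ) := by exact_mod_cast hn
    have h2 := risingWeight_pos hα (show 1 ≤ ∑ j, parts j by omega)
    have h3 : ((∑ j, parts j : ℕ) : ℝ) - 1 ≠ 0 := by linarith
    have h4 := (Gamma_pos_of_two_le h hα (show 2 ≤ ∑ j, parts j + 2 by omega)).2
    have e1 : ((Finset.univ.val.map parts).map (risingWeight α)).prod =
        ∏ j, risingWeight α (parts j) := by
      rw [Multiset.map_map]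
      rfl
    have e2 : (Finset.univ.val.map parts).sum = ∑ j, parts j := rfl
    rw [alphaGammaEppf, e1, e2]
    simp only [Multiset.card_map, Finset.card_val, Finset.card_univ, Fintype.card_fin]
    field_simp

end Gibbs

/-! ### The binary case -/

theorem measurableSet_antitone : MeasurableSet {s : ℕ → ℝ≥0∞ | Antitone s} := by
  have : {s : ℕ → ℝ≥0∞ | Antitone s} = ⋂ i : ℕ, {s | s (i + 1) ≤ s i} := by
    ext s
    simp only [Set.mem_ofPred_eq, Set.mem_iInter]
    exact ⟨fun h i => h (Nat.le_succ i), antitone_nat_of_succ_le⟩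
  rw [this]
  exact MeasurableSet.iInter fun i =>
    measurableSet_le (measurable_pi_apply _) (measurable_pi_apply _)

theorem measurableSet_tsum_eq_one : MeasurableSet {s : ℕ → ℝ≥0∞ | ∑' i, s i = 1} :=
  measurableSet_eq_fun (Measurable.tsum fun i => measurable_pi_apply i) measurable_const

theorem measurableSet_apply_ne_zero (i : ℕ) : MeasurableSet {s : ℕ → ℝ≥0∞ | s i ≠ 0} :=
  (measurableSet_eq_fun (measurable_pi_apply i) measurable_const).compl

theorem lintegral_beta {a b : ℝ} (ha : 0 < a) (hb : 0 < b) :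
    ∫⁻ x in Set.Ioo (0 : ℝ) 1, ENNReal.ofReal (x ^ (a - 1) * (1 - x) ^ (b - 1)) =
      ENNReal.ofReal (Real.Gamma a * Real.Gamma b / Real.Gamma (a + b)) := by
  have hB := beta_pos ha hb
  have h := lintegral_betaPDF_eq_one ha hb
  rw [lintegral_betaPDF] at h
  have e : ∀ x : ℝ, ENNReal.ofReal (1 / beta a b * x ^ (a - 1) * (1 - x) ^ (b - 1)) =
      ENNReal.ofReal (1 / beta a b) * ENNReal.ofReal (x ^ (a - 1) * (1 - x) ^ (b - 1)) :=
    fun x => by rw [← ENNReal.ofReal_mul (by positivity), mul_assoc]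
  simp only [e] at h
  rw [lintegral_const_mul _ (by fun_prop)] at h
  have h2 : ENNReal.ofReal (beta a b) * ENNReal.ofReal (1 / beta a b) = 1 := by
    rw [← ENNReal.ofReal_mul hB.le, mul_one_div_cancel hB.ne', ENNReal.ofReal_one]
  calc _ = ENNReal.ofReal (beta a b) * (ENNReal.ofReal (1 / beta a b) *
        ∫⁻ x in Set.Ioo (0 : ℝ) 1, ENNReal.ofReal (x ^ (a - 1) * (1 - x) ^ (b - 1))) := by
        rw [← mul_assoc, h2, one_mul]
    _ = _ := by rw [h, mul_one, beta]

/-- The sequence `(x, 1 - x, 0, 0, …)`. -/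
noncomputable def binarySeq (x : ℝ) (i : ℕ) : ℝ≥0∞ :=
  if i = 0 then ENNReal.ofReal x else if i = 1 then ENNReal.ofReal (1 - x) else 0

theorem measurable_binarySeq : Measurable binarySeq := by
  refine measurable_pi_lambda _ fun i => ?_
  unfold binarySeq
  split_ifs <;> fun_prop

theorem tsum_binarySeq_pow (x : ℝ) {m : ℕ} (hm : 1 ≤ m) :
    ∑' l, binarySeq x l ^ m = ENNReal.ofReal x ^ m + ENNReal.ofReal (1 - x) ^ m := by
  rw [tsum_eq_sum (s := {0, 1})]
  · simp [binarySeq]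
  · intro l hl
    simp only [Finset.mem_insert, Finset.mem_singleton, not_or] at hl
    simp [binarySeq, hl.1, hl.2]
    omega

theorem distinctSum_binarySeq_two (x : ℝ) (parts : Fin 2 → ℕ) (hp : ∀ j, 1 ≤ parts j) :
    distinctSum parts (binarySeq x) =
      ENNReal.ofReal x ^ parts 0 * ENNReal.ofReal (1 - x) ^ parts 1 +
      ENNReal.ofReal (1 - x) ^ parts 0 * ENNReal.ofReal x ^ parts 1 := by
  have h := tsum_mul_distinctSum ![parts 1] (parts 0) (binarySeq x)
  have e : Function.update ![parts 1] 0 (parts 1 + parts 0) = ![parts 1 + parts 0] := by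
    ext i
    fin_cases i
    rfl
  have e' : (Fin.cons (parts 0) ![parts 1] : Fin 2 → ℕ) = parts := by
    ext i
    fin_cases i <;> rfl
  have h0 := hp 0
  have h1 := hp 1
  simp only [Finset.univ_unique, Fin.default_eq_zero, Finset.sum_singleton,
    Matrix.cons_val_fin_one, e, distinctSum_one, tsum_binarySeq_pow x h0,
    tsum_binarySeq_pow x h1, tsum_binarySeq_pow x (h1.trans (Nat.le_add_right _ (parts 0)))] at h
  rw [e'] at h
  have hfin : ENNReal.ofReal x ^ (parts 1 + parts 0) +
      ENNReal.ofReal (1 - x) ^ (parts 1 + parts 0) ≠ ∞ :=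
    ENNReal.add_ne_top.2 ⟨ENNReal.pow_ne_top ENNReal.ofReal_ne_top,
      ENNReal.pow_ne_top ENNReal.ofReal_ne_top⟩
  refine (ENNReal.add_left_inj hfin).1 (h.symm.trans ?_)
  ring

theorem distinctSum_binarySeq_of_three_le (x : ℝ) {k : ℕ} (hk : 3 ≤ k) (parts : Fin k → ℕ)
    (hp : ∀ j, 1 ≤ parts j) : distinctSum parts (binarySeq x) = 0 := by
  refine ENNReal.tsum_eq_zero.2 fun i => ?_
  have : ∃ j, 2 ≤ i j := by
    by_contra! hlt
    have := Fintype.card_le_of_injective (fun j => (⟨i j, hlt j⟩ : Fin 2)) fun a b hab =>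
      i.injective (Fin.mk.inj hab)
    simp at this
    omega
  obtain ⟨j, hj⟩ := this
  refine Finset.prod_eq_zero (Finset.mem_univ j) ?_
  have h1 := hp j
  rw [binarySeq, if_neg (by omega), if_neg (by omega), zero_pow (by omega)]

/-- The binary dislocation measure before its density is applied. -/
noncomputable def binaryMeasure (α : ℝ) : Measure (ℕ → ℝ≥0∞) :=
  ((volume.restrict (Set.Ioo (1 / 2 : ℝ) 1)).withDensity fun x =>
    ENNReal.ofReal (x ^ (-α - 1) * (1 - x) ^ (-α - 1))).map binarySeq

theorem PDStar_of_eq (α : ℝ) : PDStar α (-α - α) = binaryMeasure α := by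
  rw [PDStar, if_pos (by ring)]
  rfl

theorem ae_binaryMeasure {α : ℝ} {p : (ℕ → ℝ≥0∞) → Prop} (hp : MeasurableSet {s | p s})
    (h : ∀ x ∈ Set.Ioo (1 / 2 : ℝ) 1, p (binarySeq x)) : ∀ᵐ s ∂binaryMeasure α, p s := by
  rw [binaryMeasure, ae_map_iff measurable_binarySeq.aemeasurable hp]
  refine (withDensity_absolutelyContinuous _ _).ae_le ?_
  exact ae_restrict_of_forall_mem measurableSet_Ioo h

theorem lintegral_binaryMeasure (α : ℝ) {f : (ℕ → ℝ≥0∞) → ℝ≥0∞} (hf : Measurable f) :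
    ∫⁻ s, f s ∂binaryMeasure α = ∫⁻ x in Set.Ioo (1 / 2 : ℝ) 1,
      ENNReal.ofReal (x ^ (-α - 1) * (1 - x) ^ (-α - 1)) * f (binarySeq x) := by
  rw [binaryMeasure, lintegral_map hf measurable_binarySeq]
  exact lintegral_withDensity_eq_lintegral_mul _ (by fun_prop) (hf.comp measurable_binarySeq)

/-- Folding the unit interval at `1 / 2`. -/
theorem lintegral_fold {g : ℝ → ℝ≥0∞} (hg : Measurable g) :
    ∫⁻ x in Set.Ioo (1 / 2 : ℝ) 1, (g x + g (1 - x)) = ∫⁻ x in Set.Ioo (0 : ℝ) 1, g x := by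
  have h1 : ∫⁻ x in Set.Ioo (1 / 2 : ℝ) 1, g (1 - x) = ∫⁻ x in Set.Ioo (0 : ℝ) (1 / 2), g x := by
    rw [← lintegral_indicator measurableSet_Ioo, ← lintegral_indicator measurableSet_Ioo,
      ← lintegral_sub_left_eq_self _ (1 : ℝ)]
    refine lintegral_congr fun x => ?_
    simp only [Set.indicator, Set.mem_Ioo, sub_sub_cancel]
    congr 1
    refine propext ⟨fun h => ⟨by linarith [h.2], by linarith [h.1]⟩,
      fun h => ⟨by linarith [h.2], by linarith [h.1]⟩⟩
  rw [lintegral_add_left hg, h1, setLIntegral_congr (Ioo_ae_eq_Ioc (a := (0 : ℝ))), add_comm,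
    ← Set.Ioc_union_Ioo_eq_Ioo (show (0 : ℝ) ≤ 1 / 2 by norm_num) (by norm_num),
    lintegral_union measurableSet_Ioo]
  exact Set.disjoint_left.2 fun x h h' => not_le.2 h'.1 h.2

/-- The moments are Beta integrals; moments over three or more distinct indices vanish. -/
theorem hasGibbsMoments_binaryMeasure {α : ℝ} (hα : α < 1) :
    HasGibbsMoments α (-α - α) (binaryMeasure α)
      fun k => if k = 2 then ENNReal.ofReal (Real.Gamma (1 - α) ^ 2) else 0 where
  antitone := ae_binaryMeasure measurableSet_antitone fun x hx => by
    refine antitone_nat_of_succ_le fun n => ?_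
    match n with
    | 0 =>
      simp only [binarySeq]
      simp only [zero_add, one_ne_zero, if_false, if_true]
      exact ENNReal.ofReal_le_ofReal (by linarith [hx.1])
    | n + 1 => simp [binarySeq]
  sum_eq := ae_binaryMeasure measurableSet_tsum_eq_one fun x hx => by
    have := tsum_binarySeq_pow x le_rfl
    simp only [pow_one] at this
    rw [this, ← ENNReal.ofReal_add (by linarith [hx.1]) (by linarith [hx.2])]
    simp
  ne_zero := ae_binaryMeasure (measurableSet_apply_ne_zero 1) fun x hx => by
    simp only [binarySeq, one_ne_zero, if_false, if_true, ne_eq, ENNReal.ofReal_eq_zero, not_le]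
    linarith [hx.2]
  moment := fun k parts hk hp => by
    rw [lintegral_binaryMeasure α (measurable_distinctSum parts)]
    obtain rfl | hk := hk.eq_or_lt
    · have h0 : (1 : ℝ) ≤ parts 0 := by exact_mod_cast hp 0
      have h1 : (1 : ℝ) ≤ parts 1 := by exact_mod_cast hp 1
      have hmeas : Measurable fun x : ℝ => ENNReal.ofReal
        (x ^ ((parts 0 : ℝ) - α - 1) * (1 - x) ^ ((parts 1 : ℝ) - α - 1)) := by fun_prop
      have hG : 0 < Real.Gamma (1 - α) := Real.Gamma_pos_of_pos (by linarith)
      have hpow : ∀ x : ℝ, 0 < x → ∀ n : ℕ, x ^ (-α - 1) * x ^ n = x ^ ((n : ℝ) - α - 1) :=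
        fun x hx n => by
          rw [← Real.rpow_natCast, ← Real.rpow_add hx]
          ring_nf
      rw [if_pos rfl, ← ENNReal.ofReal_mul (by positivity), Fin.prod_univ_two, Fin.sum_univ_two]
      have e : Real.Gamma (1 - α) ^ 2 * (risingWeight α (parts 0) * risingWeight α (parts 1) /
          Real.Gamma ((parts 0 + parts 1 : ℕ) + (-α - α))) =
          Real.Gamma (parts 0 - α) * Real.Gamma (parts 1 - α) /
            Real.Gamma ((parts 0 - α) + (parts 1 - α)) := by
        rw [risingWeight, risingWeight]
        push_cast
        field_simp
        ring_nf
      rw [e, ← lintegral_beta (by linarith) (by linarith), ← lintegral_fold hmeas]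
      refine setLIntegral_congr_fun measurableSet_Ioo fun x hx => ?_
      have hx0 : 0 < x := by linarith [hx.1]
      have hx1 : 0 < 1 - x := by linarith [hx.2]
      rw [distinctSum_binarySeq_two x parts hp, sub_sub_cancel, ← hpow x hx0, ← hpow x hx0,
        ← hpow _ hx1, ← hpow _ hx1, ← ENNReal.ofReal_pow hx0.le, ← ENNReal.ofReal_pow hx1.le,
        ← ENNReal.ofReal_pow hx0.le, ← ENNReal.ofReal_pow hx1.le,
        ← ENNReal.ofReal_mul (by positivity), ← ENNReal.ofReal_mul (by positivity), mul_add,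
        ← ENNReal.ofReal_mul (by positivity), ← ENNReal.ofReal_mul (by positivity)]
      congr 2 <;> ring
    · rw [if_neg (by omega), zero_mul]
      simp only [distinctSum_binarySeq_of_three_le _ (show 3 ≤ k from hk) parts hp, mul_zero,
        lintegral_zero]
  two_ne_zero := by
    have hG : 0 < Real.Gamma (1 - α) := Real.Gamma_pos_of_pos (by linarith)
    rw [if_pos rfl, ne_eq, ENNReal.ofReal_eq_zero, not_le]
    positivity
  two_ne_top := by
    rw [if_pos rfl]
    exact ENNReal.ofReal_ne_top

/-! ### The arrival times of a Poisson process -/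

/-- The law of a sequence of independent standard exponential variables. -/
noncomputable abbrev expSeq : Measure (ℕ → ℝ) := Measure.infinitePi fun _ : ℕ => expMeasure 1

instance isProbabilityMeasure_expMeasure_one : IsProbabilityMeasure (expMeasure 1) :=
  isProbabilityMeasure_expMeasure one_pos

theorem lintegral_rpow_mul_exp {a r : ℝ} (ha : 0 < a) (hr : 0 < r) :
    ∫⁻ x in Set.Ioi (0 : ℝ), ENNReal.ofReal (x ^ (a - 1) * Real.exp (-(r * x))) =
      ENNReal.ofReal (Real.Gamma a * r ^ (-a)) := by
  have hG := Real.Gamma_pos_of_pos ha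
  have hc : 0 < r ^ a / Real.Gamma a := by positivity
  have h := lintegral_gammaPDF_eq_one ha hr
  have e : ∀ x, gammaPDF a r x = Set.indicator (Set.Ici 0) (fun x =>
      ENNReal.ofReal (r ^ a / Real.Gamma a) *
        ENNReal.ofReal (x ^ (a - 1) * Real.exp (-(r * x)))) x := fun x => by
    by_cases hx : 0 ≤ x
    · rw [Set.indicator_of_mem (Set.mem_Ici.2 hx), gammaPDF_of_nonneg hx,
        ← ENNReal.ofReal_mul hc.le, mul_assoc]
    · rw [Set.indicator_of_notMem (by simpa using hx), gammaPDF_of_neg (not_le.1 hx)]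
  simp only [e] at h
  rw [lintegral_indicator measurableSet_Ici, setLIntegral_congr Ioi_ae_eq_Ici.symm,
    lintegral_const_mul _ (by fun_prop)] at h
  have h2 : ENNReal.ofReal (Real.Gamma a * r ^ (-a)) * ENNReal.ofReal (r ^ a / Real.Gamma a) =
      1 := by
    rw [← ENNReal.ofReal_mul (by positivity), Real.rpow_neg hr.le, ← ENNReal.ofReal_one]
    congr 1
    field_simp
  rw [← one_mul (∫⁻ x in _, _), ← h2, mul_assoc, h, mul_one]

theorem lintegral_expMeasure {g : ℝ → ℝ≥0∞} (hg : Measurable g) :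
    ∫⁻ x, g x ∂expMeasure 1 = ∫⁻ x in Set.Ioi (0 : ℝ), ENNReal.ofReal (Real.exp (-x)) * g x := by
  have hm : Measurable (gammaPDF 1 1) := (measurable_gammaPDFReal 1 1).ennreal_ofReal
  rw [expMeasure, gammaMeasure, lintegral_withDensity_eq_lintegral_mul _ hm hg,
    ← setLIntegral_congr (Ioi_ae_eq_Ici (a := (0 : ℝ))).symm,
    ← lintegral_indicator measurableSet_Ici]
  refine lintegral_congr fun x => ?_
  simp only [Pi.mul_apply, Set.indicator, Set.mem_Ici]
  split_ifs with h
  · rw [show gammaPDF 1 1 x = exponentialPDF 1 x from rfl, exponentialPDF_of_nonneg h]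
    simp
  · rw [gammaPDF_of_neg (not_le.1 h), zero_mul]

theorem ae_expMeasure_pos : ∀ᵐ x ∂expMeasure 1, 0 < x := by
  have h : Measurable fun x : ℝ => if 0 < x then (0 : ℝ≥0∞) else 1 :=
    Measurable.ite measurableSet_Ioi measurable_const measurable_const
  have := lintegral_expMeasure h
  rw [setLIntegral_congr_fun (g := fun _ => 0) measurableSet_Ioi
    (fun x hx => by simp [Set.mem_Ioi.1 hx]), lintegral_zero, lintegral_eq_zero_iff h] at this
  filter_upwards [this] with x hx
  by_contra hx0
  simp [hx0] at hx

/-- The sequence with first term `x` followed by the terms of `E`. -/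
def consSeq (x : ℝ) (E : ℕ → ℝ) : ℕ → ℝ
  | 0 => x
  | n + 1 => E n

theorem measurable_consSeq : Measurable fun p : ℝ × (ℕ → ℝ) => consSeq p.1 p.2 := by
  refine measurable_pi_lambda _ fun n => ?_
  cases n with
  | zero => exact measurable_fst
  | succ n => exact (measurable_pi_apply n).comp measurable_snd

theorem map_consSeq : ((expMeasure 1).prod expSeq).map (fun p => consSeq p.1 p.2) = expSeq := by
  classical
  refine Measure.eq_infinitePi _ fun s t ht => ?_
  rw [Measure.map_apply measurable_consSeq
    (MeasurableSet.pi s.countable_toSet fun i _ => ht i)]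
  let u : Finset ℕ := s.preimage Nat.succ (Nat.succ_injective.injOn)
  have hu : ∀ i, i ∈ u ↔ i + 1 ∈ s := fun i => Finset.mem_preimage
  have e : (fun p : ℝ × (ℕ → ℝ) => consSeq p.1 p.2) ⁻¹' (Set.pi s t) =
      (if 0 ∈ s then t 0 else Set.univ) ×ˢ Set.pi u fun i => t (i + 1) := by
    ext ⟨x, E⟩
    simp only [Set.mem_preimage, Set.mem_pi, Set.mem_prod, Finset.mem_coe, hu]
    constructor
    · intro h
      refine ⟨?_, fun i hi => h (i + 1) hi⟩
      split_ifs with h0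
      · exact h 0 h0
      · trivial
    · rintro ⟨h1, h2⟩ i hi
      cases i with
      | zero => rwa [if_pos hi] at h1
      | succ i => exact h2 i hi
  have hs : ∏ i ∈ s, expMeasure 1 (t i) =
      expMeasure 1 (if 0 ∈ s then t 0 else Set.univ) * ∏ i ∈ u, expMeasure 1 (t (i + 1)) := by
    have h1 : ∏ i ∈ u, expMeasure 1 (t (i + 1)) = ∏ i ∈ s.erase 0, expMeasure 1 (t i) := by
      refine Finset.prod_bij (fun i _ => i + 1) ?_ ?_ ?_ ?_
      · intro i hi
        exact Finset.mem_erase.2 ⟨Nat.succ_ne_zero i, (hu i).1 hi⟩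
      · intro i _ j _ h
        exact Nat.succ_injective h
      · intro i hi
        obtain ⟨h0, hi⟩ := Finset.mem_erase.1 hi
        obtain ⟨j, rfl⟩ := Nat.exists_eq_succ_of_ne_zero h0
        exact ⟨j, (hu j).2 hi, rfl⟩
      · intro i _
        rfl
    rw [h1]
    split_ifs with h0
    · exact (Finset.mul_prod_erase s (fun i => expMeasure 1 (t i)) h0).symm
    · rw [Finset.erase_eq_of_notMem h0, measure_univ, one_mul]
  rw [e, Measure.prod_prod, hs, Measure.infinitePi_pi _ fun i _ => ht (i + 1)]

theorem lintegral_expSeq {F : (ℕ → ℝ) → ℝ≥0∞} (hF : Measurable F) :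
    ∫⁻ E, F E ∂expSeq = ∫⁻ x, ∫⁻ E, F (consSeq x E) ∂expSeq ∂expMeasure 1 := by
  conv_lhs => rw [← map_consSeq]
  rw [lintegral_map hF measurable_consSeq, lintegral_prod]
  exact (hF.comp measurable_consSeq).aemeasurable

/-- The arrival times of a Poisson process with interarrival times `E`. -/
noncomputable def arrival (E : ℕ → ℝ) (i : ℕ) : ℝ := ∑ j ∈ Finset.range (i + 1), E j

theorem measurable_arrival : Measurable arrival :=
  measurable_pi_lambda _ fun _ => Finset.measurable_sum _ fun j _ => measurable_pi_apply j

theorem arrival_consSeq (x : ℝ) (E : ℕ → ℝ) :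
    arrival (consSeq x E) = consSeq x fun i => x + arrival E i := by
  ext i
  cases i with
  | zero => simp [arrival, consSeq]
  | succ i => rw [arrival, Finset.sum_range_succ', add_comm]; rfl

theorem ae_expSeq_pos : ∀ᵐ E ∂expSeq, ∀ i, 0 < E i := by
  refine ae_all_iff.2 fun i => ?_
  have h := measurePreserving_eval_infinitePi (fun _ : ℕ => expMeasure 1) i
  exact h.quasiMeasurePreserving.ae ae_expMeasure_pos

theorem arrival_strictMono {E : ℕ → ℝ} (hE : ∀ i, 0 < E i) : StrictMono (arrival E) :=
  strictMono_nat_of_lt_succ fun i => by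
    rw [arrival, arrival, Finset.sum_range_succ _ (i + 1)]
    linarith [hE (i + 1)]

theorem arrival_pos {E : ℕ → ℝ} (hE : ∀ i, 0 < E i) (i : ℕ) : 0 < arrival E i :=
  Finset.sum_pos (fun j _ => hE j) ⟨0, by simp⟩

theorem lintegral_exp_neg_arrival (n : ℕ) :
    ∫⁻ E, ENNReal.ofReal (Real.exp (-arrival E n)) ∂expSeq = 2⁻¹ ^ (n + 1) := by
  have h2 : ∫⁻ x, ENNReal.ofReal (Real.exp (-x)) ∂expMeasure 1 = 2⁻¹ := by
    have h := lintegral_rpow_mul_exp (a := 1) (r := 2) one_pos two_pos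
    rw [lintegral_expMeasure (by fun_prop)]
    simp only [sub_self, Real.rpow_zero, one_mul, Real.Gamma_one, Real.rpow_neg_one] at h
    rw [ENNReal.ofReal_inv_of_pos two_pos, ENNReal.ofReal_ofNat] at h
    refine Eq.trans (lintegral_congr fun x => ?_) h
    rw [← ENNReal.ofReal_mul (Real.exp_pos _).le, ← Real.exp_add]
    ring_nf
  induction n with
  | zero =>
    have h := measurePreserving_eval_infinitePi (fun _ : ℕ => expMeasure 1) 0
    have := h.lintegral_comp (f := fun x => ENNReal.ofReal (Real.exp (-x))) (by fun_prop)
    simp only [zero_add, pow_one, ← h2, ← this]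
    refine lintegral_congr fun E => ?_
    simp [arrival]
  | succ n ih =>
    have hm : ∀ n, Measurable fun E => ENNReal.ofReal (Real.exp (-arrival E n)) := fun n =>
      ENNReal.measurable_ofReal.comp (Real.measurable_exp.comp
        ((measurable_pi_apply _).comp measurable_arrival).neg)
    rw [lintegral_expSeq (hm _)]
    have e : ∀ x E, ENNReal.ofReal (Real.exp (-arrival (consSeq x E) (n + 1))) =
        ENNReal.ofReal (Real.exp (-x)) * ENNReal.ofReal (Real.exp (-arrival E n)) := fun x E => by
      rw [← ENNReal.ofReal_mul (Real.exp_pos _).le, ← Real.exp_add, arrival_consSeq]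
      simp only [consSeq]
      ring_nf
    simp only [e]
    simp only [lintegral_const_mul _ (hm n), ih]
    rw [lintegral_mul_const _ (by fun_prop), h2, pow_succ' _ (n + 1)]

/-- The arrival times are unbounded, since the sum of their negative exponentials has finite
mean. -/
theorem ae_exists_lt_arrival : ∀ᵐ E ∂expSeq, ∀ t : ℝ, ∃ n, t < arrival E n := by
  have hm : ∀ n, Measurable fun E => ENNReal.ofReal (Real.exp (-arrival E n)) := fun n =>
    ENNReal.measurable_ofReal.comp (Real.measurable_exp.comp
      ((measurable_pi_apply _).comp measurable_arrival).neg)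
  have h : ∫⁻ E, ∑' n, ENNReal.ofReal (Real.exp (-arrival E n)) ∂expSeq ≠ ∞ := by
    rw [lintegral_tsum fun n => (hm n).aemeasurable]
    simp only [lintegral_exp_neg_arrival]
    rw [ENNReal.tsum_geometric_add_one]
    norm_num
  filter_upwards [ae_lt_top (Measurable.tsum hm) h] with E hE t
  have := ENNReal.tendsto_atTop_zero_of_tsum_ne_top hE.ne
  have := (this.eventually_lt_const (u := ENNReal.ofReal (Real.exp (-t)))
    (ENNReal.ofReal_pos.2 (Real.exp_pos _))).exists
  obtain ⟨n, hn⟩ := this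
  refine ⟨n, ?_⟩
  have := (ENNReal.ofReal_lt_ofReal_iff (Real.exp_pos _)).1 hn
  have := Real.exp_lt_exp.1 this
  linarith

theorem measurable_setLIntegral_Ioo {X : Type*} [MeasurableSpace X] {a b : X → ℝ}
    (ha : Measurable a) (hb : Measurable b) {g : X → ℝ → ℝ≥0∞}
    (hg : Measurable (Function.uncurry g)) :
    Measurable fun x => ∫⁻ t in Set.Ioo (a x) (b x), g x t := by
  have : ∀ x, ∫⁻ t in Set.Ioo (a x) (b x), g x t = ∫⁻ t, Set.indicator
      {p : X × ℝ | a p.1 < p.2 ∧ p.2 < b p.1} (Function.uncurry g) (x, t) := fun x => by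
    rw [← lintegral_indicator measurableSet_Ioo]
    rfl
  simp only [this]
  refine Measurable.lintegral_prod_right' (hg.indicator ?_)
  exact (measurableSet_lt (ha.comp measurable_fst) measurable_snd).inter
    (measurableSet_lt measurable_snd (hb.comp measurable_fst))

/-- Two successive arrival times, the first of which is uniform given the second. -/
theorem lintegral_two_arrivals {H : ℝ → ℝ → ℝ≥0∞} (hH : Measurable (Function.uncurry H)) :
    ∫⁻ x, ∫⁻ y, H x (x + y) ∂expMeasure 1 ∂expMeasure 1 =
      ∫⁻ s, (∫⁻ x in Set.Ioo 0 s, H x s) ∂expMeasure 1 := by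
  have hH2 : ∀ x, Measurable (H x) := fun x => hH.comp measurable_prodMk_left
  have e1 : ∀ x, ∫⁻ y, H x (x + y) ∂expMeasure 1 = ∫⁻ s, Set.indicator (Set.Ioi x)
      (fun s => ENNReal.ofReal (Real.exp (-(s - x))) * H x s) s := fun x => by
    rw [lintegral_expMeasure (g := fun y => H x (x + y)) ((hH2 x).comp (measurable_const_add x)),
      ← lintegral_indicator measurableSet_Ioi,
      ← lintegral_sub_right_eq_self _ x]
    refine lintegral_congr fun s => ?_
    simp only [Set.indicator, Set.mem_Ioi, sub_pos, add_sub_cancel]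
  have hK : Measurable (Function.uncurry fun x s : ℝ =>
      Set.indicator {p : ℝ × ℝ | 0 < p.1 ∧ p.1 < p.2}
        (fun p => ENNReal.ofReal (Real.exp (-p.2)) * H p.1 p.2) (x, s)) := by
    refine Measurable.indicator (f := fun p : ℝ × ℝ =>
      ENNReal.ofReal (Real.exp (-p.2)) * H p.1 p.2) ?_ ?_
    · exact (by fun_prop : Measurable fun p : ℝ × ℝ => ENNReal.ofReal (Real.exp (-p.2))).mul hH
    · exact (measurableSet_lt measurable_const measurable_fst).inter
        (measurableSet_lt measurable_fst measurable_snd)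
  have hm1 : Measurable fun x => ∫⁻ y, H x (x + y) ∂expMeasure 1 :=
    Measurable.lintegral_prod_right' (f := fun p : ℝ × ℝ => H p.1 (p.1 + p.2))
      (hH.comp (by fun_prop : Measurable fun p : ℝ × ℝ => (p.1, p.1 + p.2)))
  have hm2 : Measurable fun s => ∫⁻ x in Set.Ioo 0 s, H x s :=
    measurable_setLIntegral_Ioo measurable_const measurable_id (hH.comp measurable_swap)
  rw [lintegral_expMeasure hm1, lintegral_expMeasure hm2, ← lintegral_indicator measurableSet_Ioi,
    ← lintegral_indicator measurableSet_Ioi]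
  calc _ = ∫⁻ x, ∫⁻ s, Set.indicator {p : ℝ × ℝ | 0 < p.1 ∧ p.1 < p.2}
        (fun p => ENNReal.ofReal (Real.exp (-p.2)) * H p.1 p.2) (x, s) := by
        refine lintegral_congr fun x => ?_
        by_cases hx : 0 < x
        · rw [Set.indicator_of_mem (Set.mem_Ioi.2 hx), e1, ← lintegral_const_mul']
          · refine lintegral_congr fun s => ?_
            simp only [Set.indicator, Set.mem_Ioi, Set.mem_ofPred_eq, hx, true_and, mul_ite,
              mul_zero]
            refine if_congr Iff.rfl ?_ rfl
            rw [← mul_assoc, ← ENNReal.ofReal_mul (Real.exp_pos _).le, ← Real.exp_add]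
            ring_nf
          · exact ENNReal.ofReal_ne_top
        · rw [Set.indicator_of_notMem (by simpa using hx)]
          simp [Set.indicator, hx]
    _ = ∫⁻ s, ∫⁻ x, Set.indicator {p : ℝ × ℝ | 0 < p.1 ∧ p.1 < p.2}
        (fun p => ENNReal.ofReal (Real.exp (-p.2)) * H p.1 p.2) (x, s) :=
        lintegral_lintegral_swap hK.aemeasurable
    _ = _ := by
        refine lintegral_congr fun s => ?_
        by_cases hs : 0 < s
        · rw [Set.indicator_of_mem (Set.mem_Ioi.2 hs), ← lintegral_const_mul' _ _
            ENNReal.ofReal_ne_top, ← lintegral_indicator measurableSet_Ioo]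
          rfl
        · rw [Set.indicator_of_notMem (by simpa using hs)]
          have : ∀ x, ¬ (0 < x ∧ x < s) := fun x h => hs (h.1.trans h.2)
          simp [Set.indicator, this]

/-- The increasing enumeration of the indices other than `i`. -/
def skip (i j : ℕ) : ℕ := if j < i then j else j + 1

theorem skip_injective (i : ℕ) : Function.Injective (skip i) := fun a b h => by
  simp only [skip] at h
  split_ifs at h <;> omega

theorem skip_ne (i j : ℕ) : skip i j ≠ i := by
  rw [skip]
  split_ifs <;> omega

theorem exists_skip {i j : ℕ} (h : j ≠ i) : ∃ l, skip i l = j := by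
  obtain h | h := h.lt_or_gt
  · exact ⟨j, if_pos h⟩
  · exact ⟨j - 1, by rw [skip, if_neg (by omega)]; omega⟩

/-- The left end of the interval between arrivals that ends at the arrival with index `i`. -/
noncomputable def prevArrival (E : ℕ → ℝ) : ℕ → ℝ
  | 0 => 0
  | i + 1 => arrival E i

theorem measurable_arrival_apply (i : ℕ) : Measurable fun E => arrival E i :=
  (measurable_pi_apply i).comp measurable_arrival

theorem measurable_prevArrival (i : ℕ) : Measurable fun E => prevArrival E i := by
  cases i with
  | zero => exact measurable_const
  | succ i => exact measurable_arrival_apply i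

theorem measurable_comp_skip (i : ℕ) : Measurable fun T : ℕ → ℝ => T ∘ skip i :=
  measurable_pi_lambda _ fun j => measurable_pi_apply (skip i j)

theorem measurable_consSeq_add :
    Measurable fun p : ℝ × (ℕ → ℝ) => consSeq p.1 fun i => p.1 + p.2 i :=
  measurable_consSeq.comp (measurable_fst.prodMk (measurable_pi_lambda _ fun i =>
    measurable_fst.add ((measurable_pi_apply i).comp measurable_snd)))

/-- Deleting an arrival from a Poisson process: the deleted arrival is distributed like a uniform
point in the interval between arrivals in which it was. -/
theorem lintegral_arrival_skip (i : ℕ) {G : ℝ → (ℕ → ℝ) → ℝ≥0∞}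
    (hG : Measurable (Function.uncurry G)) :
    ∫⁻ E, G (arrival E i) (arrival E ∘ skip i) ∂expSeq =
      ∫⁻ E, (∫⁻ t in Set.Ioo (prevArrival E i) (arrival E i), G t (arrival E)) ∂expSeq := by
  have hL : ∀ i, ∀ G : ℝ → (ℕ → ℝ) → ℝ≥0∞, Measurable (Function.uncurry G) →
      Measurable fun E => G (arrival E i) (arrival E ∘ skip i) := fun i G hG =>
    hG.comp ((measurable_arrival_apply i).prodMk ((measurable_comp_skip i).comp measurable_arrival))
  have hR : ∀ i, ∀ G : ℝ → (ℕ → ℝ) → ℝ≥0∞, Measurable (Function.uncurry G) → Measurable fun E =>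
      ∫⁻ t in Set.Ioo (prevArrival E i) (arrival E i), G t (arrival E) := fun i G hG =>
    measurable_setLIntegral_Ioo (measurable_prevArrival i) (measurable_arrival_apply i)
      (hG.comp (measurable_snd.prodMk (measurable_arrival.comp measurable_fst)))
  induction i generalizing G with
  | zero =>
    have hH : Measurable (Function.uncurry fun x s : ℝ =>
        ∫⁻ E, G x (consSeq s fun i => s + arrival E i) ∂expSeq) := by
      refine Measurable.lintegral_prod_right' (ν := expSeq) (f := fun p : (ℝ × ℝ) × (ℕ → ℝ) =>
        G p.1.1 (consSeq p.1.2 fun i => p.1.2 + arrival p.2 i)) ?_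
      refine hG.comp ((measurable_fst.comp measurable_fst).prodMk (measurable_consSeq_add.comp
        ((measurable_snd.comp measurable_fst).prodMk (measurable_arrival.comp measurable_snd))))
    have e1 : ∀ x y E, G (arrival (consSeq x (consSeq y E)) 0)
        (arrival (consSeq x (consSeq y E)) ∘ skip 0) =
        G x (consSeq (x + y) fun i => x + y + arrival E i) := fun x y E => by
      rw [arrival_consSeq, arrival_consSeq]
      congr 1
      ext j
      cases j with
      | zero => rfl
      | succ j => simp [consSeq, skip, add_assoc]
    have e2 : ∀ x E, ∫⁻ t in Set.Ioo (prevArrival (consSeq x E) 0) (arrival (consSeq x E) 0),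
        G t (arrival (consSeq x E)) =
        ∫⁻ t in Set.Ioo 0 x, G t (consSeq x fun i => x + arrival E i) := fun x E => by
      rw [arrival_consSeq]
      rfl
    rw [lintegral_expSeq (hL 0 G hG), lintegral_expSeq (hR 0 G hG)]
    simp only [e2]
    have e3 : ∀ x, ∫⁻ E, G (arrival (consSeq x E) 0) (arrival (consSeq x E) ∘ skip 0) ∂expSeq =
        ∫⁻ y, ∫⁻ E, G x (consSeq (x + y) fun i => x + y + arrival E i) ∂expSeq ∂expMeasure 1 :=
      fun x => by
        rw [lintegral_expSeq (F := fun E => G (arrival (consSeq x E) 0)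
          (arrival (consSeq x E) ∘ skip 0))
          ((hL 0 G hG).comp (measurable_consSeq.comp measurable_prodMk_left))]
        simp only [e1]
    simp only [e3]
    rw [lintegral_two_arrivals hH]
    refine lintegral_congr fun s => ?_
    refine lintegral_lintegral_swap (f := fun x E => G x (consSeq s fun i => s + arrival E i)) ?_
    refine Measurable.aemeasurable (hG.comp (measurable_fst.prodMk (measurable_consSeq_add.comp
      (measurable_const.prodMk (measurable_arrival.comp measurable_snd)))))
  | succ i ih =>
    rw [lintegral_expSeq (hL (i + 1) G hG), lintegral_expSeq (hR (i + 1) G hG)]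
    refine lintegral_congr fun x => ?_
    have hG' : Measurable (Function.uncurry fun (t : ℝ) (T : ℕ → ℝ) =>
        G (x + t) (consSeq x fun i => x + T i)) :=
      hG.comp ((measurable_const.add measurable_fst).prodMk (measurable_consSeq_add.comp
        (measurable_const.prodMk measurable_snd)))
    refine Eq.trans (lintegral_congr fun E => ?_) ((ih hG').trans (lintegral_congr fun E => ?_))
    · rw [arrival_consSeq]
      congr 1
      ext j
      cases j with
      | zero => rfl
      | succ j =>
        simp only [Function.comp_apply, skip, Nat.add_lt_add_iff_right, consSeq]
        split_ifs <;> rfl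
    · rw [← lintegral_indicator measurableSet_Ioo, ← lintegral_indicator measurableSet_Ioo]
      refine Eq.trans ?_ (lintegral_add_left_eq_self _ x)
      refine lintegral_congr fun t => ?_
      have hp : prevArrival (consSeq x E) (i + 1) = x + prevArrival E i := by
        rw [prevArrival, arrival_consSeq]
        cases i with
        | zero => simp [consSeq, prevArrival]
        | succ i => rfl
      simp only [Set.indicator, Set.mem_Ioo, hp, arrival_consSeq]
      simp only [consSeq, add_lt_add_iff_left]

/-- The Mecke equation: choosing an arrival of a Poisson process and deleting it amounts to an
independent choice of a point of `(0, ∞)` from Lebesgue measure. -/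
theorem lintegral_tsum_arrival {G : ℝ → (ℕ → ℝ) → ℝ≥0∞} (hG : Measurable (Function.uncurry G)) :
    ∫⁻ E, ∑' i, G (arrival E i) (arrival E ∘ skip i) ∂expSeq =
      ∫⁻ E, (∫⁻ t in Set.Ioi 0, G t (arrival E)) ∂expSeq := by
  have hL : ∀ i, Measurable fun E => G (arrival E i) (arrival E ∘ skip i) := fun i =>
    hG.comp ((measurable_arrival_apply i).prodMk ((measurable_comp_skip i).comp measurable_arrival))
  have hR : ∀ i, Measurable fun E =>
      ∫⁻ t in Set.Ioo (prevArrival E i) (arrival E i), G t (arrival E) := fun i =>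
    measurable_setLIntegral_Ioo (measurable_prevArrival i) (measurable_arrival_apply i)
      (hG.comp (measurable_snd.prodMk (measurable_arrival.comp measurable_fst)))
  rw [lintegral_tsum fun i => (hL i).aemeasurable]
  simp only [lintegral_arrival_skip _ hG]
  rw [← lintegral_tsum fun i => (hR i).aemeasurable]
  refine lintegral_congr_ae ?_
  filter_upwards [ae_expSeq_pos, ae_exists_lt_arrival] with E hE hE'
  have hmono : Monotone (prevArrival E) := monotone_nat_of_le_succ fun i => by
    cases i with
    | zero => exact (arrival_pos hE 0).le
    | succ i => exact (arrival_strictMono hE).monotone (Nat.le_succ i)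
  have hU : Set.Ioi (0 : ℝ) = ⋃ i, Set.Ioc (prevArrival E i) (arrival E i) := by
    ext t
    simp only [Set.mem_Ioi, Set.mem_iUnion, Set.mem_Ioc]
    constructor
    · intro ht
      have hex : ∃ n, t ≤ arrival E n := (hE' t).imp fun n hn => hn.le
      classical
      refine ⟨Nat.find hex, ?_, Nat.find_spec hex⟩
      cases h : Nat.find hex with
      | zero => exact ht
      | succ i => exact not_le.1 (Nat.find_min hex (by omega))
    · rintro ⟨i, hi, -⟩
      exact (hmono (Nat.zero_le i)).trans_lt hi
  have hd : Pairwise (Function.onFun Disjoint fun i => Set.Ioc (prevArrival E i) (arrival E i)) :=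
    hmono.pairwise_disjoint_on_Ioc_succ
  rw [hU, lintegral_iUnion (fun i => measurableSet_Ioc) hd]
  exact tsum_congr fun i => setLIntegral_congr Ioo_ae_eq_Ioc

theorem tsum_eq_add_tsum_skip (a : ℕ → ℝ≥0∞) (i : ℕ) :
    ∑' l, a l = a i + ∑' l, a (skip i l) := by
  rw [ENNReal.tsum_eq_add_tsum_ite i]
  congr 1
  have : Set.range (skip i) = {i}ᶜ := by
    ext j
    refine ⟨?_, fun h => exists_skip h⟩
    rintro ⟨l, rfl⟩
    exact skip_ne i l
  rw [← tsum_range a (skip_injective i), this, tsum_subtype]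
  refine tsum_congr fun l => ?_
  simp [Set.indicator, ite_not]

/-- Choosing `k + 1` distinct indices by choosing the first one and then the others among the
remaining ones. -/
theorem tsum_embedding_succ (k : ℕ) (F : (Fin (k + 1) → ℕ) → ℝ≥0∞) :
    ∑' i : Fin (k + 1) ↪ ℕ, F i =
      ∑' l, ∑' i : Fin k ↪ ℕ, F (Fin.cons l fun j => skip l (i j)) := by
  let g : ℕ × (Fin k ↪ ℕ) → (Fin (k + 1) ↪ ℕ) := fun p =>
    ⟨Fin.cons p.1 fun j => skip p.1 (p.2 j), by
      refine Fin.cons_injective_iff.2 ⟨?_, (skip_injective p.1).comp p.2.injective⟩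
      rintro ⟨j, hj⟩
      exact skip_ne _ _ hj⟩
  have hg : Function.Bijective g := by
    constructor
    · rintro ⟨l, i⟩ ⟨l', i'⟩ h
      have h : (Fin.cons l fun j => skip l (i j) : Fin (k + 1) → ℕ) =
          Fin.cons l' fun j => skip l' (i' j) :=
        congrArg (fun e : Fin (k + 1) ↪ ℕ => (e : Fin (k + 1) → ℕ)) h
      obtain ⟨rfl, h⟩ := Fin.cons_inj.1 h
      refine Prod.ext rfl (DFunLike.ext _ _ fun j => skip_injective l (congrFun h j))
    · intro e
      have h : ∀ j : Fin k, ∃ l, skip (e 0) l = e j.succ := fun j =>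
        exists_skip fun h => Fin.succ_ne_zero j (e.injective h)
      choose i hi using h
      refine ⟨⟨e 0, ⟨i, fun a b hab => ?_⟩⟩, ?_⟩
      · have : e a.succ = e b.succ := by rw [← hi, ← hi, hab]
        exact Fin.succ_injective _ (e.injective this)
      · ext j
        refine Fin.cases rfl (fun j => ?_) j
        exact hi j
  rw [← (Equiv.ofBijective g hg).tsum_eq, ENNReal.tsum_prod']
  rfl

/-- The multivariate Mecke equation for functionals that are products over the arrivals. -/
theorem lintegral_tsum_embedding {ξ : ℝ≥0∞ → ℝ≥0∞} (hξ : Measurable ξ)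
    (hadd : ∀ a b, ξ (a + b) = ξ a * ξ b) {f : ℝ → ℝ≥0∞} (hf : Measurable f) {k : ℕ}
    {h : Fin k → ℝ → ℝ≥0∞} (hh : ∀ j, Measurable (h j)) :
    ∫⁻ E, (∑' i : Fin k ↪ ℕ, ∏ j, h j (arrival E (i j))) * ξ (∑' l, f (arrival E l)) ∂expSeq =
      (∏ j, ∫⁻ t in Set.Ioi 0, h j t * ξ (f t)) * ∫⁻ E, ξ (∑' l, f (arrival E l)) ∂expSeq := by
  induction k with
  | zero =>
    simp
  | succ k ih =>
    let Φ : (ℕ → ℝ) → ℝ≥0∞ := fun T =>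
      (∑' i : Fin k ↪ ℕ, ∏ j, h j.succ (T (i j))) * ξ (∑' l, f (T l))
    have hΦ : Measurable Φ := by
      refine (Measurable.tsum fun i => Finset.measurable_prod _ fun j _ =>
        (hh _).comp (measurable_pi_apply _)).mul (hξ.comp (Measurable.tsum fun l =>
          hf.comp (measurable_pi_apply l)))
    have hG : Measurable (Function.uncurry fun t T => h 0 t * ξ (f t) * Φ T) :=
      (((hh 0).mul (hξ.comp hf)).comp measurable_fst).mul (hΦ.comp measurable_snd)
    have e : ∀ E, (∑' i : Fin (k + 1) ↪ ℕ, ∏ j, h j (arrival E (i j))) *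
        ξ (∑' l, f (arrival E l)) =
        ∑' l, h 0 (arrival E l) * ξ (f (arrival E l)) * Φ (arrival E ∘ skip l) := fun E => by
      rw [tsum_embedding_succ k fun i => ∏ j, h j (arrival E (i j)), ← ENNReal.tsum_mul_right]
      refine tsum_congr fun l => ?_
      rw [tsum_eq_add_tsum_skip _ l, hadd]
      simp only [Fin.prod_univ_succ, Fin.cons_zero, Fin.cons_succ, ENNReal.tsum_mul_left]
      simp only [Φ, Function.comp_apply]
      ring
    simp only [e]
    rw [lintegral_tsum_arrival hG]
    have hm : Measurable fun t => h 0 t * ξ (f t) := (hh 0).mul (hξ.comp hf)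
    simp only [lintegral_mul_const _ hm]
    rw [lintegral_const_mul (f := fun E => Φ (arrival E)) _ (hΦ.comp measurable_arrival),
      Fin.prod_univ_succ, mul_assoc,
      ← ih fun j => hh j.succ]

/-! ### Gamma integrals of extended nonnegative variables -/

/-- The function `y ↦ exp (-y)` on `[0, ∞]`. -/
noncomputable def expNeg (y : ℝ≥0∞) : ℝ≥0∞ :=
  if y = ∞ then 0 else ENNReal.ofReal (Real.exp (-y.toReal))

theorem expNeg_ofReal {x : ℝ} (hx : 0 ≤ x) :
    expNeg (ENNReal.ofReal x) = ENNReal.ofReal (Real.exp (-x)) := by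
  rw [expNeg, if_neg ENNReal.ofReal_ne_top, ENNReal.toReal_ofReal hx]

theorem expNeg_add (a b : ℝ≥0∞) : expNeg (a + b) = expNeg a * expNeg b := by
  by_cases ha : a = ∞
  · simp [expNeg, ha]
  by_cases hb : b = ∞
  · simp [expNeg, hb]
  rw [expNeg, expNeg, expNeg, if_neg ha, if_neg hb, if_neg (ENNReal.add_ne_top.2 ⟨ha, hb⟩),
    ← ENNReal.ofReal_mul (Real.exp_pos _).le, ← Real.exp_add, ENNReal.toReal_add ha hb]
  ring_nf

theorem measurable_expNeg : Measurable expNeg :=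
  Measurable.ite (measurableSet_singleton ∞) measurable_const
    (ENNReal.measurable_ofReal.comp (Real.measurable_exp.comp ENNReal.measurable_toReal.neg))

theorem lintegral_rpow_mul_expNeg {a : ℝ} (ha : 0 < a) {s : ℝ≥0∞} (h0 : s ≠ 0) (ht : s ≠ ∞) :
    ∫⁻ l in Set.Ioi (0 : ℝ), ENNReal.ofReal (l ^ (a - 1)) * expNeg (ENNReal.ofReal l * s) =
      ENNReal.ofReal (Real.Gamma a) * s ^ (-a) := by
  have hs : 0 < s.toReal := ENNReal.toReal_pos h0 ht
  have e : s ^ (-a) = ENNReal.ofReal (s.toReal ^ (-a)) := by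
    rw [← ENNReal.ofReal_rpow_of_pos hs, ENNReal.ofReal_toReal ht]
  rw [e, ← ENNReal.ofReal_mul (Real.Gamma_pos_of_pos ha).le, ← lintegral_rpow_mul_exp ha hs]
  refine setLIntegral_congr_fun measurableSet_Ioi fun l hl => ?_
  have hl : 0 < l := hl
  conv_lhs => rw [← ENNReal.ofReal_toReal ht]
  rw [← ENNReal.ofReal_mul hl.le, expNeg_ofReal (by positivity),
    ← ENNReal.ofReal_mul (by positivity), mul_comm l]

/-- Negative moments as integrals of Laplace transforms. -/
theorem lintegral_rpow_mul_laplace {Ω : Type*} [MeasurableSpace Ω] {P : Measure Ω} [SFinite P]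
    {a : ℝ} (ha : 0 < a) {σ H : Ω → ℝ≥0∞} (hσ : Measurable σ) (hH : Measurable H)
    (h0 : ∀ᵐ x ∂P, σ x ≠ 0) (ht : ∀ᵐ x ∂P, σ x ≠ ∞) :
    ∫⁻ l in Set.Ioi (0 : ℝ), ENNReal.ofReal (l ^ (a - 1)) *
        ∫⁻ x, H x * expNeg (ENNReal.ofReal l * σ x) ∂P =
      ENNReal.ofReal (Real.Gamma a) * ∫⁻ x, H x * σ x ^ (-a) ∂P := by
  have hm : Measurable fun p : ℝ × Ω => expNeg (ENNReal.ofReal p.1 * σ p.2) :=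
    measurable_expNeg.comp ((ENNReal.measurable_ofReal.comp measurable_fst).mul
      (hσ.comp measurable_snd))
  have hl : Measurable fun l : ℝ => ENNReal.ofReal (l ^ (a - 1)) := by fun_prop
  calc _ = ∫⁻ l in Set.Ioi (0 : ℝ), ∫⁻ x, ENNReal.ofReal (l ^ (a - 1)) *
        (H x * expNeg (ENNReal.ofReal l * σ x)) ∂P :=
        lintegral_congr fun l => (lintegral_const_mul _
          (hH.mul (hm.comp measurable_prodMk_left))).symm
    _ = ∫⁻ x, (∫⁻ l in Set.Ioi (0 : ℝ), ENNReal.ofReal (l ^ (a - 1)) *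
        (H x * expNeg (ENNReal.ofReal l * σ x))) ∂P :=
        lintegral_lintegral_swap ((hl.comp measurable_fst).mul
          ((hH.comp measurable_snd).mul hm)).aemeasurable
    _ = ∫⁻ x, ENNReal.ofReal (Real.Gamma a) * (H x * σ x ^ (-a)) ∂P := by
        refine lintegral_congr_ae ?_
        filter_upwards [h0, ht] with x hx0 hxt
        rw [mul_left_comm, ← lintegral_rpow_mul_expNeg ha hx0 hxt, ← lintegral_const_mul]
        · exact lintegral_congr fun l => mul_left_comm _ _ _
        · exact hl.mul (hm.comp measurable_prodMk_right)
    _ = _ := lintegral_const_mul _ (hH.mul (hσ.pow_const _))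

/-! ### The jumps of a stable subordinator -/

/-- The inverse of the tail `x ↦ x ^ (-α) / Γ(1 - α)` of the stable Lévy measure. -/
noncomputable def jumpSize (α t : ℝ) : ℝ≥0∞ :=
  ENNReal.ofReal ((Real.Gamma (1 - α) * t) ^ (-1 / α))

theorem measurable_jumpSize (α : ℝ) : Measurable (jumpSize α) := by
  unfold jumpSize
  fun_prop

section Stable

variable {α : ℝ}

theorem jumpSize_anti (h0 : 0 < α) (h1 : α < 1) {t u : ℝ} (ht : 0 < t) (htu : t ≤ u) :
    jumpSize α u ≤ jumpSize α t := by
  have hG : 0 < Real.Gamma (1 - α) := Real.Gamma_pos_of_pos (by linarith)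
  refine ENNReal.ofReal_le_ofReal (Real.rpow_le_rpow_of_nonpos (by positivity) (by gcongr) ?_)
  rw [neg_div]
  exact neg_nonpos.2 (by positivity)

theorem jumpSize_ne_zero (h1 : α < 1) {t : ℝ} (ht : 0 < t) : jumpSize α t ≠ 0 := by
  have hG : 0 < Real.Gamma (1 - α) := Real.Gamma_pos_of_pos (by linarith)
  rw [jumpSize, ne_eq, ENNReal.ofReal_eq_zero, not_le]
  positivity

/-- The image of Lebesgue measure under `jumpSize α` is the stable Lévy measure. -/
theorem lintegral_jumpSize (h0 : 0 < α) (h1 : α < 1) (H : ℝ≥0∞ → ℝ≥0∞) :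
    ∫⁻ t in Set.Ioi 0, H (jumpSize α t) = ∫⁻ y in Set.Ioi (0 : ℝ),
      ENNReal.ofReal (α / Real.Gamma (1 - α) * y ^ (-α - 1)) * H (ENNReal.ofReal y) := by
  have hG : 0 < Real.Gamma (1 - α) := Real.Gamma_pos_of_pos (by linarith)
  let ψ : ℝ → ℝ := fun y => y ^ (-α) / Real.Gamma (1 - α)
  have hψ : ∀ y, 0 < y → (Real.Gamma (1 - α) * ψ y) ^ (-1 / α) = y := fun y hy => by
    simp only [ψ]
    rw [mul_div_cancel₀ _ hG.ne', ← Real.rpow_mul hy.le]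
    have : -α * (-1 / α) = 1 := by field_simp
    rw [this, Real.rpow_one]
  have himg : ψ '' Set.Ioi 0 = Set.Ioi 0 := by
    ext t
    constructor
    · rintro ⟨y, hy, rfl⟩
      have hy : 0 < y := hy
      exact Set.mem_Ioi.2 (by positivity)
    · intro ht
      have ht : 0 < t := ht
      refine ⟨(Real.Gamma (1 - α) * t) ^ (-1 / α), Set.mem_Ioi.2 (by positivity), ?_⟩
      simp only [ψ]
      rw [← Real.rpow_mul (by positivity)]
      have : -1 / α * -α = 1 := by field_simp
      rw [this, Real.rpow_one, mul_div_cancel_left₀ _ hG.ne']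
  have hder : ∀ y ∈ Set.Ioi (0 : ℝ), HasDerivWithinAt ψ
      (-α * y ^ (-α - 1) / Real.Gamma (1 - α)) (Set.Ioi 0) y := fun y hy =>
    ((Real.hasDerivAt_rpow_const (Or.inl (Set.mem_Ioi.1 hy).ne')).div_const _).hasDerivWithinAt
  have hinj : Set.InjOn ψ (Set.Ioi 0) := fun x hx y hy hxy => by
    rw [← hψ x hx, hxy, hψ y hy]
  have h := lintegral_image_eq_lintegral_abs_deriv_mul measurableSet_Ioi hder hinj
    fun t => H (jumpSize α t)
  rw [himg] at h
  rw [h]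
  refine setLIntegral_congr_fun measurableSet_Ioi fun y hy => ?_
  have hy : 0 < y := hy
  rw [jumpSize, hψ y hy, neg_mul, neg_div, abs_neg, abs_of_nonneg (by positivity)]
  congr 2
  ring

theorem lintegral_jumpSize_pow (h0 : 0 < α) (h1 : α < 1) {n : ℕ} (hn : 1 ≤ n) {l : ℝ}
    (hl : 0 < l) :
    ∫⁻ t in Set.Ioi 0, jumpSize α t ^ n * expNeg (ENNReal.ofReal l * jumpSize α t) =
      ENNReal.ofReal (α * risingWeight α n * l ^ (α - n)) := by
  have hG : 0 < Real.Gamma (1 - α) := Real.Gamma_pos_of_pos (by linarith)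
  have hn1 : (1 : ℝ) ≤ n := by exact_mod_cast hn
  rw [lintegral_jumpSize h0 h1 fun y => y ^ n * expNeg (ENNReal.ofReal l * y)]
  calc _ = ∫⁻ y in Set.Ioi (0 : ℝ), ENNReal.ofReal (α / Real.Gamma (1 - α)) *
        ENNReal.ofReal (y ^ ((n - α : ℝ) - 1) * Real.exp (-(l * y))) := by
        refine setLIntegral_congr_fun measurableSet_Ioi fun y hy => ?_
        have hy : 0 < y := hy
        rw [← ENNReal.ofReal_mul hl.le, expNeg_ofReal (by positivity), ← ENNReal.ofReal_pow hy.le,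
          ← ENNReal.ofReal_mul (by positivity), ← ENNReal.ofReal_mul (by positivity),
          ← ENNReal.ofReal_mul (by positivity), show (n - α : ℝ) - 1 = (-α - 1) + n by ring,
          Real.rpow_add hy, Real.rpow_natCast]
        congr 1
        ring
    _ = _ := by
        rw [lintegral_const_mul _ (by fun_prop), lintegral_rpow_mul_exp (by linarith) hl,
          ← ENNReal.ofReal_mul (by positivity), risingWeight, neg_sub]
        congr 1
        field_simp

theorem measurable_stableJump (α : ℝ) : Measurable (stableJump α) :=
  measurable_pi_lambda _ fun i => (measurable_jumpSize α).comp (measurable_arrival_apply i)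

theorem measurable_stableValue (α : ℝ) : Measurable (stableValue α) :=
  Measurable.tsum fun i => (measurable_pi_apply i).comp (measurable_stableJump α)

theorem ae_stableJump_antitone (h0 : 0 < α) (h1 : α < 1) :
    ∀ᵐ E ∂expSeq, Antitone (stableJump α E) := by
  filter_upwards [ae_expSeq_pos] with E hE i j hij
  exact jumpSize_anti h0 h1 (arrival_pos hE i) ((arrival_strictMono hE).monotone hij)

theorem ae_stableJump_ne_zero (h1 : α < 1) : ∀ᵐ E ∂expSeq, ∀ i, stableJump α E i ≠ 0 := by
  filter_upwards [ae_expSeq_pos] with E hE i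
  exact jumpSize_ne_zero h1 (arrival_pos hE i)

theorem ae_stableValue_ne_zero (h1 : α < 1) : ∀ᵐ E ∂expSeq, stableValue α E ≠ 0 := by
  filter_upwards [ae_stableJump_ne_zero h1] with E hE h
  exact hE 0 (ENNReal.tsum_eq_zero.1 h 0)

theorem setLIntegral_jumpSize_ne_top (h0 : 0 < α) (h1 : α < 1) :
    ∫⁻ t in Set.Ioi 0, Set.indicator (Set.Ioi 1) (jumpSize α) t ≠ ∞ := by
  have hG : 0 < Real.Gamma (1 - α) := Real.Gamma_pos_of_pos (by linarith)
  have hlt : -1 / α < -1 := by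
    rw [div_lt_iff₀ h0]
    linarith
  have hi : IntegrableOn (fun t : ℝ => (Real.Gamma (1 - α) * t) ^ (-1 / α)) (Set.Ioi 1) := by
    refine IntegrableOn.congr_fun ((integrableOn_Ioi_rpow_of_lt hlt one_pos).const_mul
      (Real.Gamma (1 - α) ^ (-1 / α))) (fun t ht => ?_) measurableSet_Ioi
    have ht : 1 < t := ht
    exact (Real.mul_rpow hG.le (by linarith)).symm
  have hle : ∫⁻ t in Set.Ioi 0, Set.indicator (Set.Ioi 1) (jumpSize α) t ≤
      ∫⁻ t in Set.Ioi 1, jumpSize α t := by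
    rw [← lintegral_indicator measurableSet_Ioi (jumpSize α)]
    exact setLIntegral_le_lintegral _ _
  exact ne_top_of_le_ne_top hi.lintegral_lt_top.ne hle

/-- The jumps of the stable subordinator are summable: those of bounded size have finite mean sum,
and only finitely many others occur. -/
theorem ae_stableValue_ne_top (h0 : 0 < α) (h1 : α < 1) : ∀ᵐ E ∂expSeq, stableValue α E ≠ ∞ := by
  let g : ℝ → ℝ≥0∞ := Set.indicator (Set.Ioi 1) (jumpSize α)
  have hg : Measurable g := (measurable_jumpSize α).indicator measurableSet_Ioi
  have hM := lintegral_tsum_arrival (G := fun t _ => g t) (hg.comp measurable_fst)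
  rw [lintegral_const, measure_univ, mul_one] at hM
  have hm : Measurable fun E => ∑' i, g (arrival E i) :=
    Measurable.tsum fun i => hg.comp (measurable_arrival_apply i)
  have hM' : ∫⁻ E, ∑' i, g (arrival E i) ∂expSeq ≠ ∞ :=
    hM.trans_ne (setLIntegral_jumpSize_ne_top h0 h1)
  filter_upwards [ae_lt_top hm hM', ae_expSeq_pos, ae_exists_lt_arrival] with E hE hpos hex
  obtain ⟨N, hN⟩ := hex 1
  have h1 : ∑ i ∈ Finset.range N, stableJump α E i ≠ ∞ :=
    ENNReal.sum_ne_top.2 fun i _ => ENNReal.ofReal_ne_top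
  have h2 : ∑' i, stableJump α E (i + N) = ∑' i, g (arrival E (i + N)) := by
    refine tsum_congr fun i => ?_
    have : arrival E N ≤ arrival E (i + N) :=
      (arrival_strictMono hpos).monotone (Nat.le_add_left _ _)
    exact (Set.indicator_of_mem (Set.mem_Ioi.2 (hN.trans_le this)) (jumpSize α)).symm
  have h3 : ∑' i, g (arrival E (i + N)) ≤ ∑' i, g (arrival E i) :=
    ENNReal.tsum_comp_le_tsum_of_injective (add_left_injective N) _
  have h4 : ∑ i ∈ Finset.range N, stableJump α E i + ∑' i, stableJump α E (i + N) =
      stableValue α E := ENNReal.summable.sum_add_tsum_nat_add' (f := stableJump α E)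
  rw [← h4, h2]
  exact ENNReal.add_ne_top.2 ⟨h1, ne_top_of_le_ne_top hE.ne h3⟩

theorem lintegral_distinctSum_mul_laplace (h0 : 0 < α) (h1 : α < 1) {k : ℕ} {parts : Fin k → ℕ}
    (hp : ∀ j, 1 ≤ parts j) {l : ℝ} (hl : 0 < l) :
    ∫⁻ E, distinctSum parts (stableJump α E) * expNeg (ENNReal.ofReal l * stableValue α E) ∂expSeq =
      ENNReal.ofReal (α ^ k * ∏ j, risingWeight α (parts j)) *
        (ENNReal.ofReal (l ^ (k * α - ∑ j, parts j)) *
          ∫⁻ E, expNeg (ENNReal.ofReal l * stableValue α E) ∂expSeq) := by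
  have h := lintegral_tsum_embedding (ξ := fun y => expNeg (ENNReal.ofReal l * y))
    (measurable_expNeg.comp (measurable_id.const_mul _))
    (fun a b => by rw [mul_add, expNeg_add]) (measurable_jumpSize α) (k := k)
    (h := fun j t => jumpSize α t ^ parts j) fun j => (measurable_jumpSize α).pow_const _
  refine h.trans ?_
  have hr : ∀ j, 0 ≤ risingWeight α (parts j) := fun j => (risingWeight_pos h1 (hp j)).le
  rw [← mul_assoc, ← ENNReal.ofReal_mul
    (mul_nonneg (by positivity) (Finset.prod_nonneg fun j _ => hr j))]
  congr 1
  rw [Finset.prod_congr rfl fun j _ => lintegral_jumpSize_pow h0 h1 (hp j) hl,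
    ← ENNReal.ofReal_prod_of_nonneg fun j _ => mul_nonneg (mul_nonneg h0.le (hr j)) (by positivity),
    Finset.prod_mul_distrib, Finset.prod_mul_distrib, Finset.prod_const, Finset.card_univ,
    Fintype.card_fin, ← Real.rpow_sum_of_pos hl]
  simp [Finset.sum_sub_distrib]

end Stable

/-! ### The stable case -/

section Stable

variable {α ϑ : ℝ}

theorem measurable_normalizedJumps (α : ℝ) :
    Measurable fun E i => stableJump α E i / stableValue α E :=
  measurable_pi_lambda _ fun i =>
    ((measurable_pi_apply i).comp (measurable_stableJump α)).div (measurable_stableValue α)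

theorem lintegral_PDStar (hϑ : ϑ ≠ -2 * α) {f : (ℕ → ℝ≥0∞) → ℝ≥0∞} (hf : Measurable f) :
    ∫⁻ s, f s ∂PDStar α ϑ = ∫⁻ E, stableValue α E ^ (-ϑ) *
      f (fun i => stableJump α E i / stableValue α E) ∂expSeq := by
  rw [PDStar, if_neg hϑ, lintegral_map hf (measurable_normalizedJumps α)]
  exact lintegral_withDensity_eq_lintegral_mul _ ((measurable_stableValue α).pow_const _)
    (hf.comp (measurable_normalizedJumps α))

theorem ae_PDStar (hϑ : ϑ ≠ -2 * α) {p : (ℕ → ℝ≥0∞) → Prop} (hp : MeasurableSet {s | p s})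
    (h : ∀ᵐ E ∂expSeq, p fun i => stableJump α E i / stableValue α E) :
    ∀ᵐ s ∂PDStar α ϑ, p s := by
  rw [PDStar, if_neg hϑ, ae_map_iff (measurable_normalizedJumps α).aemeasurable hp]
  exact (withDensity_absolutelyContinuous _ _).ae_le h

theorem distinctSum_div {k : ℕ} (parts : Fin k → ℕ) (s : ℕ → ℝ≥0∞) (c : ℝ≥0∞) :
    distinctSum parts (fun i => s i / c) = distinctSum parts s * c⁻¹ ^ ∑ j, parts j := by
  rw [distinctSum, distinctSum, ← ENNReal.tsum_mul_right]
  refine tsum_congr fun i => ?_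
  simp only [div_eq_mul_inv, mul_pow]
  rw [Finset.prod_mul_distrib, Finset.prod_pow_eq_pow_sum]

/-- The moments of the Poisson-Dirichlet measures are computed by writing the negative power of the
value of the subordinator as a Gamma integral of exponentials, which turns them into integrals of
products over the points of a Poisson process. -/
theorem lintegral_distinctSum_PDStar (h0 : 0 < α) (h1 : α < 1) (hϑ : -2 * α < ϑ) {k : ℕ}
    (hk : 2 ≤ k) (parts : Fin k → ℕ) (hp : ∀ j, 1 ≤ parts j) :
    ∫⁻ s, distinctSum parts s ∂PDStar α ϑ =
      (ENNReal.ofReal (α ^ k * Real.Gamma (k * α + ϑ)) *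
        ∫⁻ E, stableValue α E ^ (-(k * α + ϑ)) ∂expSeq) *
      ENNReal.ofReal ((∏ j, risingWeight α (parts j)) / Real.Gamma (∑ j, parts j + ϑ)) := by
  have hk2 : (2 : ℝ) ≤ k := by exact_mod_cast hk
  have hkn : (k : ℝ) ≤ ∑ j, (parts j : ℝ) := by exact_mod_cast le_sum_parts hp
  have ha : 0 < k * α + ϑ := by nlinarith
  have hb : 0 < ∑ j, (parts j : ℝ) + ϑ := by nlinarith
  have hGa := Real.Gamma_pos_of_pos ha
  have hGb := Real.Gamma_pos_of_pos hb
  have hr : 0 ≤ ∏ j, risingWeight α (parts j) := (prod_risingWeight_fin_pos h1 hp).le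
  have hσ0 := ae_stableValue_ne_zero h1
  have hσt := ae_stableValue_ne_top h0 h1
  have hσm := measurable_stableValue α
  have hdm : Measurable fun E => distinctSum parts (stableJump α E) :=
    (measurable_distinctSum parts).comp (measurable_stableJump α)
  rw [lintegral_PDStar hϑ.ne' (measurable_distinctSum parts)]
  have e1 : ∫⁻ E, stableValue α E ^ (-ϑ) *
      distinctSum parts (fun i => stableJump α E i / stableValue α E) ∂expSeq =
      ∫⁻ E, distinctSum parts (stableJump α E) *
        stableValue α E ^ (-(∑ j, (parts j : ℝ) + ϑ)) ∂expSeq := by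
    refine lintegral_congr_ae ?_
    filter_upwards [hσ0, hσt] with E hE0 hEt
    rw [distinctSum_div, mul_left_comm, neg_add, ENNReal.rpow_add _ _ hE0 hEt, mul_comm (_ ^ (-ϑ)),
      ENNReal.rpow_neg _ (∑ j, (parts j : ℝ)), ← Nat.cast_sum, ENNReal.rpow_natCast, ENNReal.inv_pow]
  have e2 := lintegral_rpow_mul_laplace hb hσm hdm hσ0 hσt
  have e3 := lintegral_rpow_mul_laplace ha hσm measurable_one hσ0 hσt
  have e4 : ∫⁻ l in Set.Ioi (0 : ℝ), ENNReal.ofReal (l ^ (∑ j, (parts j : ℝ) + ϑ - 1)) *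
        ∫⁻ E, distinctSum parts (stableJump α E) *
          expNeg (ENNReal.ofReal l * stableValue α E) ∂expSeq =
      ENNReal.ofReal (α ^ k * ∏ j, risingWeight α (parts j)) *
        ∫⁻ l in Set.Ioi (0 : ℝ), ENNReal.ofReal (l ^ (k * α + ϑ - 1)) *
          ∫⁻ E, (1 : (ℕ → ℝ) → ℝ≥0∞) E *
            expNeg (ENNReal.ofReal l * stableValue α E) ∂expSeq := by
    rw [← lintegral_const_mul' _ _ ENNReal.ofReal_ne_top]
    refine setLIntegral_congr_fun measurableSet_Ioi fun l hl => ?_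
    have hl : 0 < l := hl
    rw [lintegral_distinctSum_mul_laplace h0 h1 hp hl, mul_left_comm]
    congr 1
    rw [← mul_assoc, ← ENNReal.ofReal_mul (by positivity), ← Real.rpow_add hl]
    simp only [Pi.one_apply, one_mul]
    congr 3
    rw [Nat.cast_sum]
    ring
  rw [e2, e3] at e4
  simp only [Pi.one_apply, one_mul] at e4
  rw [e1]
  have e5 : ENNReal.ofReal (Real.Gamma (∑ j, (parts j : ℝ) + ϑ))⁻¹ *
      ENNReal.ofReal (Real.Gamma (∑ j, (parts j : ℝ) + ϑ)) = 1 := by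
    rw [← ENNReal.ofReal_mul (by positivity), inv_mul_cancel₀ hGb.ne', ENNReal.ofReal_one]
  generalize ∏ j, risingWeight α (parts j) = r at *
  rw [← one_mul (lintegral _ _), ← e5, mul_assoc, e4, mul_comm _ (ENNReal.ofReal (_ / _)),
    ← mul_assoc, ← mul_assoc, ← mul_assoc, Nat.cast_sum]
  generalize Real.Gamma (∑ j, (parts j : ℝ) + ϑ) = b at *
  generalize Real.Gamma (k * α + ϑ) = c at *
  rw [← ENNReal.ofReal_mul (by positivity), ← ENNReal.ofReal_mul (by positivity),
    ← ENNReal.ofReal_mul (by positivity)]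
  congr 2
  ring

theorem lintegral_stableValue_rpow_ne_zero (h0 : 0 < α) (h1 : α < 1) {a : ℝ} (ha : 0 < a) :
    ∫⁻ E, stableValue α E ^ (-a) ∂expSeq ≠ 0 := by
  intro h
  rw [lintegral_eq_zero_iff ((measurable_stableValue α).pow_const _)] at h
  have : ∀ᵐ _ ∂expSeq, False := by
    filter_upwards [h, ae_stableValue_ne_top h0 h1] with E hE hEt
    have hE : stableValue α E ^ (-a) = 0 := hE
    rw [ENNReal.rpow_eq_zero_iff] at hE
    obtain ⟨-, h⟩ | ⟨h, -⟩ := hE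
    · linarith
    · exact hEt h
  exact absurd (Filter.eventually_false_iff_eq_bot.1 this) (ae_neBot.2 (NeZero.ne _)).ne

/-- The value of the subordinator is at least its largest jump, which has all negative moments. -/
theorem lintegral_stableValue_rpow_ne_top (h0 : 0 < α) (h1 : α < 1) {a : ℝ} (ha : 0 < a) :
    ∫⁻ E, stableValue α E ^ (-a) ∂expSeq ≠ ∞ := by
  have hG : 0 < Real.Gamma (1 - α) := Real.Gamma_pos_of_pos (by linarith)
  have hm : Measurable fun x : ℝ => ENNReal.ofReal (Real.Gamma (1 - α) ^ (a / α) * x ^ (a / α)) := by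
    fun_prop
  have hle : ∫⁻ E, stableValue α E ^ (-a) ∂expSeq ≤
      ∫⁻ E : ℕ → ℝ, ENNReal.ofReal (Real.Gamma (1 - α) ^ (a / α) * E 0 ^ (a / α)) ∂expSeq := by
    refine lintegral_mono_ae ?_
    filter_upwards [ae_expSeq_pos] with E hE
    have hx := hE 0
    have e : stableJump α E 0 = ENNReal.ofReal ((Real.Gamma (1 - α) * E 0) ^ (-1 / α)) := by
      simp [stableJump]
    calc stableValue α E ^ (-a) ≤ stableJump α E 0 ^ (-a) := by
          rw [ENNReal.rpow_neg, ENNReal.rpow_neg]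
          exact ENNReal.inv_le_inv.2 (ENNReal.rpow_le_rpow (ENNReal.le_tsum 0) ha.le)
      _ = _ := by
          rw [e, ENNReal.ofReal_rpow_of_pos (by positivity), ← Real.rpow_mul (by positivity),
            Real.mul_rpow hG.le hx.le]
          congr 3 <;> (field_simp)
  refine ne_top_of_le_ne_top ?_ hle
  have hev := measurePreserving_eval_infinitePi (fun _ : ℕ => expMeasure 1) 0
  have h := hev.lintegral_comp hm
  refine (h.trans_ne ?_)
  rw [lintegral_expMeasure hm]
  have h := lintegral_rpow_mul_exp (a := a / α + 1) (r := 1) (by positivity) one_pos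
  have e : ∫⁻ x in Set.Ioi (0 : ℝ), ENNReal.ofReal (Real.exp (-x)) *
      ENNReal.ofReal (Real.Gamma (1 - α) ^ (a / α) * x ^ (a / α)) =
      ∫⁻ x in Set.Ioi (0 : ℝ), ENNReal.ofReal (Real.Gamma (1 - α) ^ (a / α)) *
        ENNReal.ofReal (x ^ (a / α + 1 - 1) * Real.exp (-(1 * x))) := by
    refine lintegral_congr fun x => ?_
    rw [← ENNReal.ofReal_mul (Real.exp_pos _).le, ← ENNReal.ofReal_mul (by positivity),
      add_sub_cancel_right, one_mul]
    congr 1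
    ring
  rw [e, lintegral_const_mul' _ _ ENNReal.ofReal_ne_top, h]
  exact ENNReal.mul_ne_top ENNReal.ofReal_ne_top ENNReal.ofReal_ne_top

/-- The weights `w k` are negative moments of the value of the subordinator; they need not be
evaluated. -/
theorem hasGibbsMoments_PDStar (h0 : 0 < α) (h1 : α < 1) (hϑ : -2 * α < ϑ) :
    HasGibbsMoments α ϑ (PDStar α ϑ) fun k => ENNReal.ofReal (α ^ k * Real.Gamma (k * α + ϑ)) *
      ∫⁻ E, stableValue α E ^ (-(k * α + ϑ)) ∂expSeq where
  antitone := ae_PDStar hϑ.ne' measurableSet_antitone <| by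
    filter_upwards [ae_stableJump_antitone h0 h1] with E hE i j hij
    exact ENNReal.div_le_div_right (hE hij) _
  sum_eq := ae_PDStar hϑ.ne' measurableSet_tsum_eq_one <| by
    filter_upwards [ae_stableValue_ne_zero h1, ae_stableValue_ne_top h0 h1] with E hE0 hEt
    simp only [div_eq_mul_inv]
    rw [ENNReal.tsum_mul_right]
    exact ENNReal.mul_inv_cancel hE0 hEt
  ne_zero := ae_PDStar hϑ.ne' (measurableSet_apply_ne_zero 1) <| by
    filter_upwards [ae_stableJump_ne_zero h1, ae_stableValue_ne_top h0 h1] with E hE hEt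
    exact ENNReal.div_ne_zero.2 ⟨hE 1, hEt⟩
  moment := fun k parts hk hp => lintegral_distinctSum_PDStar h0 h1 hϑ hk parts hp
  two_ne_zero := by
    have ha : 0 < ((2 : ℕ) : ℝ) * α + ϑ := by push_cast; linarith
    have := Real.Gamma_pos_of_pos ha
    refine mul_ne_zero ?_ (lintegral_stableValue_rpow_ne_zero h0 h1 ha)
    rw [ne_eq, ENNReal.ofReal_eq_zero, not_le]
    positivity
  two_ne_top := ENNReal.mul_ne_top ENNReal.ofReal_ne_top
    (lintegral_stableValue_rpow_ne_top h0 h1 (by push_cast; linarith))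

end Stable

end AlphaGamma

theorem theorem2 (α γ : ℝ) (hγ : 0 ≤ γ) (hγα : γ ≤ α) (hα : α ≤ 1) :
    (AlphaGamma.IsMarkovBranching (AlphaGamma.shapeLaw α γ) (AlphaGamma.splittingRule α γ) ∧
      AlphaGamma.SamplingConsistent (AlphaGamma.shapeLaw α γ)) ∧
    (α < 1 →
      AlphaGamma.HasIntegralRepresentation (AlphaGamma.splittingRule α γ)
        (AlphaGamma.alphaGammaMeasure α γ)) := by
  have h : AlphaGamma.IsParam α γ := ⟨hγ, hγα, hα⟩
  refine ⟨⟨AlphaGamma.isMarkovBranching h, AlphaGamma.samplingConsistent h⟩, fun hα1 => ?_⟩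
  obtain rfl | hlt := hγα.eq_or_lt
  · have hμ := AlphaGamma.hasGibbsMoments_binaryMeasure hα1
    rw [← AlphaGamma.PDStar_of_eq] at hμ
    exact hμ.hasIntegralRepresentation h hα1
  · exact (AlphaGamma.hasGibbsMoments_PDStar (hγ.trans_lt hlt) hα1
      (by linarith)).hasIntegralRepresentation h hα1
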